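/- **Multi-segment Hamiltonian simulation by a truncated Dyson series.** *Setting.* Let $t\ge 0$, $\alpha>0$, $\epsilon>0$, and let $H:[0,t]\to\mathbb C^{2^{n_s}\times 2^{n_s}}$ be Hermitian-valued and differentiable with integrable derivative, $\max_s\|H(s)\|\le h\le\alpha$ and $\langle\|\dot H\|\rangle=\frac1t\int_0^t\|\dot H(s)\|\,ds\le D$ (spectral norm). Its time-ordered exponential is $$\mathcal T\big[e^{-i\int_0^tH(s)\,ds}\big]=\sum_{k\ge0}(-i)^k\int_{0\le t_1\le\dots\le t_k\le t}H(t_k)\cdots H(t_1)\,dt_1\cdots dt_k .$$ Put $L=\lceil 2\alpha t\rceil$, $\tau=t/L$ and, for $1\le j\le L$, $H_j(s)=H((j-1)\tau+s)$ on $[0,\tau]$. Segment $j$ is accessed through a unitary oracle $\mathrm{HAM\text{-}T}_j$ on $\mathbb C^M\otimes\mathbb C^{2^{n_a}}\otimes\mathbb C^{2^{n_s}}$ with $$(\langle0|_a\otimes 1)\,\mathrm{HAM\text{-}T}_j\,(|0\rangle_a\otimes 1)=\sum_{m=0}^{M-1}|m\rangle\langle m|\otimes\frac{H_j(m\tau/M)}{\alpha}.$$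 The time index is stored in $\lceil\log_2M\rceil$ qubits, and the oracle acts as the identity on unused indices. A circuit is a sequence of primitive gates (arbitrary unitaries on at most two qubits, and single-qubit computational-basis measurements whose outcome $1$ means failure) and of queries to the $\mathrm{HAM\text{-}T}_j$ or their inverses, possibly controlled by one qubit, each counted as one query. All non-system qubits start in $|0\rangle$ and must be found in $|0\rangle$ at the end; $W$ is the resulting (unnormalised) operator on the system upon success, and on a unit vector $\psi$ the failure probability is $1-\|W\psi\|^2$. Write $$X=\frac{t}{\alpha\epsilon}\,(D+h^2),\qquad \ell=\frac{\log r}{\log\log r}\ \text{ with }\ r=\max\{\alpha t/\epsilon,\,16\}.$$ *Claim.* There are absolute constants $c_0,c_f>0$, and for every $C_1$ a constant $C>0$, such that for all $n_s,n_a\ge 0$, $\alpha>0$, $t\ge0$, $\epsilon>0$, $D\ge0$, $0\le h\le\alpha$ and every integer $M\ge1$ with $c_0X\le M\le C_1\max\{X,1\}$ there is a circuit, depending only on these parameters (not on $H$ or the oracles), with 1. at most $C\max\{\alpha t,1\}\,\ell$ queries to all $\mathrm{HAM\text{-}T}_j$ together, 2. at most $n_s+C\,(n_a+\log\max\{X,2\})$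 qubits, 3. at most $C\max\{\alpha t,1\}\,(n_a+\log\max\{X,2\})\,\ell$ primitive gates, such that for every $H$ as above and all oracles $\mathrm{HAM\text{-}T}_j$ encoding its segments, the implemented operation $W$ satisfies $\big\|W-\mathcal T[e^{-i\int_0^tH(s)\,ds}]\big\|\le\epsilon$, and its failure probability is at most $c_f\,\epsilon$ on every input state. -/

import Mathlib

open scoped Matrix.Norms.L2Operator

namespace DysonSim

noncomputable section

/-- Labels of the computational basis of the qubits indexed by `k`. -/
abbrev Label (k : Type) : Type := k → Bool

/-- Operators on the Hilbert space of the qubits indexed by `k` (dimension `2 ^ card k`), written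
in the computational basis; the norm on them is the spectral norm. -/
abbrev QOp (k : Type) : Type := Matrix (Label k) (Label k) ℂ

/-- The label of the state in which all qubits are `0`. -/
def zeroLabel (k : Type) : Label k := fun _ => false

/-! ### Time-dependent Hamiltonians -/

/-- The `k`-th Dyson term, the integral over `0 ≤ t₁ ≤ ⋯ ≤ tₖ ≤ s` of `H(tₖ) ⋯ H(t₁)`, written as
an iterated integral whose outermost variable is the latest time. -/
def dysonTerm {n : ℕ} (H : ℝ → QOp (Fin n)) : ℕ → ℝ → QOp (Fin n)
  | 0, _ => 1
  | k + 1, s => ∫ u in (0 : ℝ)..s, H u * dysonTerm H k u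

/-- The time-ordered exponential `𝒯 exp (-i ∫₀ᵗ H(s) ds)`, as its Dyson series. -/
def timeOrderedExp {n : ℕ} (H : ℝ → QOp (Fin n)) (t : ℝ) : QOp (Fin n) :=
  ∑' k : ℕ, (-Complex.I) ^ k • dysonTerm H k t

/-- The average rate of change `(1 / t) ∫₀ᵗ ‖H'(s)‖ ds`. -/
def avgDerivNorm {n : ℕ} (H : ℝ → QOp (Fin n)) (t : ℝ) : ℝ :=
  (1 / t) * ∫ s in (0 : ℝ)..t, ‖derivWithin H (Set.Icc 0 t) s‖

/-- `H` is a Hamiltonian on `[0, t]`: Hermitian and differentiable there, with integrable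
derivative. -/
structure IsHamiltonianOn {n : ℕ} (H : ℝ → QOp (Fin n)) (t : ℝ) : Prop where
  hermitian : ∀ s ∈ Set.Icc 0 t, (H s).IsHermitian
  differentiable : DifferentiableOn ℝ H (Set.Icc 0 t)
  integrable : IntervalIntegrable (derivWithin H (Set.Icc 0 t)) MeasureTheory.volume 0 t

/-! ### The oracles -/

/-- Operators on `ℂ^M ⊗ (ℂ²)^{⊗ na} ⊗ (ℂ²)^{⊗ ns}`: time index, ancilla register `a`, system. -/
abbrev OracleOp (ns na M : ℕ) : Type :=
  Matrix (Fin M × Label (Fin na) × Label (Fin ns)) (Fin M × Label (Fin na) × Label (Fin ns)) ℂ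

/-- `U` is an oracle HAM-T for `H` on `[0, τ]`: it is unitary and
`(⟨0|_a ⊗ 1) U (|0⟩_a ⊗ 1) = ∑ m, |m⟩⟨m| ⊗ H(m τ / M) / α`. -/
structure IsHamT {ns na M : ℕ} (H : ℝ → QOp (Fin ns)) (τ α : ℝ) (U : OracleOp ns na M) :
    Prop where
  unitary : U ∈ Matrix.unitaryGroup (Fin M × Label (Fin na) × Label (Fin ns)) ℂ
  block : ∀ (m m' : Fin M) (x y : Label (Fin ns)),
    U (m, zeroLabel (Fin na), x) (m', zeroLabel (Fin na), y) =
      if m = m' then H ((m : ℝ) * τ / (M : ℝ)) x y / (α : ℂ) else 0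

/-- The qubits an oracle acts on: the time index in binary (`Nat.clog 2 M` qubits), the ancilla
register `a`, and the system. -/
abbrev OracleWires (ns na M : ℕ) : Type := Fin (Nat.clog 2 M) ⊕ Fin na ⊕ Fin ns

/-- The time index written (least significant bit first) in the first register. -/
def timeIndex {ns na M : ℕ} (x : Label (OracleWires ns na M)) : ℕ :=
  ∑ i, if x (Sum.inl i) then 2 ^ (i : ℕ) else 0

/-- The oracle as an operator on qubits: it acts as `U` where the binary time index is below `M`
and as the identity on the unused time indices. -/
def oracleOnQubits {ns na M : ℕ} (U : OracleOp ns na M) : QOp (OracleWires ns na M) :=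
  fun x y =>
    if h : timeIndex x < M ∧ timeIndex y < M then
      U (⟨timeIndex x, h.1⟩, fun i => x (Sum.inr (Sum.inl i)), fun i => x (Sum.inr (Sum.inr i)))
        (⟨timeIndex y, h.2⟩, fun i => y (Sum.inr (Sum.inl i)), fun i => y (Sum.inr (Sum.inr i)))
    else if x = y then 1 else 0

/-! ### Query circuits -/

/-- The operator `A` on the qubits `k`, acting on the wires `e '' k` of a larger set `w` of wires,
and as the identity on all other wires. -/
def onWires {k w : Type} (e : k ↪ w) (A : QOp k) : QOp w := by
  classical
  exact fun x y =>
    if ∀ i, i ∉ Set.range e → x i = y i then A (fun i => x (e i)) (fun i => y (e i)) else 0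

/-- The operator `A` controlled by one extra qubit, `none`: it is applied iff this qubit is `1`. -/
def controlled {k : Type} (A : QOp k) : QOp (Option k) := by
  classical
  exact fun x y =>
    if x none = y none then
      if x none = true then A (fun i => x (some i)) (fun i => y (some i))
      else if x = y then 1 else 0
    else 0

/-- The projector onto the states in which qubit `q` is `0`. -/
def projZero {w : Type} (q : w) : QOp w := by
  classical
  exact fun x y => if x = y ∧ x q = false then 1 else 0

/-- One instruction of a circuit on the wires `w` with access to `L` oracles.
* `gate`: an arbitrary unitary on at most two qubits;
* `query j inv`: a query to oracle `j`, or to its inverse if `inv = true`;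
* `cquery j inv`: the same, controlled by one further qubit;
* `check q`: measure qubit `q` in the computational basis; outcome `0` continues and outcome `1`
  is a failure. -/
inductive Instr (ns na M L : ℕ) (w : Type) : Type
  | gate (k : ℕ) (hk : k ≤ 2) (e : Fin k ↪ w) (U : Matrix.unitaryGroup (Label (Fin k)) ℂ)
  | query (j : Fin L) (inv : Bool) (e : OracleWires ns na M ↪ w)
  | cquery (j : Fin L) (inv : Bool) (e : Option (OracleWires ns na M) ↪ w)
  | check (q : w)

/-- The oracle on qubits, or its inverse if `inv = true`. -/
def oracleOrInv {ns na M : ℕ} (U : OracleOp ns na M) (inv : Bool) : QOp (OracleWires ns na M) :=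
  if inv then (oracleOnQubits U).conjTranspose else oracleOnQubits U

namespace Instr

variable {ns na M L : ℕ} {w : Type}

/-- The (unnormalised) operator that an instruction applies if it does not fail. -/
def op (O : Fin L → OracleOp ns na M) : Instr ns na M L w → QOp w
  | gate _ _ e U => onWires e (U : QOp _)
  | query j inv e => onWires e (oracleOrInv (O j) inv)
  | cquery j inv e => onWires e (controlled (oracleOrInv (O j) inv))
  | check q => projZero q

/-- Queries, controlled or not, forward or inverse, cost one each. -/
def queries : Instr ns na M L w → ℕ
  | gate _ _ _ _ => 0
  | query _ _ _ => 1
  | cquery _ _ _ => 1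
  | check _ => 0

/-- Primitive gates: gates on at most two qubits, and single-qubit measurements. -/
def gates : Instr ns na M L w → ℕ
  | gate _ _ _ _ => 1
  | query _ _ _ => 0
  | cquery _ _ _ => 0
  | check _ => 1

end Instr

/-- A circuit on `ns` system qubits and `anc` further qubits; the head of the list is the first
instruction to be executed. It names oracles, but does not depend on what they are. -/
abbrev Circuit (ns na M L anc : ℕ) : Type := List (Instr ns na M L (Fin ns ⊕ Fin anc))

namespace Circuit

variable {ns na M L anc : ℕ}

/-- The operator applied by the whole circuit if no measurement fails. -/
def op (O : Fin L → OracleOp ns na M) : Circuit ns na M L anc → QOp (Fin ns ⊕ Fin anc)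
  | [] => 1
  | i :: c => op O c * i.op O

/-- The number of queries, summed over all oracles. -/
def queries (c : Circuit ns na M L anc) : ℕ := (c.map Instr.queries).sum

/-- The number of primitive gates. -/
def gates (c : Circuit ns na M L anc) : ℕ := (c.map Instr.gates).sum

/-- The total number of qubits of a circuit, system included. -/
def qubits (_ : Circuit ns na M L anc) : ℕ := ns + anc

/-- The operation `W = (⟨0| ⊗ 1) C (|0⟩ ⊗ 1)` that the circuit implements on the system upon
success: all other qubits start in `0`, all measurements of the circuit give `0`, and the final
measurement of the other qubits gives `0`. -/
def implemented (O : Fin L → OracleOp ns na M) (c : Circuit ns na M L anc) : QOp (Fin ns) :=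
  fun x y => op O c (Sum.elim x (zeroLabel (Fin anc))) (Sum.elim y (zeroLabel (Fin anc)))

/-- The failure probability on the input state `ψ` (a unit vector): by the Born rule, success has
probability `‖W ψ‖ ^ 2`. -/
def failureProb (O : Fin L → OracleOp ns na M) (c : Circuit ns na M L anc)
    (ψ : EuclideanSpace ℂ (Label (Fin ns))) : ℝ :=
  1 - ‖Matrix.toEuclideanLin (implemented O c) ψ‖ ^ 2

end Circuit

/-! ### Cost functions -/

/-- `log r / log log r` for `r ≥ 16`, extended by its value at `16` to smaller `r`. -/
def logOverLogLog (r : ℝ) : ℝ :=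
  Real.log (max r 16) / Real.log (Real.log (max r 16))

/-- The quantity `(t / (α ε)) (D + h²)` that governs the number of time steps, where `D` bounds the
average rate of change and `h` the norm of the Hamiltonian. -/
def stepScale (α t ε D h : ℝ) : ℝ := t / (α * ε) * (D + h ^ 2)

end

end DysonSim

/-! Cut each segment, of length τ with ατ ≤ 1/2, into M cells of length δ = τ/M. For the exact
propagator U and a fixed time a, the backward evolution E(s) = U(a)U(s)ᴴ solves E' = E·(iH). It is
unitary, so one Euler step costs only (h²δ + ∫‖H'‖)δ with the integral over one cell
(`norm_euler_step_le`). Summed over all cells this is δ(h²t + ∫‖H'‖), which is why the average rate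
of change, and not its maximum, governs M. Hence E nearly satisfies the discrete integral equation
E(m) = 1 + δ ∑_{j<m} E(j)·iH_j. Iterating that equation n times from a bounded start gives a
truncated series that differs from E by at most twice the accumulated Euler error plus
3(hδ)ⁿ·binom(m,n), hence by O((hτ)ⁿ/n!) in the tail (`norm_discrete_sub_le`).

The iteration is what a nested circuit computes. In Horner form, Y_{n+1}(m) is the identity plus a
sum over j < m of Y_n(j) times the block at j. So the circuit is a descending walk: at a level it
prepares a superposed new index, compares it with the old one, unprepares the old one, queries, and
flags every dirty outcome (`mul_stepOp_apply`). A unary counter, rotated before and after the deeper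
levels, decides whether the walk goes on; it contributes 1 - p for stopping and i·p for continuing
(`outRow_mul_levelOp`). Only two time registers are needed, whatever the truncation order. Since the
walk descends from M - 1, no surviving branch queries an unused index. The latest Hamiltonian acts
first, which is why the encoded operator is a backward evolution.

A uniform superposition of a power of two many indices is a product state. Each segment is therefore
split into two pieces, the indices below N = 2^(⌈log₂ M⌉ - 1) and those from N on, each served by
one-qubit gates with the same p = αδN ≤ 1/2. The encoded block is (1 - p)Y with Y close to a unitary
E. A padding rotation rescales it to exactly Y/2, and one round of amplitude amplification gives
(3Yᴴ - YᴴYYᴴ)/2, close to the forward evolution Eᴴ (`ampOp_apply`, `norm_amplified_sub_le`). All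
ancillas are measured after each piece, so what the pieces implement multiplies
(`implemented_append_checks`). Blocks of unitaries are contractions, so errors add
(`exists_circuit_aux`).

It remains to choose the truncation order (`exists_order`). The counter is unary, so K + 1 has to be
O(log X) as well as O(log r / log log r) with r = αt/ε. If r < X² up to constants the second bound
implies the first. Otherwise X, and with it (h/α)² ≤ X/r, is so small that order four suffices.
Closeness to a unitary in norm finally bounds the failure probability (`one_sub_sq_norm_le`). -/

set_option linter.unusedSectionVars false

namespace DysonSim
open Matrix

/-! ### Operators acting on some of the wires, and controlled operators. -/

section Wires

variable {k v w : Type} [Fintype k] [DecidableEq k] [Fintype v] [DecidableEq v]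
  [Fintype w] [DecidableEq w]

theorem onWires_extend (e : k ↪ w) (A : QOp k) (z : Label k) (y : Label w) :
    onWires e A (Function.extend e z y) y = A z (y ∘ e) := by
  unfold onWires
  rw [if_pos]
  · congr 1
    funext i
    exact e.injective.extend_apply z y i
  · intro i hi
    exact Function.extend_apply' _ _ _ hi

theorem extend_injective (e : k ↪ w) (y : Label w) :
    Function.Injective (fun z : Label k => (Function.extend e z y : Label w)) := by
  intro z z' h
  funext i
  have := congrFun h (e i)
  simpa [e.injective.extend_apply] using this

theorem onWires_eq_zero (e : k ↪ w) (A : QOp k) (x y : Label w)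
    (h : x ∉ Set.range (fun z : Label k => (Function.extend e z y : Label w))) :
    onWires e A x y = 0 := by
  unfold onWires
  rw [if_neg]
  intro h'
  apply h
  refine ⟨fun i => x (e i), ?_⟩
  funext i
  by_cases hi : i ∈ Set.range e
  · obtain ⟨a, rfl⟩ := hi
    simp [e.injective.extend_apply]
  · rw [h' i hi]
    exact Function.extend_apply' _ _ _ hi

/-- Circuits are evaluated by pushing rows through them from the left. The column label y is then
rewritten by one factor after another, and only labels that agree with y off the range of e occur.
All later `mul_…_apply` lemmas have this shape. -/
theorem mul_onWires_apply {ι : Type} (ρ : Matrix ι (Label w) ℂ) (e : k ↪ w) (A : QOp k) (i : ι)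
    (y : Label w) :
    (ρ * onWires e A) i y = ∑ z : Label k, ρ i (Function.extend e z y) * A z (y ∘ e) := by
  rw [Matrix.mul_apply]
  symm
  refine Fintype.sum_of_injective _ (extend_injective e y) _ _ ?_ ?_
  · intro x hx
    rw [onWires_eq_zero e A x y hx, mul_zero]
  · intro z
    rw [onWires_extend]

theorem onWires_mul (e : k ↪ w) (A B : QOp k) :
    onWires e (A * B) = onWires e A * onWires e B := by
  ext x y
  rw [mul_onWires_apply]
  by_cases h : ∀ i, i ∉ Set.range e → x i = y i
  · simp only [onWires, if_pos h, Matrix.mul_apply]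
    refine Finset.sum_congr rfl fun z _ => ?_
    rw [if_pos]
    · congr 2
      funext i
      exact (e.injective.extend_apply z y i).symm
    · intro i hi
      rw [h i hi]
      exact (Function.extend_apply' _ _ _ hi).symm
  · simp only [onWires, if_neg h]
    symm
    refine Finset.sum_eq_zero fun z _ => ?_
    rw [if_neg, zero_mul]
    intro h'
    apply h
    intro i hi
    rw [h' i hi]
    exact Function.extend_apply' _ _ _ hi

theorem onWires_one (e : k ↪ w) : onWires e (1 : QOp k) = 1 := by
  ext x y
  unfold onWires
  by_cases hxy : x = y
  · subst hxy
    simp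
  · rw [Matrix.one_apply_ne hxy]
    split_ifs with h
    · rw [Matrix.one_apply_ne]
      intro h'
      apply hxy
      funext i
      by_cases hi : i ∈ Set.range e
      · obtain ⟨a, rfl⟩ := hi
        exact congrFun h' a
      · exact h i hi
    · rfl

theorem onWires_conjTranspose (e : k ↪ w) (A : QOp k) :
    (onWires e A)ᴴ = onWires e Aᴴ := by
  ext x y
  rw [Matrix.conjTranspose_apply]
  unfold onWires
  by_cases h : ∀ i, i ∉ Set.range e → x i = y i
  · rw [if_pos h, if_pos fun i hi => (h i hi).symm]
    rfl
  · rw [if_neg h, if_neg fun h' => h fun i hi => (h' i hi).symm, star_zero]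

theorem onWires_unitary (e : k ↪ w) {A : QOp k} (hA : A ∈ unitaryGroup (Label k) ℂ) :
    onWires e A ∈ unitaryGroup (Label w) ℂ := by
  rw [mem_unitaryGroup_iff, star_eq_conjTranspose, onWires_conjTranspose, ← onWires_mul,
    ← star_eq_conjTranspose, mem_unitaryGroup_iff.1 hA, onWires_one]

theorem controlled_mul (A B : QOp k) : controlled (A * B) = controlled A * controlled B := by
  have key : ∀ (C : QOp k) (a c : Bool) (x y : Label k),
      controlled C (fun o => o.elim a x) (fun o => o.elim c y) =
        if a = c then (if a then C x y else (1 : QOp k) x y) else 0 := by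
    intro C a c x y
    unfold controlled
    have : ((fun o : Option k => o.elim a x) = fun o => o.elim c y) ↔ a = c ∧ x = y := by
      constructor
      · intro h
        exact ⟨congrFun h none, funext fun i => congrFun h (some i)⟩
      · rintro ⟨rfl, rfl⟩
        rfl
    rw [Matrix.one_apply]
    simp only [this]
    by_cases h : a = c <;> simp [h]
  let E : Bool × Label k → Label (Option k) := fun p o => o.elim p.1 p.2
  have hE : Function.Bijective E := by
    constructor
    · rintro ⟨a, x⟩ ⟨c, y⟩ h
      have h1 := congrFun h none
      have h2 : x = y := funext fun i => congrFun h (some i)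
      exact Prod.ext h1 h2
    · intro x
      refine ⟨(x none, fun i => x (some i)), ?_⟩
      funext o
      cases o <;> rfl
  ext x y
  obtain ⟨⟨a, x⟩, rfl⟩ := hE.2 x
  obtain ⟨⟨c, y⟩, rfl⟩ := hE.2 y
  rw [Matrix.mul_apply, ← hE.sum_comp (fun z => controlled A (E (a, x)) z * controlled B z (E (c, y))),
    Fintype.sum_prod_type]
  simp only [E, key]
  rw [Finset.sum_eq_single a]
  · by_cases h : a = c
    · subst h
      cases a
      · simp [Matrix.one_apply]
      · simp [Matrix.mul_apply]
    · simp [h]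
  · intro d _ hd
    simp [Ne.symm hd]
  · simp

theorem controlled_one : controlled (1 : QOp k) = 1 := by
  ext x y
  unfold controlled
  by_cases hxy : x = y
  · subst hxy
    simp
  · rw [Matrix.one_apply_ne hxy]
    split_ifs with h h'
    · rw [Matrix.one_apply_ne]
      intro h2
      apply hxy
      funext o
      cases o with
      | none => exact h
      | some i => exact congrFun h2 i
    · rfl
    · rfl

theorem controlled_conjTranspose (A : QOp k) : (controlled A)ᴴ = controlled Aᴴ := by
  ext x y
  rw [Matrix.conjTranspose_apply]
  unfold controlled
  by_cases h : x none = y none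
  · by_cases h1 : x none = true
    · simp [h1, ← h]
    · by_cases h2 : x = y
      · subst h2
        simp [h1]
      · simp [h1, h2, ← h, Ne.symm h2]
  · simp [h, Ne.symm h]

theorem controlled_unitary {A : QOp k} (hA : A ∈ unitaryGroup (Label k) ℂ) :
    controlled A ∈ unitaryGroup (Label (Option k)) ℂ := by
  rw [mem_unitaryGroup_iff, star_eq_conjTranspose, controlled_conjTranspose, ← controlled_mul,
    ← star_eq_conjTranspose, mem_unitaryGroup_iff.1 hA, controlled_one]

theorem projZero_conjTranspose (q : w) : (projZero q)ᴴ = projZero q := by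
  ext x y
  rw [Matrix.conjTranspose_apply]
  unfold projZero
  by_cases h : x = y
  · subst h
    split_ifs <;> simp
  · simp [h, Ne.symm h]

end Wires

/-! ### Binary expansions, and unitarity of the oracle on qubits. -/

section BinaryValue

/-- The number with binary digits `z`, least significant first. -/
def binVal {b : ℕ} (z : Label (Fin b)) : ℕ := ∑ i, if z i then 2 ^ (i : ℕ) else 0

theorem binVal_succ {b : ℕ} (z : Label (Fin (b + 1))) :
    binVal z = (if z 0 then 1 else 0) + 2 * binVal (fun i => z i.succ) := by
  unfold binVal
  rw [Fin.sum_univ_succ, Finset.mul_sum]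
  congr 1
  refine Finset.sum_congr rfl fun i _ => ?_
  split_ifs <;> simp [pow_succ, mul_comm]

theorem binVal_castSucc {b : ℕ} (z : Label (Fin (b + 1))) :
    binVal z = binVal (fun i : Fin b => z i.castSucc) + if z (Fin.last b) then 2 ^ b else 0 := by
  unfold binVal
  rw [Fin.sum_univ_castSucc]
  simp

theorem binVal_lt {b : ℕ} (z : Label (Fin b)) : binVal z < 2 ^ b := by
  induction b with
  | zero => simp [binVal]
  | succ b ih =>
    rw [binVal_succ, pow_succ]
    have := ih fun i => z i.succ
    split_ifs <;> omega

theorem binVal_injective {b : ℕ} : Function.Injective (binVal : Label (Fin b) → ℕ) := by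
  induction b with
  | zero => intro z z' _; funext i; exact i.elim0
  | succ b ih =>
    intro z z' h
    rw [binVal_succ, binVal_succ] at h
    have h0 : z 0 = z' 0 := by
      cases h1 : z 0 <;> cases h2 : z' 0 <;> simp [h1, h2] at h ⊢ <;> omega
    have h1 : binVal (fun i => z i.succ) = binVal (fun i => z' i.succ) := by
      rw [h0] at h; omega
    have h2 := ih h1
    funext i
    refine Fin.cases h0 (fun j => congrFun h2 j) i

theorem exists_binVal_eq {b m : ℕ} (hm : m < 2 ^ b) : ∃ z : Label (Fin b), binVal z = m := by
  let f : Label (Fin b) → Fin (2 ^ b) := fun z => ⟨binVal z, binVal_lt z⟩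
  have hf : Function.Bijective f := by
    rw [Fintype.bijective_iff_injective_and_card]
    refine ⟨fun z z' h => binVal_injective (Fin.ext_iff.1 h), by simp⟩
  obtain ⟨z, hz⟩ := hf.2 ⟨m, hm⟩
  exact ⟨z, Fin.ext_iff.1 hz⟩

end BinaryValue

section Oracle

variable {ns na M : ℕ}

theorem timeIndex_eq (x : Label (OracleWires ns na M)) :
    timeIndex x = binVal (fun i => x (Sum.inl i)) := rfl

/-- The used labels of the oracle qubits. -/
def usedLabel (ns na M : ℕ) :
    {x : Label (OracleWires ns na M) // timeIndex x < M} →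
      Fin M × Label (Fin na) × Label (Fin ns) :=
  fun x => (⟨timeIndex x.1, x.2⟩, fun i => x.1 (Sum.inr (Sum.inl i)),
    fun i => x.1 (Sum.inr (Sum.inr i)))

theorem usedLabel_bijective : Function.Bijective (usedLabel ns na M) := by
  constructor
  · rintro ⟨x, hx⟩ ⟨y, hy⟩ h
    simp only [usedLabel, Prod.mk.injEq, Fin.mk.injEq] at h
    obtain ⟨h1, h2, h3⟩ := h
    have h1' := binVal_injective h1
    refine Subtype.ext (funext fun i => ?_)
    rcases i with i | i | i
    · exact congrFun h1' i
    · exact congrFun h2 i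
    · exact congrFun h3 i
  · rintro ⟨m, a, s⟩
    have hm : (m : ℕ) < 2 ^ Nat.clog 2 M :=
      lt_of_lt_of_le m.2 (Nat.le_pow_clog one_lt_two M)
    obtain ⟨z, hz⟩ := exists_binVal_eq hm
    refine ⟨⟨Sum.elim z (Sum.elim a s), ?_⟩, ?_⟩
    · rw [timeIndex_eq]
      simpa using hz ▸ m.2
    · simp only [usedLabel, timeIndex_eq, Sum.elim_inl, Sum.elim_inr, Prod.mk.injEq, and_true]
      exact Fin.ext hz

/-- Sorting the labels into used and unused time indices makes the operator block diagonal, with a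
reindexed U and an identity as blocks; unitarity can be read off from this. -/
theorem oracleOnQubits_eq (U : OracleOp ns na M) :
    oracleOnQubits U =
      (fromBlocks (U.submatrix (usedLabel ns na M) (usedLabel ns na M)) 0 0
        (1 : Matrix {x : Label (OracleWires ns na M) // ¬ timeIndex x < M} _ ℂ)).submatrix
        (Equiv.sumCompl fun x : Label (OracleWires ns na M) => timeIndex x < M).symm
        (Equiv.sumCompl fun x : Label (OracleWires ns na M) => timeIndex x < M).symm := by
  ext x y
  unfold oracleOnQubits
  simp only [submatrix_apply]
  have hp : ∀ {z : Label (OracleWires ns na M)} (hz : timeIndex z < M),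
      (Equiv.sumCompl fun x : Label (OracleWires ns na M) => timeIndex x < M).symm z =
        Sum.inl ⟨z, hz⟩ := fun hz =>
    Equiv.sumCompl_symm_apply_of_pos
      (p := fun x : Label (OracleWires ns na M) => timeIndex x < M) hz
  have hn : ∀ {z : Label (OracleWires ns na M)} (hz : ¬ timeIndex z < M),
      (Equiv.sumCompl fun x : Label (OracleWires ns na M) => timeIndex x < M).symm z =
        Sum.inr ⟨z, hz⟩ := fun hz =>
    Equiv.sumCompl_symm_apply_of_neg
      (p := fun x : Label (OracleWires ns na M) => timeIndex x < M) hz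
  by_cases hx : timeIndex x < M <;> by_cases hy : timeIndex y < M
  · rw [hp hx, hp hy, dif_pos ⟨hx, hy⟩]
    rfl
  · rw [hp hx, hn hy, dif_neg (by tauto), if_neg (by rintro rfl; exact hy hx)]
    rfl
  · rw [hn hx, hp hy, dif_neg (by tauto), if_neg (by rintro rfl; exact hx hy)]
    rfl
  · rw [hn hx, hn hy, dif_neg (by tauto), fromBlocks_apply₂₂, Matrix.one_apply]
    simp

theorem oracleOnQubits_unitary {U : OracleOp ns na M}
    (hU : U ∈ unitaryGroup (Fin M × Label (Fin na) × Label (Fin ns)) ℂ) :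
    oracleOnQubits U ∈ unitaryGroup (Label (OracleWires ns na M)) ℂ := by
  rw [mem_unitaryGroup_iff, star_eq_conjTranspose, oracleOnQubits_eq, conjTranspose_submatrix,
    submatrix_mul_equiv, fromBlocks_conjTranspose, fromBlocks_multiply, conjTranspose_submatrix]
  have h := submatrix_mul_equiv U Uᴴ (usedLabel ns na M) (Equiv.ofBijective _ usedLabel_bijective)
    (usedLabel ns na M)
  simp only [Equiv.coe_ofBijective] at h
  rw [h, ← star_eq_conjTranspose, mem_unitaryGroup_iff.1 hU]
  have h1 : (1 : OracleOp ns na M).submatrix (usedLabel ns na M) (usedLabel ns na M) = 1 :=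
    submatrix_one _ usedLabel_bijective.1
  simp [h1]

theorem oracleOrInv_not (U : OracleOp ns na M) (inv : Bool) :
    oracleOrInv U (!inv) = (oracleOrInv U inv)ᴴ := by
  cases inv <;> simp [oracleOrInv]

end Oracle

/-! ### Operator families implemented by circuits, with query and gate counts. -/

section Run

variable {ns na M L : ℕ} {w : Type} [Fintype w] [DecidableEq w]

/-- The operator applied by a list of instructions if no measurement fails. -/
noncomputable def run (O : Fin L → OracleOp ns na M) : List (Instr ns na M L w) → QOp w
  | [] => 1
  | i :: c => run O c * i.op O

theorem run_append (O : Fin L → OracleOp ns na M) (c d : List (Instr ns na M L w)) :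
    run O (c ++ d) = run O d * run O c := by
  induction c with
  | nil => simp [run]
  | cons i c ih => simp [run, ih, Matrix.mul_assoc]

/-- The instruction that applies the adjoint operator. -/
noncomputable def Instr.adj : Instr ns na M L w → Instr ns na M L w
  | .gate k hk e U => .gate k hk e U⁻¹
  | .query j inv e => .query j (!inv) e
  | .cquery j inv e => .cquery j (!inv) e
  | .check q => .check q

theorem Instr.op_adj (O : Fin L → OracleOp ns na M) (i : Instr ns na M L w) :
    i.adj.op O = (i.op O)ᴴ := by
  cases i with
  | gate k hk e U =>
    simp only [Instr.adj, Instr.op, onWires_conjTranspose]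
    rfl
  | query j inv e => simp only [Instr.adj, Instr.op, onWires_conjTranspose, oracleOrInv_not]
  | cquery j inv e =>
    simp only [Instr.adj, Instr.op, onWires_conjTranspose, oracleOrInv_not,
      controlled_conjTranspose]
  | check q => simp only [Instr.adj, Instr.op, projZero_conjTranspose]

/-- The family `F` of operators is implemented by unitary instructions, with at most `q` queries
and at most `g` primitive gates. -/
def Impl (q g : ℕ) (F : (Fin L → OracleOp ns na M) → QOp w) : Prop :=
  ∃ c : List (Instr ns na M L w), (c.map Instr.queries).sum ≤ q ∧ (c.map Instr.gates).sum ≤ g ∧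
    (∀ O, run O c = F O) ∧
    ∀ O : Fin L → OracleOp ns na M, (∀ j, O j ∈ unitaryGroup _ ℂ) → F O ∈ unitaryGroup _ ℂ

variable {F G : (Fin L → OracleOp ns na M) → QOp w} {q q' g g' : ℕ}

theorem Impl.mono (h : Impl q g F) (hq : q ≤ q') (hg : g ≤ g') : Impl q' g' F := by
  obtain ⟨c, h1, h2, h3⟩ := h
  exact ⟨c, h1.trans hq, h2.trans hg, h3⟩

theorem Impl.one : Impl 0 0 (fun _ : Fin L → OracleOp ns na M => (1 : QOp w)) :=
  ⟨[], by simp, by simp, fun _ => rfl, fun _ _ => one_mem _⟩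

theorem Impl.mul (hF : Impl q g F) (hG : Impl q' g' G) :
    Impl (q + q') (g + g') (fun O => F O * G O) := by
  obtain ⟨c, h1, h2, h3, h4⟩ := hF
  obtain ⟨d, h1', h2', h3', h4'⟩ := hG
  refine ⟨d ++ c, ?_, ?_, fun O => ?_, fun O hO => mul_mem (h4 O hO) (h4' O hO)⟩
  · simp; omega
  · simp; omega
  · rw [run_append, h3, h3']

/-- Reversing the list and replacing each instruction by its adjoint changes no cost, because
inverse queries count like forward ones. -/
theorem Impl.adjoint (hF : Impl q g F) : Impl q g (fun O => (F O)ᴴ) := by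
  obtain ⟨c, h1, h2, h3, h4⟩ := hF
  refine ⟨(c.map Instr.adj).reverse, ?_, ?_, fun O => ?_, fun O hO => Unitary.star_mem (h4 O hO)⟩
  · rw [← List.map_reverse, List.map_map]
    refine le_of_eq_of_le ?_ h1
    rw [List.map_reverse, List.sum_reverse]
    congr 1
    refine List.map_congr_left fun i _ => ?_
    cases i <;> rfl
  · rw [← List.map_reverse, List.map_map]
    refine le_of_eq_of_le ?_ h2
    rw [List.map_reverse, List.sum_reverse]
    congr 1
    refine List.map_congr_left fun i _ => ?_
    cases i <;> rfl
  · simp only [← h3]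
    clear h4 h1 h2 h3
    induction c with
    | nil => simp [run]
    | cons i c ih =>
      rw [List.map_cons, List.reverse_cons, run_append, ih]
      simp [run, Instr.op_adj, Matrix.conjTranspose_mul]

theorem Impl.gate {k : ℕ} (hk : k ≤ 2) (e : Fin k ↪ w) {A : QOp (Fin k)}
    (hA : A ∈ unitaryGroup (Label (Fin k)) ℂ) :
    Impl 0 1 (fun _ : Fin L → OracleOp ns na M => onWires e A) :=
  ⟨[.gate k hk e ⟨A, hA⟩], by simp [Instr.queries], by simp [Instr.gates],
    fun O => by simp [run, Instr.op], fun _ _ => onWires_unitary e hA⟩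

theorem Impl.cquery (j : Fin L) (e : Option (OracleWires ns na M) ↪ w) :
    Impl 1 0 (fun O : Fin L → OracleOp ns na M => onWires e (controlled (oracleOnQubits (O j)))) :=
  ⟨[.cquery j false e], by simp [Instr.queries], by simp [Instr.gates],
    fun O => by simp [run, Instr.op, oracleOrInv],
    fun O hO => onWires_unitary e (controlled_unitary (oracleOnQubits_unitary (hO j)))⟩

end Run
end DysonSim

namespace DysonSim
open Matrix

/-! ### One-qubit matrices on a wire, depending on the other wires. -/

section FiberOp

variable {k w : Type} [Fintype k] [DecidableEq k] [Fintype w] [DecidableEq w] {α : Type}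

/-- `F` does not depend on the wire `t`. -/
def Indep (t : w) (F : Label w → α) : Prop := ∀ y b, F (Function.update y t b) = F y

/-- The operator that applies to the wire `t` a matrix depending on the labels of the wires. -/
noncomputable def fiberOp (t : w) (F : Label w → Matrix Bool Bool ℂ) : QOp w :=
  fun x y => if x = Function.update y t (x t) then F y (x t) (y t) else 0

variable {t : w} {F G : Label w → Matrix Bool Bool ℂ}

theorem mul_fiberOp_apply {ι : Type} (ρ : Matrix ι (Label w) ℂ) (t : w)
    (F : Label w → Matrix Bool Bool ℂ) (i : ι) (y : Label w) :
    (ρ * fiberOp t F) i y = ∑ b, ρ i (Function.update y t b) * F y b (y t) := by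
  rw [Matrix.mul_apply]
  symm
  refine Fintype.sum_of_injective (fun b => Function.update y t b)
    (Function.update_injective y t) _ _ ?_ ?_
  · intro x hx
    unfold fiberOp
    rw [if_neg, mul_zero]
    intro h
    exact hx ⟨x t, h.symm⟩
  · intro b
    simp [fiberOp]

theorem fiberOp_apply (t : w) (F : Label w → Matrix Bool Bool ℂ) (x y : Label w) :
    fiberOp t F x y =
      ∑ b, (if x = Function.update y t b then 1 else 0) * F y b (y t) := by
  rw [← Matrix.one_mul (fiberOp t F), mul_fiberOp_apply]
  simp only [Matrix.one_apply]

/-- Independence of t is needed for the left factor only: it is evaluated at labels whose wire t the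
right factor has already changed. -/
theorem fiberOp_mul (hF : Indep t F) :
    fiberOp t F * fiberOp t G = fiberOp t (fun y => F y * G y) := by
  ext x y
  rw [mul_fiberOp_apply]
  simp only [fiberOp, Function.update_idem, hF y, Function.update_self, Matrix.mul_apply]
  split_ifs <;> simp

theorem fiberOp_one : fiberOp t (fun _ => 1) = (1 : QOp w) := by
  ext x y
  unfold fiberOp
  by_cases h : x = y
  · subst h
    simp
  · rw [Matrix.one_apply_ne h]
    split_ifs with h1
    · refine Matrix.one_apply_ne ?_
      intro h2
      apply h
      rw [h1, h2, Function.update_eq_self]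
    · rfl

theorem fiberOp_conjTranspose (hF : Indep t F) :
    (fiberOp t F)ᴴ = fiberOp t (fun y => (F y)ᴴ) := by
  ext x y
  rw [Matrix.conjTranspose_apply]
  unfold fiberOp
  by_cases h : x = Function.update y t (x t)
  · have h' : y = Function.update x t (y t) := by
      rw [h]; simp
    have hF' : F x = F y := by rw [h, hF]
    rw [if_pos h, if_pos h', hF']
    rfl
  · have h' : ¬ y = Function.update x t (y t) := by
      intro h'
      apply h
      rw [h']; simp
    rw [if_neg h, if_neg h', star_zero]

theorem fiberOp_unitary (hF : Indep t F) (hU : ∀ y, F y ∈ unitaryGroup Bool ℂ) :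
    fiberOp t F ∈ unitaryGroup (Label w) ℂ := by
  rw [mem_unitaryGroup_iff, star_eq_conjTranspose, fiberOp_conjTranspose hF, fiberOp_mul hF]
  have : (fun y => F y * (F y)ᴴ) = fun _ => 1 := by
    funext y
    exact mem_unitaryGroup_iff.1 (hU y)
  rw [this, fiberOp_one]

/-- This turns a primitive gate on one or two abstract qubits into a conditioned one-qubit matrix on
the full set of wires, so that all gates can be multiplied in a single calculus. -/
theorem onWires_fiberOp (e : k ↪ w) (t : k) (F : Label k → Matrix Bool Bool ℂ) :
    onWires e (fiberOp t F) = fiberOp (e t) (fun x => F (x ∘ e)) := by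
  ext x y
  unfold onWires
  rw [fiberOp_apply, fiberOp_apply]
  by_cases h : ∀ i, i ∉ Set.range e → x i = y i
  · rw [if_pos h]
    refine Finset.sum_congr rfl fun b _ => ?_
    congr 2
    rw [eq_iff_iff]
    constructor
    · intro h1
      funext i
      by_cases hi : i ∈ Set.range e
      · obtain ⟨a, rfl⟩ := hi
        have := congrFun h1 a
        by_cases hat : a = t
        · subst hat
          simpa using this
        · simpa [hat] using this
      · rw [h i hi, Function.update_of_ne]
        rintro rfl
        exact hi ⟨t, rfl⟩
    · intro h1
      funext a
      have := congrFun h1 (e a)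
      by_cases hat : a = t
      · subst hat
        simpa using this
      · simpa [hat] using this
  · rw [if_neg h]
    symm
    refine Finset.sum_eq_zero fun b _ => ?_
    rw [if_neg, zero_mul]
    intro h1
    apply h
    intro i hi
    rw [h1, Function.update_of_ne]
    rintro rfl
    exact hi ⟨t, rfl⟩

end FiberOp

/-! ### Bit flips conditioned on other wires. -/

section Xor

variable {w : Type} [Fintype w] [DecidableEq w]

/-- The Pauli matrix `X`. -/
def boolX : Matrix Bool Bool ℂ := fun a b => if a = b then 0 else 1

theorem boolX_conjTranspose : boolXᴴ = boolX := by
  ext a b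
  cases a <;> cases b <;> simp [boolX]

theorem boolX_mul_self : boolX * boolX = 1 := by
  ext a b
  rw [Matrix.mul_apply]
  cases a <;> cases b <;> simp [boolX]

theorem boolX_unitary : boolX ∈ unitaryGroup Bool ℂ := by
  rw [mem_unitaryGroup_iff, star_eq_conjTranspose, boolX_conjTranspose, boolX_mul_self]

/-- A square root of `X`. -/
noncomputable def sqrtX : Matrix Bool Bool ℂ :=
  fun a b => if a = b then (1 + Complex.I) / 2 else (1 - Complex.I) / 2

theorem sqrtX_mul_self : sqrtX * sqrtX = boolX := by
  ext a b
  rw [Matrix.mul_apply]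
  cases a <;> cases b <;> simp [boolX, sqrtX] <;> ring_nf <;> simp [Complex.I_sq] <;> norm_num

theorem sqrtX_unitary : sqrtX ∈ unitaryGroup Bool ℂ := by
  rw [mem_unitaryGroup_iff, star_eq_conjTranspose]
  ext a b
  rw [Matrix.mul_apply]
  cases a <;> cases b <;> simp [sqrtX, Complex.conj_ofNat] <;> ring_nf <;>
    simp [Complex.I_sq] <;> norm_num

/-- The operator that adds `g` to the wire `t`. -/
noncomputable def xorOp (t : w) (g : Label w → Bool) : QOp w :=
  fiberOp t (fun y => cond (g y) boolX 1)

theorem indep_cond {t : w} {g : Label w → Bool} (hg : Indep t g) {α : Type} (a b : α) :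
    Indep t (fun y => cond (g y) a b) := fun y c => by
  simp only [hg y c]

theorem mul_xorOp_apply {ι : Type} (ρ : Matrix ι (Label w) ℂ) (t : w) (g : Label w → Bool) (i : ι)
    (y : Label w) :
    (ρ * xorOp t g) i y = ρ i (Function.update y t (y t ^^ g y)) := by
  unfold xorOp
  rw [mul_fiberOp_apply]
  cases hg : g y <;> cases hy : y t <;> simp [boolX]

theorem cond_mem {α : Type} [Monoid α] {S : Submonoid α} {a b : α} (ha : a ∈ S) (hb : b ∈ S)
    (c : Bool) :
    cond c a b ∈ S := by
  cases c
  · exact hb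
  · exact ha

theorem xorOp_unitary {t : w} {g : Label w → Bool} (hg : Indep t g) :
    xorOp t g ∈ unitaryGroup (Label w) ℂ := by
  exact fiberOp_unitary (indep_cond hg _ _) fun y => cond_mem boolX_unitary (one_mem _) _

theorem xorOp_mul_xorOp {t : w} {g g' : Label w → Bool} (hg : Indep t g) :
    xorOp t g * xorOp t g' = xorOp t (fun y => g y ^^ g' y) := by
  unfold xorOp
  rw [fiberOp_mul (indep_cond hg _ _)]
  congr 1
  funext y
  dsimp only
  generalize g y = u
  generalize g' y = v
  cases u <;> cases v <;> simp [boolX_mul_self]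

/-- A controlled operation conjugated by a bit flip of its control. -/
theorem conj_xorOp_fiberOp {t c : w} (hct : c ≠ t) {g : Label w → Bool} (hgc : Indep c g)
    (hgt : Indep t g) (G : Bool → Matrix Bool Bool ℂ) :
    xorOp c g * fiberOp t (fun y => G (y c)) * xorOp c g =
      fiberOp t (fun y => G (y c ^^ g y)) := by
  ext x y
  rw [mul_xorOp_apply, mul_fiberOp_apply, fiberOp_apply]
  refine Finset.sum_congr rfl fun b _ => ?_
  rw [Function.update_self, Function.update_of_ne hct.symm]
  congr 1
  rw [← Matrix.one_mul (xorOp c g), mul_xorOp_apply, Matrix.one_apply]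
  have h1 : g (Function.update (Function.update y c (y c ^^ g y)) t b) = g y := by
    rw [hgt, hgc]
  rw [h1, Function.update_of_ne hct, Function.update_self, Function.update_comm hct.symm,
    Function.update_idem, Bool.xor_assoc, Bool.xor_self, Bool.xor_false,
    Function.update_eq_self]

end Xor

/-! ### Toffoli, majority and swap from two-qubit gates. -/

section ImplGates

variable {ns na M L : ℕ} {w : Type} [Fintype w] [DecidableEq w]

variable (ns na M L) in
/-- The operator `A` is implemented by at most `g` gates, without queries. -/
def GateImpl (g : ℕ) (A : QOp w) : Prop :=
  Impl (ns := ns) (na := na) (M := M) (L := L) 0 g (fun _ => A)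

theorem GateImpl.mono {g g' : ℕ} {A : QOp w} (h : GateImpl ns na M L g A) (hg : g ≤ g') :
    GateImpl ns na M L g' A := Impl.mono h le_rfl hg

theorem GateImpl.mul {g g' : ℕ} {A B : QOp w} (hA : GateImpl ns na M L g A)
    (hB : GateImpl ns na M L g' B) : GateImpl ns na M L (g + g') (A * B) := Impl.mul hA hB

theorem GateImpl.one : GateImpl ns na M L 0 (1 : QOp w) := Impl.one

theorem GateImpl.adjoint {g : ℕ} {A : QOp w} (hA : GateImpl ns na M L g A) :
    GateImpl ns na M L g Aᴴ := Impl.adjoint hA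

theorem gateImpl_single (t : w) {U : Matrix Bool Bool ℂ} (hU : U ∈ unitaryGroup Bool ℂ) :
    GateImpl ns na M L 1 (fiberOp t (fun _ => U)) := by
  let e : Fin 1 ↪ w := ⟨fun _ => t, fun _ _ _ => Subsingleton.elim _ _⟩
  have h := Impl.gate (ns := ns) (na := na) (M := M) (L := L) (by norm_num : 1 ≤ 2) e
    (fiberOp_unitary (t := (0 : Fin 1)) (F := fun _ => U) (fun _ _ => rfl) fun _ => hU)
  rw [onWires_fiberOp] at h
  exact h

theorem gateImpl_ctrl {t c : w} (hct : c ≠ t) {G : Bool → Matrix Bool Bool ℂ}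
    (hG : ∀ b, G b ∈ unitaryGroup Bool ℂ) :
    GateImpl ns na M L 1 (fiberOp t (fun x => G (x c))) := by
  let e : Fin 2 ↪ w := ⟨![t, c], by
    intro i j h
    fin_cases i <;> fin_cases j <;> simp_all⟩
  have h := Impl.gate (ns := ns) (na := na) (M := M) (L := L) le_rfl e
    (fiberOp_unitary (t := (0 : Fin 2)) (F := fun x => G (x 1)) (fun _ _ => by simp)
      fun _ => hG _)
  rw [onWires_fiberOp] at h
  exact h

theorem gateImpl_const (t : w) (v : Bool) : GateImpl ns na M L 1 (xorOp t (fun _ => v)) := by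
  exact gateImpl_single t (cond_mem boolX_unitary (one_mem _) _)

theorem gateImpl_lit {t a : w} (ha : a ≠ t) (v : Bool) :
    GateImpl ns na M L 1 (xorOp t (fun y => y a == v)) := by
  exact gateImpl_ctrl (G := fun b => cond (b == v) boolX 1) ha fun b =>
    cond_mem boolX_unitary (one_mem _) _

theorem indep_lit {t a : w} (ha : a ≠ t) (v : Bool) : Indep t (fun y => y a == v) := fun y b => by
  simp [Function.update_of_ne ha]

theorem Indep.and {t : w} {g g' : Label w → Bool} (hg : Indep t g) (hg' : Indep t g') :
    Indep t (fun y => g y && g' y) := fun y b => by simp only [hg y b, hg' y b]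

/-- With u and v the truth values of the two literals, u + v - (u ⊕ v) = 2uv. Two controlled roots
of X, and an inverse root controlled by the sum that a controlled-not puts temporarily on c,
therefore multiply to X to the power uv. -/
theorem gateImpl_and {t a c : w} (ha : a ≠ t) (hc : c ≠ t) (hac : a ≠ c) (va vc : Bool) :
    GateImpl ns na M L 5 (xorOp t (fun y => (y a == va) && (y c == vc))) := by
  have hV : ∀ (v b : Bool), cond (b == v) sqrtX 1 ∈ unitaryGroup Bool ℂ := fun v b =>
    cond_mem sqrtX_unitary (one_mem _) _
  have h1 := gateImpl_ctrl (ns := ns) (na := na) (M := M) (L := L) ha (hV va)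
  have h2 := gateImpl_lit (ns := ns) (na := na) (M := M) (L := L) hac va
  have h3 := (gateImpl_ctrl (ns := ns) (na := na) (M := M) (L := L) hc (hV vc)).adjoint
  have h4 := gateImpl_ctrl (ns := ns) (na := na) (M := M) (L := L) hc (hV vc)
  have h := h1.mul (((h2.mul h3).mul h2).mul h4)
  have hi : ∀ {v : Bool} {c : w}, c ≠ t →
      Indep t (fun y => (cond (y c == v) sqrtX 1 : Matrix Bool Bool ℂ)) :=
    fun hc => indep_cond (indep_lit hc _) _ _
  rw [fiberOp_conjTranspose (hi hc),
    conj_xorOp_fiberOp hc (indep_lit hac va) (indep_lit ha va)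
      (fun b => (cond (b == vc) sqrtX 1 : Matrix Bool Bool ℂ)ᴴ),
    fiberOp_mul, fiberOp_mul (hi ha)] at h
  · refine GateImpl.mono (A := xorOp t _) ?_ (le_refl 5)
    convert h using 1
    unfold xorOp
    congr 1
    funext y
    have hu := mem_unitaryGroup_iff.1 sqrtX_unitary
    have hu' := mem_unitaryGroup_iff'.1 sqrtX_unitary
    rw [star_eq_conjTranspose] at hu hu'
    dsimp only
    generalize y a = ya
    generalize y c = yc
    cases ya <;> cases yc <;> cases va <;> cases vc <;> simp [sqrtX_mul_self, hu, hu']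
  · intro y b
    simp [Function.update_of_ne ha, Function.update_of_ne hc]

theorem GateImpl.xor {t : w} {g g' : Label w → Bool} {n n' : ℕ} (hg : Indep t g)
    (h : GateImpl ns na M L n (xorOp t g)) (h' : GateImpl ns na M L n' (xorOp t g')) :
    GateImpl ns na M L (n + n') (xorOp t (fun y => g y ^^ g' y)) := by
  rw [← xorOp_mul_xorOp hg]
  exact h.mul h'

/-- De Morgan: flip t once, and once more when both wires are 0. -/
theorem gateImpl_or {t a c : w} (ha : a ≠ t) (hc : c ≠ t) (hac : a ≠ c) :
    GateImpl ns na M L 6 (xorOp t (fun y => y a || y c)) := by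
  have h := (gateImpl_const (ns := ns) (na := na) (M := M) (L := L) t true).xor
    (fun _ _ => rfl) (gateImpl_and ha hc hac false false)
  convert h using 3 with y
  cases y a <;> cases y c <;> rfl

/-- The majority function. -/
def maj (a b c : Bool) : Bool := (a && b) ^^ ((a && c) ^^ (b && c))

theorem gateImpl_maj {t a b c : w} (ha : a ≠ t) (hb : b ≠ t) (hc : c ≠ t) (hab : a ≠ b)
    (hac : a ≠ c) (hbc : b ≠ c) :
    GateImpl ns na M L 15 (xorOp t (fun y => maj (!y a) (y b) (y c))) := by
  have h1 := gateImpl_and (ns := ns) (na := na) (M := M) (L := L) ha hb hab false true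
  have h2 := gateImpl_and (ns := ns) (na := na) (M := M) (L := L) ha hc hac false true
  have h3 := gateImpl_and (ns := ns) (na := na) (M := M) (L := L) hb hc hbc true true
  have h := h1.xor ((indep_lit ha false).and (indep_lit hb true))
    (h2.xor ((indep_lit ha false).and (indep_lit hc true)) h3)
  convert h using 3 with y
  unfold maj
  cases y a <;> cases y b <;> cases y c <;> rfl

/-- The three controlled-not gates that exchange two wires. -/
noncomputable def swapOp (a c : w) : QOp w :=
  xorOp a (fun y => y c == true) * xorOp c (fun y => y a == true) * xorOp a (fun y => y c == true)

theorem gateImpl_swap {a c : w} (hac : a ≠ c) : GateImpl ns na M L 3 (swapOp a c) :=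
  ((gateImpl_lit hac.symm true).mul (gateImpl_lit hac true)).mul (gateImpl_lit hac.symm true)

theorem mul_swapOp_apply {ι : Type} (ρ : Matrix ι (Label w) ℂ) {a c : w} (hac : a ≠ c) (i : ι)
    (y : Label w) :
    (ρ * swapOp a c) i y = ρ i (Function.update (Function.update y a (y c)) c (y a)) := by
  unfold swapOp
  rw [← Matrix.mul_assoc, ← Matrix.mul_assoc, mul_xorOp_apply, mul_xorOp_apply, mul_xorOp_apply]
  congr 1
  funext v
  by_cases h1 : v = a
  · subst h1
    simp only [Function.update_self, Function.update_of_ne hac, Function.update_of_ne hac.symm]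
    cases y v <;> cases y c <;> rfl
  · by_cases h2 : v = c
    · subst h2
      simp only [Function.update_self, Function.update_of_ne hac, Function.update_of_ne hac.symm]
      cases y v <;> cases y a <;> rfl
    · simp [h1, h2]

end ImplGates

/-! ### Classical automata computed on scratch wires and uncomputed. -/

section Chain

variable {ns na M L : ℕ} {w : Type} [Fintype w] [DecidableEq w]
variable (s : ℕ → w) (δ : ℕ → Bool → Label w → Bool)

/-- The states of the automaton with transition functions `δ`, started at `false`. -/
def chainState : ℕ → Label w → Bool
  | 0, _ => false
  | n + 1, x => δ n (chainState n x) x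

/-- The states of an automaton are added, one after the other, to the wires `s`. -/
def chainFun : ℕ → Label w → Label w
  | 0, x => x
  | n + 1, x => Function.update (chainFun n x) (s (n + 1))
      (chainFun n x (s (n + 1)) ^^ δ n (chainFun n x (s n)) (chainFun n x))

/-- The operator of `chainFun`. -/
noncomputable def chainOp : ℕ → QOp w
  | 0 => 1
  | n + 1 => xorOp (s (n + 1)) (fun y => δ n (y (s n)) y) * chainOp n

variable {s δ}

theorem mul_chainOp_apply {ι : Type} (ρ : Matrix ι (Label w) ℂ) (n : ℕ) (i : ι) (y : Label w) :
    (ρ * chainOp s δ n) i y = ρ i (chainFun s δ n y) := by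
  induction n generalizing ρ with
  | zero => simp [chainOp, chainFun]
  | succ n ih => rw [chainOp, ← Matrix.mul_assoc, ih, mul_xorOp_apply, chainFun]

variable {N : ℕ} {D : Set w}

/-- Adding a state to a clean scratch wire writes it there. The input wires D are disjoint from the
scratch wires, so every transition still reads the original input. -/
theorem chainFun_spec (hs : ∀ i ≤ N, ∀ j ≤ N, s i = s j → i = j) (hD : ∀ i ≤ N, s i ∉ D)
    (hδ : ∀ i b x y, (∀ v ∈ D, x v = y v) → δ i b x = δ i b y) {x : Label w}
    (hx : ∀ i ≤ N, x (s i) = false) :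
    ∀ n ≤ N, chainFun s δ n x (s n) = chainState δ n x ∧
      (∀ j ≤ N, n < j → chainFun s δ n x (s j) = false) ∧
      ∀ v, (∀ i ≤ N, v ≠ s i) → chainFun s δ n x v = x v := by
  intro n
  induction n with
  | zero => exact fun h => ⟨hx 0 h, fun j hj _ => hx j hj, fun _ _ => rfl⟩
  | succ n ih =>
    intro hn
    obtain ⟨h1, h2, h3⟩ := ih (by omega)
    refine ⟨?_, ?_, ?_⟩
    · rw [chainFun, Function.update_self, h2 _ hn (by omega), h1, Bool.false_xor, chainState]
      refine hδ _ _ _ _ fun v hv => h3 v ?_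
      rintro i hi rfl
      exact hD i hi hv
    · intro j hj hnj
      rw [chainFun, Function.update_of_ne, h2 j hj (by omega)]
      intro h
      have := hs _ hj _ hn h
      omega
    · intro v hv
      rw [chainFun, Function.update_of_ne (hv _ hn), h3 v hv]

theorem chainFun_update (hδ : ∀ i b x y, (∀ v ∈ D, x v = y v) → δ i b x = δ i b y) {t : w}
    (ht : t ∉ D) (hts : ∀ i ≤ N, s i ≠ t) (y : Label w) (b : Bool) :
    ∀ n ≤ N, chainFun s δ n (Function.update y t b) = Function.update (chainFun s δ n y) t b := by
  intro n
  induction n with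
  | zero => exact fun _ => rfl
  | succ n ih =>
    intro hn
    have hd : ∀ c x, δ n c (Function.update x t b) = δ n c x := fun c x => by
      refine hδ _ _ _ _ fun v hv => ?_
      rw [Function.update_of_ne]
      rintro rfl
      exact ht hv
    rw [chainFun, ih (by omega), chainFun, hd, Function.update_of_ne (hts _ hn),
      Function.update_of_ne (hts n (by omega)), Function.update_comm (hts _ hn)]

theorem chainFun_apply_of_ne {t : w} (hts : ∀ i ≤ N, s i ≠ t) (y : Label w) :
    ∀ n ≤ N, chainFun s δ n y t = y t := by
  intro n
  induction n with
  | zero => exact fun _ => rfl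
  | succ n ih =>
    intro hn
    rw [chainFun, Function.update_of_ne (hts _ hn).symm, ih (by omega)]

/-- Computing the states of an automaton, using them, and uncomputing them. -/
theorem gateImpl_chain (hs : ∀ i ≤ N, ∀ j ≤ N, s i = s j → i = j) (hD : ∀ i ≤ N, s i ∉ D)
    (hδ : ∀ i b x y, (∀ v ∈ D, x v = y v) → δ i b x = δ i b y) {t : w} (ht : t ∉ D)
    (hts : ∀ i ≤ N, s i ≠ t) {F : Label w → Matrix Bool Bool ℂ} {m c : ℕ}
    (hF : GateImpl ns na M L m (fiberOp t F))
    (hc : ∀ n < N, GateImpl ns na M L c (xorOp (s (n + 1)) (fun y => δ n (y (s n)) y))) :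
    GateImpl ns na M L (2 * (N * c) + m) (fiberOp t (fun y => F (chainFun s δ N y))) := by
  have hC : ∀ n ≤ N, GateImpl ns na M L (n * c) (chainOp s δ n) ∧
      (chainOp s δ n)ᴴ * chainOp s δ n = 1 := by
    intro n
    induction n with
    | zero => exact fun _ => ⟨by simpa [chainOp] using GateImpl.one, by simp [chainOp]⟩
    | succ n ih =>
      intro hn
      obtain ⟨h1, h2⟩ := ih (by omega)
      refine ⟨((hc n hn).mul h1).mono (by rw [add_mul, one_mul, add_comm]), ?_⟩
      have hi : Indep (s (n + 1)) (fun y => δ n (y (s n)) y) := by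
        intro y b
        have hne : s n ≠ s (n + 1) := fun h => by
          have := hs _ (by omega) _ hn h
          omega
        simp only [Function.update_of_ne hne]
        refine hδ _ _ _ _ fun v hv => ?_
        rw [Function.update_of_ne]
        rintro rfl
        exact hD _ hn hv
      have hX := mem_unitaryGroup_iff'.1 (xorOp_unitary hi)
      rw [star_eq_conjTranspose] at hX
      rw [chainOp, Matrix.conjTranspose_mul, Matrix.mul_assoc, ← Matrix.mul_assoc (xorOp _ _)ᴴ, hX,
        Matrix.one_mul, h2]
  obtain ⟨h1, h2⟩ := hC N le_rfl
  have h := (h1.adjoint.mul hF).mul h1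
  -- The chain neither reads nor writes t, so it can be moved past the conditioned matrix by pulling
  -- F back along `chainFun`. This is an exact operator identity; clean scratch matters only when
  -- the condition is evaluated.
  have key : fiberOp t F * chainOp s δ N =
      chainOp s δ N * fiberOp t (fun y => F (chainFun s δ N y)) := by
    ext x y
    rw [mul_chainOp_apply, mul_fiberOp_apply, fiberOp_apply]
    refine Finset.sum_congr rfl fun b _ => ?_
    rw [chainFun_apply_of_ne hts y N le_rfl, ← Matrix.one_mul (chainOp s δ N), mul_chainOp_apply,
      Matrix.one_apply, chainFun_update hδ ht hts y b N le_rfl]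
  rw [Matrix.mul_assoc, key, ← Matrix.mul_assoc, h2, Matrix.one_mul] at h
  exact h.mono (by omega)

end Chain

/-! ### Disjunctions and comparisons with linearly many gates. -/

section Conditions

variable {ns na M L : ℕ} {w : Type} [Fintype w] [DecidableEq w]

/-- Transition functions for the disjunction of a list of wires. -/
def orStep (l : List w) (i : ℕ) (b : Bool) (x : Label w) : Bool :=
  if h : i < l.length then x l[i] || b else b

/-- Whether some wire of `D` is set, computed with scratch wires `s`. -/
noncomputable def orCond (s : ℕ → w) (D : Finset w) (x : Label w) : Bool :=
  chainFun s (orStep D.toList) D.card x (s D.card)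

theorem orStep_congr (D : Finset w) (i : ℕ) (b : Bool) (x y : Label w)
    (h : ∀ v ∈ (D : Set w), x v = y v) : orStep D.toList i b x = orStep D.toList i b y := by
  unfold orStep
  split_ifs with hi
  · rw [h _ (Finset.mem_toList.1 (List.getElem_mem hi))]
  · rfl

variable {s : ℕ → w} {D : Finset w}

theorem orCond_eq (hs : ∀ i ≤ D.card, ∀ j ≤ D.card, s i = s j → i = j)
    (hD : ∀ i ≤ D.card, s i ∉ D) {x : Label w} (hx : ∀ i ≤ D.card, x (s i) = false) :
    orCond s D x = decide (∃ v ∈ D, x v = true) := by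
  have h1 := (chainFun_spec (δ := orStep D.toList) (D := (D : Set w)) hs hD (orStep_congr D) hx
    D.card le_rfl).1
  have h2 : ∀ n ≤ D.toList.length, chainState (orStep D.toList) n x = (D.toList.take n).any x := by
    intro n
    induction n with
    | zero => intro _; rfl
    | succ n ih =>
      intro hn
      rw [chainState, ih (by omega), orStep, dif_pos (by omega), List.take_succ_eq_append_getElem
        (by omega), List.any_append]
      simp [Bool.or_comm]
  rw [orCond, h1]
  have h3 := h2 D.card (by simp)
  rw [h3, List.take_of_length_le (by simp)]
  rw [Bool.eq_iff_iff]
  simp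

theorem gateImpl_orCond (hs : ∀ i ≤ D.card, ∀ j ≤ D.card, s i = s j → i = j)
    (hD : ∀ i ≤ D.card, s i ∉ D) {t : w} (ht : t ∉ D) (hts : ∀ i ≤ D.card, s i ≠ t)
    {G : Bool → Matrix Bool Bool ℂ} (hG : ∀ b, G b ∈ unitaryGroup Bool ℂ) :
    GateImpl ns na M L (12 * D.card + 1) (fiberOp t (fun y => G (orCond s D y))) := by
  have h := gateImpl_chain (ns := ns) (na := na) (M := M) (L := L) (δ := orStep D.toList)
    (D := (D : Set w)) (c := 6) hs hD
    (orStep_congr D) ht hts (gateImpl_ctrl (hts _ le_rfl) hG) ?_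
  · exact h.mono (by omega)
  · intro n hn
    have hl : n < D.toList.length := by simpa using hn
    have hm : D.toList[n] ∈ D := Finset.mem_toList.1 (List.getElem_mem hl)
    have := gateImpl_or (ns := ns) (na := na) (M := M) (L := L) (t := s (n + 1))
      (a := D.toList[n]) (c := s n) (fun h => hD _ hn (h ▸ hm))
      (fun h => by have := hs _ hn.le _ hn h; omega) (fun h => hD _ hn.le (h ▸ hm))
    simpa only [orStep, dif_pos hl] using this

variable {b : ℕ}

/-- Transition functions for the comparison of two registers; the first transition sets the state
to `v`. -/
def cmpStep (r o : Fin b → w) (v : Bool) : ℕ → Bool → Label w → Bool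
  | 0, _, _ => v
  | i + 1, c, x => if h : i < b then maj (!x (o ⟨i, h⟩)) (x (r ⟨i, h⟩)) c else c

/-- Whether the register `r` is larger than `o` (or equal to it, if `v` is set), computed with
scratch wires `s`. -/
def cmpCond (s : ℕ → w) (r o : Fin b → w) (v : Bool) (x : Label w) : Bool :=
  chainFun s (cmpStep r o v) (b + 1) x (s (b + 1))

theorem cmpStep_congr (r o : Fin b → w) (v : Bool) (i : ℕ) (c : Bool) (x y : Label w)
    (h : ∀ u ∈ Set.range r ∪ Set.range o, x u = y u) :
    cmpStep r o v i c x = cmpStep r o v i c y := by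
  cases i with
  | zero => rfl
  | succ i =>
    simp only [cmpStep]
    split_ifs with hi
    · rw [h _ (Or.inl ⟨_, rfl⟩), h _ (Or.inr ⟨_, rfl⟩)]
    · rfl

theorem binVal_eq_sum_range (z : Label (Fin b)) :
    binVal z = ∑ i ∈ Finset.range b, if (if h : i < b then z ⟨i, h⟩ else false) then 2 ^ i else 0 := by
  rw [Finset.sum_range, binVal]
  refine Finset.sum_congr rfl fun i _ => ?_
  simp

variable {r o : Fin b → w}

/-- Scanning from the least significant digit, the state is a carry: a strictly larger digit of r
sets it, a strictly larger digit of o clears it, and equal digits keep it. That is the majority of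
the negated digit of o, the digit of r and the old state. The initial state v decides ties. -/
theorem cmpCond_eq {v : Bool} (hs : ∀ i ≤ b + 1, ∀ j ≤ b + 1, s i = s j → i = j)
    (hr : ∀ i ≤ b + 1, ∀ j, s i ≠ r j) (ho : ∀ i ≤ b + 1, ∀ j, s i ≠ o j) {x : Label w}
    (hx : ∀ i ≤ b + 1, x (s i) = false) :
    cmpCond s r o v x =
      decide (binVal (fun i => x (o i)) < binVal (fun i => x (r i)) + if v then 1 else 0) := by
  have h1 := (chainFun_spec (δ := cmpStep r o v) (D := Set.range r ∪ Set.range o) hs ?_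
    (cmpStep_congr r o v) hx (b + 1) le_rfl).1
  swap
  · rintro i hi (⟨j, hj⟩ | ⟨j, hj⟩)
    · exact hr i hi j hj.symm
    · exact ho i hi j hj.symm
  have h2 : ∀ n ≤ b, chainState (cmpStep r o v) (n + 1) x =
      decide ((∑ i ∈ Finset.range n, if (if h : i < b then x (o ⟨i, h⟩) else false) then 2 ^ i else 0)
        < (∑ i ∈ Finset.range n, if (if h : i < b then x (r ⟨i, h⟩) else false) then 2 ^ i else 0)
          + if v then 1 else 0) := by
    intro n
    induction n with
    | zero => intro _; cases v <;> simp [chainState, cmpStep]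
    | succ n ih =>
      intro hn
      -- The lower digits together stay below 2 ^ n, so digit n decides the comparison unless the
      -- two digits agree.
      have hle : ∀ f : ℕ → Bool, (∑ i ∈ Finset.range n, if f i then 2 ^ i else 0) < 2 ^ n := by
        intro f
        refine lt_of_le_of_lt (Finset.sum_le_sum (g := fun i => 2 ^ i) fun i _ => ?_) ?_
        · split_ifs <;> simp
        · have := Nat.geomSum_eq (le_refl 2) n
          rw [this]
          have := Nat.pos_of_ne_zero (pow_ne_zero n (two_ne_zero (α := ℕ)))
          omega
      have ha := hle fun i => if h : i < b then x (o ⟨i, h⟩) else false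
      have hb := hle fun i => if h : i < b then x (r ⟨i, h⟩) else false
      rw [chainState, ih (by omega), cmpStep, dif_pos (by omega), Finset.sum_range_succ,
        Finset.sum_range_succ, dif_pos (by omega), dif_pos (by omega)]
      generalize (∑ i ∈ Finset.range n,
        if (if h : i < b then x (o ⟨i, h⟩) else false) then 2 ^ i else 0) = A at ha ⊢
      generalize (∑ i ∈ Finset.range n,
        if (if h : i < b then x (r ⟨i, h⟩) else false) then 2 ^ i else 0) = B at hb ⊢
      generalize 2 ^ n = P at ha hb ⊢
      cases x (o ⟨n, by omega⟩) <;> cases x (r ⟨n, by omega⟩) <;> cases v <;>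
        simp [maj] <;> omega
  rw [cmpCond, h1, h2 b le_rfl, binVal_eq_sum_range, binVal_eq_sum_range]

theorem gateImpl_cmpCond {v : Bool} (hs : ∀ i ≤ b + 1, ∀ j ≤ b + 1, s i = s j → i = j)
    (hr : ∀ i ≤ b + 1, ∀ j, s i ≠ r j) (ho : ∀ i ≤ b + 1, ∀ j, s i ≠ o j)
    (hro : ∀ i, o i ≠ r i) {t q : w} (htr : ∀ j, t ≠ r j) (hto : ∀ j, t ≠ o j)
    (hts : ∀ i ≤ b + 1, s i ≠ t) (hq : ∀ i ≤ b + 1, s i ≠ q) (hqt : q ≠ t) :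
    GateImpl ns na M L (30 * (b + 1) + 5) (xorOp t (fun y => y q && cmpCond s r o v y)) := by
  have hbase := gateImpl_and (ns := ns) (na := na) (M := M) (L := L) hqt (hts _ le_rfl)
    (hq (b + 1) le_rfl).symm true true
  have h := gateImpl_chain (ns := ns) (na := na) (M := M) (L := L) (δ := cmpStep r o v)
    (D := Set.range r ∪ Set.range o) (c := 15) hs ?_ (cmpStep_congr r o v) ?_ hts hbase ?_
  · convert h.mono (show _ ≤ 30 * (b + 1) + 5 by omega) using 1
    unfold xorOp
    congr 1
    funext y
    dsimp only
    rw [chainFun_apply_of_ne hq y _ le_rfl]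
    simp [cmpCond]
  · rintro i hi (⟨j, hj⟩ | ⟨j, hj⟩)
    · exact hr i hi j hj.symm
    · exact ho i hi j hj.symm
  · rintro (⟨j, hj⟩ | ⟨j, hj⟩)
    · exact htr j hj.symm
    · exact hto j hj.symm
  · intro n hn
    cases n with
    | zero => exact (gateImpl_const _ v).mono (by norm_num)
    | succ n =>
      have hnb : n < b := by omega
      have := gateImpl_maj (ns := ns) (na := na) (M := M) (L := L) (t := s (n + 1 + 1))
        (a := o ⟨n, hnb⟩) (b := r ⟨n, hnb⟩) (c := s (n + 1)) (ho _ (by omega) _).symm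
        (hr _ (by omega) _).symm (fun h => by have := hs _ (by omega) _ (by omega) h; omega)
        (hro _) (ho _ (by omega) _).symm (hr _ (by omega) _).symm
      simpa only [cmpStep, dif_pos hnb] using this

end Conditions

end DysonSim

namespace DysonSim
open Matrix

/-! ### Product operators on a register, and the layout of the qubits. -/

section Tensor

variable {w : Type} [Fintype w] [DecidableEq w]

theorem extend_eq_of {k : Type} (e : k ↪ w) {z : Label k} {x y : Label w}
    (h1 : ∀ i, x (e i) = z i) (h2 : ∀ v, v ∉ Set.range e → x v = y v) :
    (Function.extend e z y : Label w) = x := by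
  funext v
  by_cases hv : v ∈ Set.range e
  · obtain ⟨i, rfl⟩ := hv
    rw [e.injective.extend_apply, h1]
  · rw [Function.extend_apply' _ _ _ hv, h2 v hv]

/-- The tensor product of one-qubit matrices. -/
def tens {b : ℕ} (G : Fin b → Matrix Bool Bool ℂ) : QOp (Fin b) :=
  fun x y => ∏ i, G i (x i) (y i)

theorem onWires_tens_succ {b : ℕ} (e : Fin (b + 1) ↪ w) (G : Fin (b + 1) → Matrix Bool Bool ℂ) :
    onWires e (tens G) = fiberOp (e 0) (fun _ => G 0) *
      onWires ((Fin.succEmb b).trans e) (tens fun i => G i.succ) := by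
  ext x y
  rw [mul_onWires_apply, ← Matrix.one_mul (onWires e _), mul_onWires_apply,
    ← (Fin.consEquiv fun _ => Bool).sum_comp, Fintype.sum_prod_type, Finset.sum_comm]
  refine Finset.sum_congr rfl fun z _ => ?_
  rw [fiberOp_apply, Finset.sum_mul]
  refine Finset.sum_congr rfl fun c _ => ?_
  have h0 : (Function.extend ((Fin.succEmb b).trans e) z y : Label w) (e 0) = y (e 0) := by
    refine Function.extend_apply' _ _ _ ?_
    rintro ⟨i, hi⟩
    exact Fin.succ_ne_zero i (e.injective hi)
  have h1 : (Function.extend e (Fin.consEquiv (fun _ => Bool) (c, z)) y : Label w) =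
      Function.update (Function.extend ((Fin.succEmb b).trans e) z y) (e 0) c := by
    refine extend_eq_of e (fun i => ?_) fun v hv => ?_
    · refine Fin.cases ?_ (fun j => ?_) i
      · simp [Fin.consEquiv]
      · rw [Function.update_of_ne (fun h => Fin.succ_ne_zero j (e.injective h))]
        exact ((Fin.succEmb b).trans e).injective.extend_apply z y j
    · rw [Function.update_of_ne (by rintro rfl; exact hv ⟨0, rfl⟩)]
      refine Function.extend_apply' _ _ _ ?_
      rintro ⟨i, hi⟩
      exact hv ⟨i.succ, hi⟩
  rw [h1, h0, Matrix.one_apply, tens, Fin.prod_univ_succ, tens, mul_assoc]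
  rfl

variable {ns na M L : ℕ}

theorem gateImpl_tens {b : ℕ} (e : Fin b ↪ w) {G : Fin b → Matrix Bool Bool ℂ}
    (hG : ∀ i, G i ∈ unitaryGroup Bool ℂ) : GateImpl ns na M L b (onWires e (tens G)) := by
  induction b with
  | zero =>
    have : (tens G : QOp (Fin 0)) = 1 := by
      ext x y
      rw [Subsingleton.elim x y, Matrix.one_apply_eq]
      simp [tens]
    rw [this, onWires_one]
    exact GateImpl.one
  | succ b ih =>
    rw [onWires_tens_succ]
    exact ((gateImpl_single (e 0) (hG 0)).mul (ih _ fun i => hG i.succ)).mono (by omega)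

end Tensor

/-- The qubits of the simulation: the system, the ancilla register of the oracles, two time
registers, the outcome of a comparison, a unary counter, failure flags, a padding qubit and scratch
qubits. -/
inductive Wire (ns na b K : ℕ) : Type
  | sys (i : Fin ns)
  | anc (i : Fin na)
  | reg (i : Fin b)
  | old (i : Fin b)
  | cmpBit
  | ctl (i : Fin (K + 1))
  | flag (i : Fin K)
  | pad
  | scr (i : Fin (na + 2 * b + 2 * K + 10))

namespace Wire

variable {ns na b K : ℕ}

/-- The qubits as a disjoint union of registers. -/
def equivSum : Wire ns na b K ≃ Fin ns ⊕ Fin na ⊕ Fin b ⊕ Fin b ⊕ Fin (K + 1) ⊕ Fin K ⊕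
    Fin (na + 2 * b + 2 * K + 10) ⊕ Bool where
  toFun
    | sys i => .inl i
    | anc i => .inr (.inl i)
    | reg i => .inr (.inr (.inl i))
    | old i => .inr (.inr (.inr (.inl i)))
    | ctl i => .inr (.inr (.inr (.inr (.inl i))))
    | flag i => .inr (.inr (.inr (.inr (.inr (.inl i)))))
    | scr i => .inr (.inr (.inr (.inr (.inr (.inr (.inl i))))))
    | cmpBit => .inr (.inr (.inr (.inr (.inr (.inr (.inr false))))))
    | pad => .inr (.inr (.inr (.inr (.inr (.inr (.inr true))))))
  invFun
    | .inl i => sys i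
    | .inr (.inl i) => anc i
    | .inr (.inr (.inl i)) => reg i
    | .inr (.inr (.inr (.inl i))) => old i
    | .inr (.inr (.inr (.inr (.inl i)))) => ctl i
    | .inr (.inr (.inr (.inr (.inr (.inl i))))) => flag i
    | .inr (.inr (.inr (.inr (.inr (.inr (.inl i)))))) => scr i
    | .inr (.inr (.inr (.inr (.inr (.inr (.inr false)))))) => cmpBit
    | .inr (.inr (.inr (.inr (.inr (.inr (.inr true)))))) => pad
  left_inv v := by cases v <;> rfl
  right_inv v := by rcases v with i | i | i | i | i | i | i | (_ | _) <;> rfl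

noncomputable instance : DecidableEq (Wire ns na b K) := Classical.decEq _

instance : Fintype (Wire ns na b K) := Fintype.ofEquiv _ equivSum.symm

/-- The scratch qubits, numbered by `ℕ`. -/
def scratch (n : ℕ) : Wire ns na b K := scr (Fin.ofNat (na + 2 * b + 2 * K + 10) n)

theorem scratch_injOn {N : ℕ} (hN : N ≤ na + 2 * b + 2 * K + 9) :
    ∀ i ≤ N, ∀ j ≤ N, (scratch i : Wire ns na b K) = scratch j → i = j := by
  intro i hi j hj h
  simp only [scratch, scr.injEq, Fin.ext_iff, Fin.val_ofNat] at h
  rwa [Nat.mod_eq_of_lt (by omega), Nat.mod_eq_of_lt (by omega)] at h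

/-- The wires of a time register. -/
def regEmb : Fin b ↪ Wire ns na b K := ⟨reg, fun _ _ h => by simpa using h⟩

/-- The wires of the other time register. -/
def oldEmb : Fin b ↪ Wire ns na b K := ⟨old, fun _ _ h => by simpa using h⟩

/-- Whether a wire has to be `0` after a step. -/
def isDirty : Wire ns na b K → Bool
  | anc _ => true
  | old _ => true
  | cmpBit => true
  | _ => false

/-- Whether a wire is neither part of the system nor a scratch qubit. -/
def isWork : Wire ns na b K → Bool
  | sys _ => false
  | scr _ => false
  | _ => true

/-- The wires that have to be `0` after a step. -/
noncomputable def dirty : Finset (Wire ns na b K) := Finset.univ.filter fun v => isDirty v = true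

/-- The wires other than the system and scratch. -/
noncomputable def work : Finset (Wire ns na b K) := Finset.univ.filter fun v => isWork v = true

theorem mem_dirty {v : Wire ns na b K} : v ∈ dirty ↔ isDirty v = true := by simp [dirty]

theorem mem_work {v : Wire ns na b K} : v ∈ work ↔ isWork v = true := by simp [work]

theorem card_dirty_le : (dirty : Finset (Wire ns na b K)).card ≤ na + b + 1 := by
  let f : Fin na ⊕ Fin b ⊕ Unit → Wire ns na b K := Sum.elim anc (Sum.elim old fun _ => cmpBit)
  have h : (dirty : Finset (Wire ns na b K)) ⊆ Finset.univ.image f := by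
    intro v hv
    rw [Finset.mem_image]
    rw [mem_dirty] at hv
    cases v with
    | anc i => exact ⟨.inl i, Finset.mem_univ _, rfl⟩
    | old i => exact ⟨.inr (.inl i), Finset.mem_univ _, rfl⟩
    | cmpBit => exact ⟨.inr (.inr ()), Finset.mem_univ _, rfl⟩
    | _ => simp [isDirty] at hv
  refine (Finset.card_le_card h).trans (Finset.card_image_le.trans ?_)
  simp
  omega

theorem card_work_le : (work : Finset (Wire ns na b K)).card ≤ na + 2 * b + 2 * K + 3 := by
  let f : Fin na ⊕ Fin b ⊕ Fin b ⊕ Fin (K + 1) ⊕ Fin K ⊕ Bool → Wire ns na b K :=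
    Sum.elim anc (Sum.elim reg (Sum.elim old (Sum.elim ctl (Sum.elim flag
      fun c => cond c cmpBit pad))))
  have h : (work : Finset (Wire ns na b K)) ⊆ Finset.univ.image f := by
    intro v hv
    rw [Finset.mem_image]
    rw [mem_work] at hv
    cases v with
    | anc i => exact ⟨.inl i, Finset.mem_univ _, rfl⟩
    | reg i => exact ⟨.inr (.inl i), Finset.mem_univ _, rfl⟩
    | old i => exact ⟨.inr (.inr (.inl i)), Finset.mem_univ _, rfl⟩
    | ctl i => exact ⟨.inr (.inr (.inr (.inl i))), Finset.mem_univ _, rfl⟩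
    | flag i => exact ⟨.inr (.inr (.inr (.inr (.inl i)))), Finset.mem_univ _, rfl⟩
    | cmpBit => exact ⟨.inr (.inr (.inr (.inr (.inr true)))), Finset.mem_univ _, rfl⟩
    | pad => exact ⟨.inr (.inr (.inr (.inr (.inr false)))), Finset.mem_univ _, rfl⟩
    | _ => simp [isWork] at hv
  refine (Finset.card_le_card h).trans (Finset.card_image_le.trans ?_)
  simp
  omega

end Wire
end DysonSim

namespace DysonSim
open Matrix Wire

/-! ### One step of the descending walk through the time indices. -/

section Step

variable {ns na b K : ℕ}

/-- The label with the given contents of the registers; the padding and scratch qubits and the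
flags are `0`. -/
def mkLabel (s : Label (Fin ns)) (a : Label (Fin na)) (r o : Label (Fin b)) (c : Bool)
    (q : Label (Fin (K + 1))) : Label (Wire ns na b K)
  | sys i => s i
  | anc i => a i
  | reg i => r i
  | old i => o i
  | cmpBit => c
  | ctl i => q i
  | flag _ => false
  | pad => false
  | scr _ => false

variable {ι : Type} (ρ : Matrix ι (Label (Wire ns na b K)) ℂ) (i : ι)
  (s : Label (Fin ns)) (a : Label (Fin na)) (r o : Label (Fin b)) (c : Bool)
  (q : Label (Fin (K + 1)))

/-- The exchange of the two time registers on a list of positions. -/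
noncomputable def swapList : List (Fin b) → QOp (Wire ns na b K)
  | [] => 1
  | j :: l => swapOp (reg j) (old j) * swapList l

theorem mul_swapList_apply (l : List (Fin b)) (hl : l.Nodup) :
    (ρ * (swapList l : QOp (Wire ns na b K))) i (mkLabel s a r o c q) =
      ρ i (mkLabel s a (fun j => if j ∈ l then o j else r j) (fun j => if j ∈ l then r j else o j)
        c q) := by
  induction l generalizing ρ with
  | nil => simp [swapList]
  | cons j l ih =>
    have hj := (List.nodup_cons.1 hl).1
    rw [swapList, ← Matrix.mul_assoc, ih _ (List.nodup_cons.1 hl).2,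
      mul_swapOp_apply _ (by simp)]
    congr 1
    funext v
    cases v with
    | reg j' =>
      rw [Function.update_of_ne (by simp)]
      by_cases h : j' = j
      · subst h
        simp [mkLabel, hj]
      · rw [Function.update_of_ne (by simpa using h)]
        simp [mkLabel, h]
    | old j' =>
      by_cases h : j' = j
      · subst h
        simp [mkLabel, hj]
      · rw [Function.update_of_ne (by simpa using h), Function.update_of_ne (by simp)]
        simp [mkLabel, h]
    | _ => rw [Function.update_of_ne (by simp), Function.update_of_ne (by simp)]; rfl

/-- The exchange of the two time registers. -/
noncomputable def swapReg : QOp (Wire ns na b K) := swapList (List.finRange b)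

theorem mul_swapReg_apply :
    (ρ * (swapReg : QOp (Wire ns na b K))) i (mkLabel s a r o c q) = ρ i (mkLabel s a o r c q) := by
  rw [swapReg, mul_swapList_apply _ _ _ _ _ _ _ _ _ (List.nodup_finRange b)]
  simp

theorem mul_onWires_reg_apply (A : QOp (Fin b)) :
    (ρ * (onWires regEmb A : QOp (Wire ns na b K))) i (mkLabel s a r o c q) =
      ∑ z, ρ i (mkLabel s a z o c q) * A z r := by
  rw [mul_onWires_apply]
  refine Finset.sum_congr rfl fun z _ => ?_
  congr 2
  refine extend_eq_of _ (fun _ => rfl) fun v hv => ?_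
  cases v with
  | reg j => exact absurd ⟨j, rfl⟩ hv
  | _ => rfl

theorem mul_onWires_old_apply (A : QOp (Fin b)) :
    (ρ * (onWires oldEmb A : QOp (Wire ns na b K))) i (mkLabel s a r o c q) =
      ∑ z, ρ i (mkLabel s a r z c q) * A z o := by
  rw [mul_onWires_apply]
  refine Finset.sum_congr rfl fun z _ => ?_
  congr 2
  refine extend_eq_of _ (fun _ => rfl) fun v hv => ?_
  cases v with
  | old j => exact absurd ⟨j, rfl⟩ hv
  | _ => rfl

/-- The comparison of the two time registers, controlled by a qubit. -/
noncomputable def cmpOp (j : Fin (K + 1)) (v : Bool) : QOp (Wire ns na b K) :=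
  xorOp cmpBit (fun y => y (ctl j) && cmpCond scratch reg old v y)

theorem mul_cmpOp_apply (j : Fin (K + 1)) (v : Bool) :
    (ρ * (cmpOp j v : QOp (Wire ns na b K))) i (mkLabel s a r o c q) =
      ρ i (mkLabel s a r o (c ^^ (q j && decide (binVal o < binVal r + if v then 1 else 0))) q) := by
  have h := cmpCond_eq (s := scratch) (r := (reg : Fin b → Wire ns na b K)) (o := old) (v := v)
    (x := mkLabel s a r o c q) (scratch_injOn (by omega)) (by simp [scratch]) (by simp [scratch])
    (fun _ _ => rfl)
  rw [cmpOp, mul_xorOp_apply, h]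
  congr 1
  funext v
  cases v with
  | cmpBit => rw [Function.update_self]; rfl
  | _ => rw [Function.update_of_ne (by simp)]; rfl

/-- The flag that records whether a wire is dirty. -/
noncomputable def flagOp (j : Fin K) : QOp (Wire ns na b K) := xorOp (flag j) (orCond scratch dirty)

theorem orCond_dirty_eq :
    orCond scratch dirty (mkLabel s a r o c q) =
      !decide (a = zeroLabel _ ∧ o = zeroLabel _ ∧ c = false) := by
  rw [orCond_eq]
  · rw [← decide_not, decide_eq_decide]
    constructor
    · rintro ⟨v, hv, hx⟩ ⟨rfl, rfl, rfl⟩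
      cases v <;> simp_all [mkLabel, zeroLabel, mem_dirty, isDirty]
    · intro h
      by_contra h'
      push Not at h'
      refine h ⟨funext fun j => ?_, funext fun j => ?_, ?_⟩
      · simpa [mkLabel, zeroLabel] using h' (anc j) (by simp [mem_dirty, isDirty])
      · simpa [mkLabel, zeroLabel] using h' (old j) (by simp [mem_dirty, isDirty])
      · simpa [mkLabel] using h' cmpBit (by simp [mem_dirty, isDirty])
  · exact scratch_injOn (card_dirty_le.trans (by omega))
  · simp [scratch, mem_dirty, isDirty]
  · exact fun _ _ => rfl

/-- The row vanishes where the flag is set, so writing the dirty bit into the flag acts as the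
projection onto clean ancilla, clean old register and successful comparison. This is post-selection
without a measurement, which keeps the circuit unitary for the later amplification. -/
theorem mul_flagOp_apply (j : Fin K) (hρ : ∀ x, x (flag j) = true → ρ i x = 0) :
    (ρ * (flagOp j : QOp (Wire ns na b K))) i (mkLabel s a r o c q) =
      if a = zeroLabel _ ∧ o = zeroLabel _ ∧ c = false then
        ρ i (mkLabel s (zeroLabel _) r (zeroLabel _) false q) else 0 := by
  rw [flagOp, mul_xorOp_apply, orCond_dirty_eq]
  split_ifs with h
  · obtain ⟨rfl, rfl, rfl⟩ := h
    simp
  · refine hρ _ ?_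
    simp [h, mkLabel]

end Step

section Query

variable {ns na M K : ℕ}

/-- The wires of a query. -/
def queryEmb (j : Fin (K + 1)) : Option (OracleWires ns na M) ↪ Wire ns na (Nat.clog 2 M) K where
  toFun
    | none => ctl j
    | some (.inl i) => reg i
    | some (.inr (.inl i)) => anc i
    | some (.inr (.inr i)) => sys i
  inj' := by
    rintro (_ | _ | _ | _) (_ | _ | _ | _) h <;> simp_all

/-- A label of the qubits of an oracle. -/
def oracleLabel (r : Label (Fin (Nat.clog 2 M))) (a : Label (Fin na)) (s : Label (Fin ns)) :
    Label (OracleWires ns na M) := Sum.elim r (Sum.elim a s)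

theorem oracleOnQubits_apply {U : OracleOp ns na M} {B : ℕ → QOp (Fin ns)}
    (hU : ∀ (m m' : Fin M) (x y : Label (Fin ns)),
      U (m, zeroLabel _, x) (m', zeroLabel _, y) = if m = m' then B m x y else 0)
    {r : Label (Fin (Nat.clog 2 M))} (hr : binVal r < M) (r' : Label (Fin (Nat.clog 2 M)))
    (s s' : Label (Fin ns)) :
    oracleOnQubits U (oracleLabel r' (zeroLabel _) s') (oracleLabel r (zeroLabel _) s) =
      if r' = r then B (binVal r) s' s else 0 := by
  unfold oracleOnQubits
  have htr : timeIndex (oracleLabel (ns := ns) (na := na) r (zeroLabel _) s) < M := hr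
  by_cases hr' : timeIndex (oracleLabel (ns := ns) (na := na) r' (zeroLabel _) s') < M
  · rw [dif_pos ⟨hr', htr⟩]
    have h := hU ⟨binVal r', hr'⟩ ⟨binVal r, hr⟩ s' s
    refine h.trans ?_
    by_cases h1 : r' = r
    · subst h1
      rw [if_pos rfl, if_pos rfl]
    · rw [if_neg fun h2 => h1 (binVal_injective (Fin.ext_iff.1 h2)), if_neg h1]
  · have hne : r' ≠ r := by
      rintro rfl
      exact hr' hr
    rw [dif_neg fun h => hr' h.1, if_neg, if_neg hne]
    intro h
    exact hne (funext fun j => congrFun h (Sum.inl j))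

variable {ι : Type} (ρ : Matrix ι (Label (Wire ns na (Nat.clog 2 M) K)) ℂ) (i : ι)
  (s : Label (Fin ns)) (a : Label (Fin na)) (r o : Label (Fin (Nat.clog 2 M))) (c : Bool)
  (q : Label (Fin (K + 1)))

/-- A controlled query. -/
noncomputable def queryOp (j : Fin (K + 1)) (U : OracleOp ns na M) :
    QOp (Wire ns na (Nat.clog 2 M) K) := onWires (queryEmb j) (controlled (oracleOnQubits U))

theorem mul_queryOp_apply (j : Fin (K + 1)) (U : OracleOp ns na M) :
    (ρ * queryOp j U) i (mkLabel s a r o c q) =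
      if q j then ∑ z : Label (OracleWires ns na M),
        ρ i (mkLabel (fun k => z (.inr (.inr k))) (fun k => z (.inr (.inl k))) (fun k => z (.inl k))
          o c q) * oracleOnQubits U z (oracleLabel r a s)
      else ρ i (mkLabel s a r o c q) := by
  have hq : (mkLabel s a r o c q ∘ queryEmb (M := M) j) none = q j := rfl
  have hz : (fun k => (mkLabel s a r o c q ∘ queryEmb (M := M) j) (some k)) = oracleLabel r a s := by
    funext k
    rcases k with k | k | k <;> rfl
  rw [queryOp, mul_onWires_apply]
  split_ifs with h
  · symm
    refine Fintype.sum_of_injective (fun z o => o.elim true z) ?_ _ _ ?_ ?_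
    · intro z z' h
      exact funext fun k => congrFun h (some k)
    · intro x hx
      unfold controlled
      rw [if_neg, mul_zero]
      rw [hq, h]
      intro h1
      refine hx ⟨fun k => x (some k), ?_⟩
      funext k
      cases k
      · exact h1.symm
      · rfl
    · intro z
      congr 1
      · congr 1
        symm
        refine extend_eq_of _ (fun k => ?_) fun v hv => ?_
        · rcases k with _ | k | k | k
          · exact h
          · rfl
          · rfl
          · rfl
        · cases v with
          | sys k => exact absurd ⟨some (.inr (.inr k)), rfl⟩ hv
          | anc k => exact absurd ⟨some (.inr (.inl k)), rfl⟩ hv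
          | reg k => exact absurd ⟨some (.inl k), rfl⟩ hv
          | _ => rfl
      · unfold controlled
        rw [hq, hz, h]
        simp
  · rw [Finset.sum_eq_single (mkLabel s a r o c q ∘ queryEmb (M := M) j)]
    · have : controlled (oracleOnQubits U) (mkLabel s a r o c q ∘ queryEmb (M := M) j)
          (mkLabel s a r o c q ∘ queryEmb (M := M) j) = 1 := by
        unfold controlled
        rw [hq]
        simp [h]
      rw [this, mul_one]
      congr 1
      exact extend_eq_of _ (fun _ => rfl) fun _ _ => rfl
    · intro z _ hz'
      have : controlled (oracleOnQubits U) z (mkLabel s a r o c q ∘ queryEmb (M := M) j) = 0 := by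
        unfold controlled
        split_ifs with h1 h2
        · rw [h1, hq] at h2
          exact absurd h2 h
        · rfl
        · rfl
      rw [this, mul_zero]
    · simp

end Query

section StepOp

variable {ns na M K : ℕ}

/-- One step of the descending walk through the time indices: prepare a new index with `P`,
compare it with the old one, unprepare the old one with `G`, and query. -/
noncomputable def stepOp (P G : Fin (Nat.clog 2 M) → Matrix Bool Bool ℂ) (v : Bool) (j : Fin K)
    (U : OracleOp ns na M) : QOp (Wire ns na (Nat.clog 2 M) K) :=
  flagOp j * queryOp j.succ U * onWires oldEmb (tens G)ᴴ * cmpOp j.succ v *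
    onWires regEmb (tens P) * swapReg

/-- The amplitude of the state prepared by `P`. -/
noncomputable def prepAmp {b : ℕ} (P : Fin b → Matrix Bool Bool ℂ) (r : Label (Fin b)) : ℂ :=
  tens P r (zeroLabel _)

/-- The old index m leaves the amplitude of its unpreparation, the new index r enters with that of
its preparation, and r keeps its register until the next step unprepares it. The hypothesis on m
confines the surviving queries to used indices; a branch with a failed comparison may query
anything, since its comparison bit stays set and the flag removes it. -/
theorem mul_stepOp_apply {U : OracleOp ns na M} {B : ℕ → QOp (Fin ns)}
    (hU : ∀ (m m' : Fin M) (x y : Label (Fin ns)),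
      U (m, zeroLabel _, x) (m', zeroLabel _, y) = if m = m' then B m x y else 0)
    (P G : Fin (Nat.clog 2 M) → Matrix Bool Bool ℂ) (v : Bool) (j : Fin K)
    {ι : Type} (ρ : Matrix ι (Label (Wire ns na (Nat.clog 2 M) K)) ℂ) (i : ι)
    (hρ : ∀ x, x (flag j) = true → ρ i x = 0)
    (s : Label (Fin ns)) (m : Label (Fin (Nat.clog 2 M))) (q : Label (Fin (K + 1)))
    (hm : q j.succ = true → ∀ r : Label (Fin (Nat.clog 2 M)),
      binVal r + (if v then 1 else 0) ≤ binVal m → binVal r < M) :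
    (ρ * stepOp P G v j U) i (mkLabel s (zeroLabel _) m (zeroLabel _) false q) =
      star (prepAmp G m) * ∑ r, prepAmp P r *
        if q j.succ then
          if binVal r + (if v then 1 else 0) ≤ binVal m then
            ∑ s', ρ i (mkLabel s' (zeroLabel _) r (zeroLabel _) false q) * B (binVal r) s' s
          else 0
        else ρ i (mkLabel s (zeroLabel _) r (zeroLabel _) false q) := by
  have hquery : ∀ (r n : Label (Fin (Nat.clog 2 M))) (c : Bool),
      (q j.succ = true → c = false → binVal r < M) →
      (ρ * (flagOp j : QOp (Wire ns na (Nat.clog 2 M) K)) * queryOp j.succ U) i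
          (mkLabel s (zeroLabel _) r n c q) =
        if n = zeroLabel _ ∧ c = false then
          if q j.succ then
            ∑ s', ρ i (mkLabel s' (zeroLabel _) r (zeroLabel _) false q) * B (binVal r) s' s
          else ρ i (mkLabel s (zeroLabel _) r (zeroLabel _) false q)
        else 0 := by
    intro r n c hr
    rw [mul_queryOp_apply]
    simp only [mul_flagOp_apply ρ i _ _ _ _ _ _ j hρ]
    by_cases hnc : n = zeroLabel _ ∧ c = false
    · obtain ⟨rfl, rfl⟩ := hnc
      by_cases hq : q j.succ = true
      · simp only [hq, if_true, and_true]
        symm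
        refine Fintype.sum_of_injective (fun s' => oracleLabel r (zeroLabel _) s') ?_ _ _ ?_ ?_
        · intro s1 s2 h
          exact funext fun k => congrFun h (.inr (.inr k))
        · intro z hz
          split_ifs with ha
          · have hz1 : z = oracleLabel (fun k => z (.inl k)) (zeroLabel _)
                (fun k => z (.inr (.inr k))) := by
              funext k
              rcases k with k | k | k
              · rfl
              · exact congrFun ha k
              · rfl
            rw [hz1, oracleOnQubits_apply hU (hr hq rfl), if_neg, mul_zero]
            intro h
            rw [h] at hz1
            exact hz ⟨_, hz1.symm⟩
          · rw [zero_mul]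
        · intro s'
          rw [oracleOnQubits_apply hU (hr hq rfl), if_pos rfl]
          simp [oracleLabel]
      · simp [hq]
    · simp only [hnc, and_false, if_false]
      simp
  have hassoc : ρ * stepOp P G v j U = ρ * (flagOp j : QOp (Wire ns na (Nat.clog 2 M) K)) * queryOp j.succ U *
      (onWires oldEmb (tens G)ᴴ : QOp (Wire ns na (Nat.clog 2 M) K)) *
      (cmpOp j.succ v : QOp (Wire ns na (Nat.clog 2 M) K)) *
      (onWires regEmb (tens P) : QOp (Wire ns na (Nat.clog 2 M) K)) *
      (swapReg : QOp (Wire ns na (Nat.clog 2 M) K)) := by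
    simp only [stepOp, Matrix.mul_assoc]
  rw [hassoc, mul_swapReg_apply, mul_onWires_reg_apply, Finset.mul_sum]
  refine Finset.sum_congr rfl fun r _ => ?_
  rw [mul_cmpOp_apply, mul_onWires_old_apply]
  have hr : ∀ n, (ρ * (flagOp j : QOp (Wire ns na (Nat.clog 2 M) K)) * queryOp j.succ U) i (mkLabel s (zeroLabel _) r n
      (false ^^ (q j.succ && decide (binVal m < binVal r + if v then 1 else 0))) q) = _ :=
    fun n => hquery r n _ (fun h1 h2 => hm h1 r (by simpa [h1] using h2))
  simp only [hr]
  rw [Finset.sum_eq_single (zeroLabel _)]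
  · rw [Matrix.conjTranspose_apply]
    unfold prepAmp
    rw [mul_assoc, mul_comm, mul_assoc]
    congr 2
    by_cases hq : q j.succ = true
    · by_cases hc : binVal r + (if v then 1 else 0) ≤ binVal m
      · simp [hq, hc]
      · simp [hq, hc, not_le.1 hc]
    · simp [hq]
  · intro n _ hn
    simp [hn]
  · simp

end StepOp
end DysonSim

namespace DysonSim
open Matrix Wire

/-! ### One level of the nested circuit, controlled by the unary counter. -/

section Fixes

variable {k w : Type} [Fintype k] [DecidableEq k] [Fintype w] [DecidableEq w]

/-- The operator `A` preserves the label of the wire `v`. -/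
def Fixes (A : QOp w) (v : w) : Prop := ∀ x z, A x z ≠ 0 → x v = z v

variable {A B : QOp w} {v : w}

theorem Fixes.one : Fixes (1 : QOp w) v := fun x z h => by
  by_cases hxz : x = z
  · rw [hxz]
  · exact absurd (Matrix.one_apply_ne hxz) h

theorem Fixes.mul (hA : Fixes A v) (hB : Fixes B v) : Fixes (A * B) v := fun x z h => by
  rw [Matrix.mul_apply] at h
  obtain ⟨y, _, hy⟩ := Finset.exists_ne_zero_of_sum_ne_zero h
  exact (hA x y (left_ne_zero_of_mul hy)).trans (hB y z (right_ne_zero_of_mul hy))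

theorem Fixes.conjTranspose (hA : Fixes A v) : Fixes Aᴴ v := fun x z h =>
  (hA z x fun h' => h (by rw [Matrix.conjTranspose_apply, h', star_zero])).symm

theorem fixes_fiberOp {t : w} (h : v ≠ t) (F : Label w → Matrix Bool Bool ℂ) :
    Fixes (fiberOp t F) v := fun x z hxz => by
  unfold fiberOp at hxz
  rw [ite_ne_right_iff] at hxz
  rw [hxz.1, Function.update_of_ne h]

theorem fixes_onWires {e : k ↪ w} (h : v ∉ Set.range e) (C : QOp k) : Fixes (onWires e C) v :=
  fun x z hxz => by
    by_contra hne
    apply hxz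
    unfold onWires
    rw [if_neg]
    exact fun h' => hne (h' v h)

end Fixes

section Rotation

/-- The rotation with amplitudes `√(1 - p)` and `√p`, and a phase. -/
noncomputable def rotMat (p : ℝ) (φ : ℂ) : Matrix Bool Bool ℂ := fun a b =>
  if a = b then (√(1 - p) : ℝ) else if b then φ * (√p : ℝ) else -star φ * (√p : ℝ)

theorem rotMat_unitary {p : ℝ} (h0 : 0 ≤ p) (h1 : p ≤ 1) {φ : ℂ} (hφ : φ * star φ = 1) :
    rotMat p φ ∈ unitaryGroup Bool ℂ := by
  have hc : ((√(1 - p) : ℝ) : ℂ) * (√(1 - p) : ℝ) = 1 - p := by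
    rw [← Complex.ofReal_mul, Real.mul_self_sqrt (by linarith)]
    push_cast
    ring
  have hs : ((√p : ℝ) : ℂ) * (√p : ℝ) = p := by
    rw [← Complex.ofReal_mul, Real.mul_self_sqrt h0]
  have hφ' : φ * (starRingEnd ℂ) φ = 1 := hφ
  rw [mem_unitaryGroup_iff, star_eq_conjTranspose]
  ext a b
  rw [Matrix.mul_apply, Fintype.sum_bool]
  cases a <;> cases b <;> simp [rotMat, Matrix.conjTranspose_apply]
  · linear_combination hc + φ * (starRingEnd ℂ) φ * hs + p * hφ'
  · ring
  · ring
  · linear_combination hc + φ * (starRingEnd ℂ) φ * hs + p * hφ'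

end Rotation

section Level

variable {ns na M K : ℕ}

/-- The rotation of a counter qubit, controlled by the preceding one. -/
noncomputable def ctlRot {b : ℕ} (j : Fin K) (p : ℝ) (φ : ℂ) : QOp (Wire ns na b K) :=
  fiberOp (ctl j.succ) (fun x => cond (x (ctl j.castSucc)) (rotMat p φ) 1)

/-- One level of the nested circuit around the operator `R` of the deeper levels. -/
noncomputable def levelOp (P G : Fin (Nat.clog 2 M) → Matrix Bool Bool ℂ) (v : Bool) (p : ℝ)
    (j : Fin K) (U : OracleOp ns na M) (R : QOp (Wire ns na (Nat.clog 2 M) K)) :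
    QOp (Wire ns na (Nat.clog 2 M) K) :=
  ctlRot j p Complex.I * R * stepOp P G v j U * ctlRot j p (-1)

/-- Matrices from the qubits to the counter and the system. -/
abbrev OutMat (ns na b K : ℕ) : Type :=
  Matrix (Label (Fin (K + 1)) × Label (Fin ns)) (Label (Wire ns na b K)) ℂ

/-- The final states, in which the time register is unprepared with `P`. -/
noncomputable def outRow {b : ℕ} (P : Fin b → Matrix Bool Bool ℂ) :
    OutMat ns na b K := fun cy x =>
  if x = mkLabel cy.2 (zeroLabel _) (fun i => x (reg i)) (zeroLabel _) false cy.1 then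
    star (prepAmp P fun i => x (reg i)) else 0

theorem outRow_mkLabel {b : ℕ} (P : Fin b → Matrix Bool Bool ℂ) (c q : Label (Fin (K + 1)))
    (y s : Label (Fin ns)) (r : Label (Fin b)) :
    outRow (na := na) P (c, y) (mkLabel s (zeroLabel _) r (zeroLabel _) false q) =
      if q = c then star (prepAmp P r) * (1 : QOp (Fin ns)) y s else 0 := by
  unfold outRow
  by_cases hq : q = c
  · subst hq
    rw [if_pos rfl]
    by_cases hs : y = s
    · subst hs
      rw [Matrix.one_apply_eq, mul_one, if_pos]
      · rfl
      · funext v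
        cases v <;> rfl
    · rw [Matrix.one_apply_ne hs, mul_zero, if_neg]
      intro h
      exact hs (funext fun i => (congrFun h (sys i)).symm)
  · rw [if_neg hq, if_neg]
    intro h
    exact hq (funext fun i => congrFun h (ctl i))

theorem outRow_eq_zero_of_flag {b : ℕ} (P : Fin b → Matrix Bool Bool ℂ)
    (cy : Label (Fin (K + 1)) × Label (Fin ns)) {x : Label (Wire ns na b K)} {j : Fin K}
    (hx : x (flag j) = true) : outRow P cy x = 0 := by
  unfold outRow
  rw [if_neg]
  intro h
  rw [h] at hx
  exact absurd hx (by simp [mkLabel])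

theorem outRow_mul_ctlRot {b : ℕ} (P : Fin b → Matrix Bool Bool ℂ) (j : Fin K) (p : ℝ) (φ : ℂ)
    {c : Label (Fin (K + 1))} (hc : c j.succ = false) (y : Label (Fin ns))
    (x : Label (Wire ns na b K)) :
    ((outRow P : OutMat ns na b K) * (ctlRot j p φ : QOp (Wire ns na b K))) (c, y) x =
      ∑ d, (cond (c j.castSucc) (rotMat p φ) 1 : Matrix Bool Bool ℂ) false d *
        outRow P (Function.update c j.succ d, y) x := by
  have hne : (ctl j.castSucc : Wire ns na b K) ≠ ctl j.succ := by
    simp [Fin.ext_iff]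
  rw [ctlRot, mul_fiberOp_apply, Finset.sum_eq_single false,
    Finset.sum_eq_single (x (ctl j.succ))]
  · have h : outRow P (c, y) (Function.update x (ctl j.succ) false) =
        outRow P (Function.update c j.succ (x (ctl j.succ)), y) x := by
      unfold outRow
      have hr : (fun i => Function.update x (ctl j.succ) false (reg i)) = fun i => x (reg i) := by
        funext i
        rw [Function.update_of_ne (by simp)]
      rw [hr]
      congr 1
      rw [eq_iff_iff]
      constructor
      · intro h
        funext v
        have hv := congrFun h v
        cases v with
        | ctl i =>
          by_cases hi : i = j.succ
          · subst hi
            simp [mkLabel]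
          · rw [Function.update_of_ne (by simpa using hi)] at hv
            rw [hv]
            simp [mkLabel, hi]
        | _ => rw [Function.update_of_ne (by simp)] at hv; exact hv
      · intro h
        funext v
        have hv := congrFun h v
        cases v with
        | ctl i =>
          by_cases hi : i = j.succ
          · subst hi
            simp [mkLabel, hc]
          · rw [Function.update_of_ne (by simpa using hi), hv]
            simp [mkLabel, hi]
        | _ => rw [Function.update_of_ne (by simp)]; exact hv
    rw [h, mul_comm]
    by_cases h0 : outRow P (Function.update c j.succ (x (ctl j.succ)), y) x = 0
    · rw [h0, mul_zero, mul_zero]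
    · congr 2
      have hx : x = mkLabel y (zeroLabel _) (fun i => x (reg i)) (zeroLabel _) false
          (Function.update c j.succ (x (ctl j.succ))) := by
        by_contra hne'
        exact h0 (if_neg hne')
      rw [hx]
      simp only [mkLabel]
      rw [Function.update_of_ne]
      simp [Fin.ext_iff]
  · intro d _ hd
    unfold outRow
    rw [if_neg, mul_zero]
    intro h
    apply hd
    rw [h]
    simp [mkLabel]
  · simp
  · intro d _ hd
    unfold outRow
    rw [if_neg, zero_mul]
    intro h
    have := congrFun h (ctl j.succ)
    simp only [Function.update_self, mkLabel, hc] at this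
    exact hd this
  · simp

/-- The operator `R` of the levels from `i` on acts on the time register and the system like `Y`,
provided that counter qubit `i` is set. -/
def RowSpec (P : Fin (Nat.clog 2 M) → Matrix Bool Bool ℂ) (i : Fin (K + 1))
    (R : QOp (Wire ns na (Nat.clog 2 M) K)) (Y : Label (Fin (Nat.clog 2 M)) → QOp (Fin ns)) :
    Prop :=
  ∀ (c q : Label (Fin (K + 1))) (y s : Label (Fin ns)) (r : Label (Fin (Nat.clog 2 M))),
    (∀ i' > i, q i' = false) → (∀ i' > i, c i' = false) → (q i = true → binVal r < M) →
    ((outRow P : OutMat ns na (Nat.clog 2 M) K) * R) (c, y)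
        (mkLabel s (zeroLabel _) r (zeroLabel _) false q) =
      if q = c then star (prepAmp P r) * (cond (q i) (Y r) 1 : QOp (Fin ns)) y s else 0

/-- The sum over the continuations of a walk at `m` by a step of at least `d`. -/
noncomputable def walkSum {b : ℕ} (P : Fin b → Matrix Bool Bool ℂ) (B : ℕ → QOp (Fin ns))
    (Y : Label (Fin b) → QOp (Fin ns)) (d m : ℕ) : QOp (Fin ns) :=
  ∑ r : Label (Fin b), if binVal r + d ≤ m then
    (prepAmp P r * star (prepAmp P r)) • (Y r * B (binVal r)) else 0

/-- The final rotation splits the row into two counter values, R is applied to each by its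
specification, and the first rotation recombines them. If the walk has already stopped, the step
merely exchanges one prepared index for another, which contributes ∑ |amplitude|² = 1; stopped
branches thus need no separate treatment. The row formulation lets R be known only on labels that
occur. -/
theorem outRow_mul_levelOp {U : OracleOp ns na M} {B : ℕ → QOp (Fin ns)}
    (hU : ∀ (m m' : Fin M) (x y : Label (Fin ns)),
      U (m, zeroLabel _, x) (m', zeroLabel _, y) = if m = m' then B m x y else 0)
    {P : Fin (Nat.clog 2 M) → Matrix Bool Bool ℂ}
    (hP : ∑ r, prepAmp P r * star (prepAmp P r) = 1)
    (G : Fin (Nat.clog 2 M) → Matrix Bool Bool ℂ) (v : Bool)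
    {p : ℝ} (hp0 : 0 ≤ p) (hp1 : p ≤ 1) (j : Fin K)
    {R : QOp (Wire ns na (Nat.clog 2 M) K)} {Y : Label (Fin (Nat.clog 2 M)) → QOp (Fin ns)}
    (hR : RowSpec P j.succ R Y) (hRf : Fixes R (flag j))
    (c q : Label (Fin (K + 1))) (y s : Label (Fin ns)) (m : Label (Fin (Nat.clog 2 M)))
    (hq : ∀ i > j.castSucc, q i = false) (hc : ∀ i > j.castSucc, c i = false)
    (hm : q j.castSucc = true → ∀ r : Label (Fin (Nat.clog 2 M)),
      binVal r + (if v then 1 else 0) ≤ binVal m → binVal r < M) :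
    ((outRow P : OutMat ns na (Nat.clog 2 M) K) * levelOp P G v p j U R) (c, y)
        (mkLabel s (zeroLabel _) m (zeroLabel _) false q) =
      if q = c then star (prepAmp G m) * (cond (q j.castSucc)
        (((1 - p : ℝ) : ℂ) • (1 : QOp (Fin ns)) + (Complex.I * p) •
          walkSum P B Y (if v then 1 else 0) (binVal m)) 1 : QOp (Fin ns)) y s
      else 0 := by
  have hjs : j.succ > j.castSucc := Fin.castSucc_lt_succ
  have hgt : ∀ i > j.succ, i > j.castSucc := fun i hi => hjs.trans hi
  have hcne : j.castSucc ≠ j.succ := ne_of_lt hjs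
  have hcs := hc _ hjs
  have hqs := hq _ hjs
  set ζ := (outRow P : OutMat ns na (Nat.clog 2 M) K) *
    (ctlRot j p Complex.I : QOp (Wire ns na (Nat.clog 2 M) K)) * R with hζ
  have hζ' : ∀ x, ζ (c, y) x =
      ∑ d, (cond (c j.castSucc) (rotMat p Complex.I) 1 : Matrix Bool Bool ℂ) false d *
        ((outRow P : OutMat ns na (Nat.clog 2 M) K) * R) (Function.update c j.succ d, y) x := by
    intro x
    rw [hζ, Matrix.mul_apply]
    simp only [outRow_mul_ctlRot P j p _ hcs y, Finset.sum_mul, Matrix.mul_apply, Finset.mul_sum]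
    rw [Finset.sum_comm]
    simp only [mul_assoc]
  -- Deeper levels use other flags, so flag j still has to be 0 at the end.
  have hkill : ∀ x, x (flag j) = true → ζ (c, y) x = 0 := by
    intro x hx
    rw [hζ']
    refine Finset.sum_eq_zero fun d _ => ?_
    rw [Matrix.mul_apply, Finset.sum_eq_zero, mul_zero]
    intro z _
    by_cases h0 : R z x = 0
    · rw [h0, mul_zero]
    · rw [outRow_eq_zero_of_flag P _ ((hRf z x h0).trans hx), zero_mul]
  have hupd : ∀ d, Function.update (mkLabel s (zeroLabel (Fin na)) m (zeroLabel _) false q)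
      (ctl j.succ) d = mkLabel s (zeroLabel _) m (zeroLabel _) false
        (Function.update q j.succ d) := by
    intro d
    funext v
    cases v with
    | ctl i =>
      by_cases hi : i = j.succ
      · subst hi
        simp [mkLabel]
      · rw [Function.update_of_ne (by simpa using hi)]
        simp [mkLabel, hi]
    | _ => rw [Function.update_of_ne (by simp)]; rfl
  have hval : ∀ (d : Bool) (s' : Label (Fin ns)) (r : Label (Fin (Nat.clog 2 M))),
      (d = true → binVal r < M) →
      ζ (c, y) (mkLabel s' (zeroLabel _) r (zeroLabel _) false (Function.update q j.succ d)) =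
        if q = c then (cond (c j.castSucc) (rotMat p Complex.I) 1 : Matrix Bool Bool ℂ) false d *
          (star (prepAmp P r) * (cond d (Y r) 1 : QOp (Fin ns)) y s') else 0 := by
    intro d s' r hr
    rw [hζ', Finset.sum_eq_single d]
    · rw [hR _ _ y s' r]
      · rw [Function.update_self]
        by_cases hqc : q = c
        · rw [if_pos hqc, if_pos (by rw [hqc])]
        · rw [if_neg hqc, if_neg, mul_zero]
          intro h
          apply hqc
          funext i
          by_cases hi : i = j.succ
          · rw [hi, hqs, hcs]
          · simpa [hi] using congrFun h i
      · intro i hi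
        rw [Function.update_of_ne hi.ne', hq i (hgt i hi)]
      · intro i hi
        rw [Function.update_of_ne hi.ne', hc i (hgt i hi)]
      · rw [Function.update_self]
        exact hr
    · intro d' _ hd'
      rw [hR _ _ y s' r, if_neg, mul_zero]
      · intro h
        have := congrFun h j.succ
        simp only [Function.update_self] at this
        exact hd' this.symm
      · intro i hi
        rw [Function.update_of_ne hi.ne', hq i (hgt i hi)]
      · intro i hi
        rw [Function.update_of_ne hi.ne', hc i (hgt i hi)]
      · rw [Function.update_self]
        exact hr
    · simp
  have hassoc : (outRow P : OutMat ns na (Nat.clog 2 M) K) * levelOp P G v p j U R =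
      ζ * stepOp P G v j U * (ctlRot j p (-1) : QOp (Wire ns na (Nat.clog 2 M) K)) := by
    simp only [levelOp, hζ, Matrix.mul_assoc]
  have hcond : mkLabel (K := K) s (zeroLabel (Fin na)) m (zeroLabel _) false q (ctl j.castSucc) =
      q j.castSucc := rfl
  have hconds : mkLabel (K := K) s (zeroLabel (Fin na)) m (zeroLabel _) false q (ctl j.succ) =
      false := hqs
  rw [hassoc, ctlRot, mul_fiberOp_apply, Fintype.sum_bool, hupd, hupd, hcond, hconds]
  -- The walk stops here: no comparison and no query, and the new index is unprepared again with
  -- total weight 1.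
  have hstep0 : (ζ * stepOp P G v j U) (c, y) (mkLabel s (zeroLabel _) m (zeroLabel _) false
      (Function.update q j.succ false)) =
      if q = c then star (prepAmp G m) *
        ((cond (c j.castSucc) (rotMat p Complex.I) 1 : Matrix Bool Bool ℂ) false false *
          (1 : QOp (Fin ns)) y s) else 0 := by
    rw [mul_stepOp_apply hU P G v j ζ (c, y) hkill s m (Function.update q j.succ false)
      (by simp)]
    simp only [Function.update_self, Bool.false_eq_true, if_false]
    by_cases hqc : q = c
    · rw [if_pos hqc]
      congr 1
      have := congrArg (fun z => (cond (c j.castSucc) (rotMat p Complex.I) 1 : Matrix Bool Bool ℂ)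
        false false * (1 : QOp (Fin ns)) y s * z) hP
      simp only [mul_one, Finset.mul_sum] at this
      rw [← this]
      refine Finset.sum_congr rfl fun r _ => ?_
      rw [hval false s r (by simp), if_pos hqc]
      simp only [cond_false]
      ring
    · rw [if_neg hqc, Finset.sum_eq_zero, mul_zero]
      intro r _
      rw [hval false s r (by simp), if_neg hqc, mul_zero]
  -- The walk goes on: the preparation of r and the unpreparation inside R give the weights of
  -- `walkSum`.
  have hstep1 : q j.castSucc = true → (ζ * stepOp P G v j U) (c, y)
      (mkLabel s (zeroLabel _) m (zeroLabel _) false (Function.update q j.succ true)) =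
      if q = c then star (prepAmp G m) *
        (rotMat p Complex.I false true *
          walkSum P B Y (if v then 1 else 0) (binVal m) y s)
      else 0 := by
    intro hqt
    rw [mul_stepOp_apply hU P G v j ζ (c, y) hkill s m (Function.update q j.succ true)
      (fun _ => hm hqt)]
    simp only [Function.update_self, if_true]
    by_cases hqc : q = c
    · rw [if_pos hqc]
      congr 1
      rw [walkSum, Matrix.sum_apply, Finset.mul_sum]
      refine Finset.sum_congr rfl fun r _ => ?_
      by_cases hr : binVal r + (if v then 1 else 0) ≤ binVal m
      · rw [if_pos hr, if_pos hr, Matrix.smul_apply, Matrix.mul_apply, smul_eq_mul, Finset.mul_sum,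
          Finset.mul_sum,
          Finset.mul_sum]
        refine Finset.sum_congr rfl fun s' _ => ?_
        rw [hval true s' r (fun _ => hm hqt r hr), if_pos hqc, ← hqc, hqt]
        simp only [cond_true]
        ring
      · rw [if_neg hr, if_neg hr]
        simp
    · rw [if_neg hqc, Finset.sum_eq_zero, mul_zero]
      intro r _
      by_cases hr : binVal r + (if v then 1 else 0) ≤ binVal m
      · rw [if_pos hr, Finset.sum_eq_zero, mul_zero]
        intro s' _
        rw [hval true s' r (fun _ => hm hqt r hr), if_neg hqc, zero_mul]
      · rw [if_neg hr, mul_zero]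
  rw [hstep0]
  cases hqt : q j.castSucc
  · by_cases hqc : q = c
    · subst hqc
      simp [hqt]
    · simp [hqc]
  · rw [hstep1 hqt]
    by_cases hqc : q = c
    · subst hqc
      -- The first rotation, with phase -1, has first column √(1 - p), √p; the last, with phase I,
      -- has first row √(1 - p), I√p. Their products are the coefficients 1 - p and I·p.
      have hcc : ((√(1 - p) : ℝ) : ℂ) * (√(1 - p) : ℝ) = ((1 - p : ℝ) : ℂ) := by
        rw [← Complex.ofReal_mul, Real.mul_self_sqrt (by linarith)]
      have hss : ((√p : ℝ) : ℂ) * (√p : ℝ) = p := by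
        rw [← Complex.ofReal_mul, Real.mul_self_sqrt hp0]
      simp only [hqt, if_true, cond_true, Matrix.add_apply, Matrix.smul_apply, smul_eq_mul]
      generalize walkSum P B Y (if v then 1 else 0) (binVal m) y s = T
      simp only [rotMat, if_true, Bool.false_eq_true, if_false, Bool.true_eq_false, star_neg,
        star_one, neg_neg, one_mul]
      linear_combination star (prepAmp G m) * Complex.I * T * hss +
        star (prepAmp G m) * (1 : QOp (Fin ns)) y s * hcc
    · simp [hqc]

end Level
end DysonSim

namespace DysonSim
open Matrix Wire

/-! ### The nested circuit encodes the truncated walk sums. -/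

section FixesOps

variable {ns na M K : ℕ}

theorem fixes_swapList {b : ℕ} {v : Wire ns na b K} (hr : ∀ i, v ≠ reg i) (ho : ∀ i, v ≠ old i)
    (l : List (Fin b)) : Fixes (swapList l) v := by
  induction l with
  | nil => exact Fixes.one
  | cons j l ih =>
    exact (((fixes_fiberOp (hr j) _).mul (fixes_fiberOp (ho j) _)).mul
      (fixes_fiberOp (hr j) _)).mul ih

theorem fixes_ctlRot {b : ℕ} {v : Wire ns na b K} (h : ∀ i, v ≠ ctl i) (j : Fin K) (p : ℝ)
    (φ : ℂ) : Fixes (ctlRot j p φ) v := fixes_fiberOp (h _) _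

/-- The wire `v` is a padding or scratch qubit or a flag other than `j`. -/
def Idle {b : ℕ} (j : Fin K) : Wire ns na b K → Prop
  | pad => True
  | scr _ => True
  | flag i => i ≠ j
  | _ => False

theorem fixes_levelOp {v : Wire ns na (Nat.clog 2 M) K} {j : Fin K} (hv : Idle j v)
    (P G : Fin (Nat.clog 2 M) → Matrix Bool Bool ℂ) (d : Bool) (p : ℝ) (U : OracleOp ns na M)
    {R : QOp (Wire ns na (Nat.clog 2 M) K)} (hR : Fixes R v) :
    Fixes (levelOp P G d p j U R) v := by
  have hreg : ∀ i, v ≠ reg i := by rintro i rfl; exact hv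
  have hold : ∀ i, v ≠ old i := by rintro i rfl; exact hv
  have hctl : ∀ i, v ≠ ctl i := by rintro i rfl; exact hv
  have hanc : ∀ i, v ≠ anc i := by rintro i rfl; exact hv
  have hsys : ∀ i, v ≠ sys i := by rintro i rfl; exact hv
  have hcmp : v ≠ cmpBit := by rintro rfl; exact hv
  have hflag : v ≠ flag j := by rintro rfl; exact hv rfl
  have hstep : Fixes (stepOp P G d j U) v := by
    unfold stepOp
    refine (((((fixes_fiberOp hflag _).mul (fixes_onWires ?_ _)).mul (fixes_onWires ?_ _)).mul
      (fixes_fiberOp hcmp _)).mul (fixes_onWires ?_ _)).mul (fixes_swapList hreg hold _)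
    · rintro ⟨i, hi⟩
      rcases i with _ | i | i | i
      · exact hctl _ hi.symm
      · exact hreg _ hi.symm
      · exact hanc _ hi.symm
      · exact hsys _ hi.symm
    · rintro ⟨i, hi⟩
      exact hold i hi.symm
    · rintro ⟨i, hi⟩
      exact hreg i hi.symm
  exact (((fixes_ctlRot hctl _ _ _).mul hR).mul hstep).mul (fixes_ctlRot hctl _ _ _)

end FixesOps

section Rest

variable {ns na M K : ℕ}

/-- The last `n` levels. -/
noncomputable def restOp (P : Fin (Nat.clog 2 M) → Matrix Bool Bool ℂ) (p : ℝ)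
    (U : OracleOp ns na M) : (n : ℕ) → n ≤ K → QOp (Wire ns na (Nat.clog 2 M) K)
  | 0, _ => 1
  | n + 1, h => levelOp P P true p ⟨K - (n + 1), by omega⟩ U (restOp P p U n (by omega))

/-- The truncated sums over descending walks below `m`, in Horner form. -/
noncomputable def walk {b : ℕ} (P : Fin b → Matrix Bool Bool ℂ) (B : ℕ → QOp (Fin ns)) (p : ℝ) :
    ℕ → ℕ → QOp (Fin ns)
  | 0, _ => 1
  | n + 1, m => ((1 - p : ℝ) : ℂ) • (1 : QOp (Fin ns)) +
      (Complex.I * p) • walkSum P B (fun r => walk P B p n (binVal r)) 1 m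

theorem fixes_restOp (P : Fin (Nat.clog 2 M) → Matrix Bool Bool ℂ) (p : ℝ) (U : OracleOp ns na M)
    (n : ℕ) (h : n ≤ K) {v : Wire ns na (Nat.clog 2 M) K}
    (hv : ∀ j : Fin K, K ≤ j + n → Idle j v) : Fixes (restOp P p U n h) v := by
  induction n with
  | zero => exact Fixes.one
  | succ n ih =>
    exact fixes_levelOp (hv _ (by simp; omega)) _ _ _ _ _ (ih (by omega) fun j hj => hv j (by omega))

/-- Induction from the innermost level outwards. The strict comparison makes a used index m pass
only to smaller, hence used, indices. -/
theorem rowSpec_restOp {U : OracleOp ns na M} {B : ℕ → QOp (Fin ns)}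
    (hU : ∀ (m m' : Fin M) (x y : Label (Fin ns)),
      U (m, zeroLabel _, x) (m', zeroLabel _, y) = if m = m' then B m x y else 0)
    {P : Fin (Nat.clog 2 M) → Matrix Bool Bool ℂ}
    (hP : ∑ r, prepAmp P r * star (prepAmp P r) = 1)
    {p : ℝ} (hp0 : 0 ≤ p) (hp1 : p ≤ 1) (n : ℕ) (h : n ≤ K) :
    RowSpec P ⟨K - n, by omega⟩ (restOp P p U n h) (fun r => walk P B p n (binVal r)) := by
  induction n with
  | zero =>
    intro c q y s r _ _ _
    rw [restOp, Matrix.mul_one, outRow_mkLabel]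
    simp [walk]
  | succ n ih =>
    have hK : K - (n + 1) < K := by omega
    have hidx : (⟨K - n, by omega⟩ : Fin (K + 1)) = (⟨K - (n + 1), hK⟩ : Fin K).succ := by
      ext
      simp
      omega
    have ih' := ih (by omega)
    rw [hidx] at ih'
    intro c q y s r hq hc hm
    rw [restOp, outRow_mul_levelOp hU hP P true hp0 hp1 ⟨K - (n + 1), hK⟩ ih' _ c q y s r hq hc]
    · rfl
    · intro hq1 r' hr'
      have := hm hq1
      simp only [if_true] at hr'
      omega
    · refine fixes_restOp P p U n _ fun j hj => ?_
      intro h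
      rw [← h] at hj
      simp at hj
      omega

end Rest

section Encoder

variable {ns na M K : ℕ}

/-- The one-qubit gates that load the constant `z` into a register. -/
def loadGate {b : ℕ} (z : Label (Fin b)) (i : Fin b) : Matrix Bool Bool ℂ := cond (z i) boolX 1

theorem prepAmp_loadGate {b : ℕ} (z r : Label (Fin b)) :
    prepAmp (loadGate z) r = if r = z then 1 else 0 := by
  unfold prepAmp tens loadGate
  split_ifs with h
  · subst h
    refine Finset.prod_eq_one fun i _ => ?_
    cases hr : r i <;> simp [zeroLabel, boolX]
  · obtain ⟨i, hi⟩ := Function.ne_iff.1 h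
    refine Finset.prod_eq_zero (Finset.mem_univ i) ?_
    cases hr : r i <;> cases hz : z i <;> simp_all [zeroLabel, boolX]

/-- The flip of the first counter qubit. -/
noncomputable def startOp {b : ℕ} : QOp (Wire ns na b K) := xorOp (ctl 0) (fun _ => true)

/-- The circuit that encodes the truncated Dyson series. -/
noncomputable def encOp (P : Fin (Nat.clog 2 M) → Matrix Bool Bool ℂ)
    (z : Label (Fin (Nat.clog 2 M))) (p θ : ℝ) (U : OracleOp ns na M) :
    QOp (Wire ns na (Nat.clog 2 M) (K + 1)) :=
  startOp * onWires regEmb (tens P)ᴴ *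
    levelOp P (loadGate z) false p 0 U (restOp P p U K (Nat.le_succ K)) *
    startOp * onWires regEmb (tens (loadGate z)) * fiberOp pad (fun _ => rotMat θ 1)

/-- The label of the system state `s` with all other qubits in `0`. -/
def embLabel {b : ℕ} (s : Label (Fin ns)) : Label (Wire ns na b K) :=
  mkLabel s (zeroLabel _) (zeroLabel _) (zeroLabel _) false (zeroLabel _)

/-- The counter after its start. -/
def startLabel (K : ℕ) : Label (Fin (K + 1)) := Function.update (zeroLabel _) 0 true

theorem startOp_mul_apply {b : ℕ} (P : Fin b → Matrix Bool Bool ℂ) (y : Label (Fin ns))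
    (x : Label (Wire ns na b K)) :
    ((startOp : QOp (Wire ns na b K)) * (onWires regEmb (tens P)ᴴ : QOp (Wire ns na b K)))
      (embLabel y) x =
      (outRow P : OutMat ns na b K) (startLabel K, y) x := by
  have hrange : ∀ (z : Label (Fin b)) (i : Fin b),
      (Function.extend regEmb z x : Label (Wire ns na b K)) (reg i) = z i := fun z i =>
    (regEmb (ns := ns) (na := na) (K := K)).injective.extend_apply z x i
  have hoff : ∀ (z : Label (Fin b)) (v : Wire ns na b K), (∀ i, v ≠ reg i) →
      (Function.extend regEmb z x : Label (Wire ns na b K)) v = x v := fun z v hv =>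
    Function.extend_apply' _ _ _ (by rintro ⟨i, hi⟩; exact hv i hi.symm)
  have hstart : ∀ x' : Label (Wire ns na b K), (startOp : QOp (Wire ns na b K)) (embLabel y) x' =
      if x' = mkLabel y (zeroLabel _) (zeroLabel _) (zeroLabel _) false (startLabel K) then 1
      else 0 := by
    intro x'
    rw [startOp, ← Matrix.one_mul (xorOp _ _), mul_xorOp_apply, Matrix.one_apply]
    congr 1
    rw [eq_iff_iff]
    constructor
    · intro h
      funext v
      have hv := congrFun h v
      cases v with
      | ctl i =>
        by_cases hi : i = 0
        · subst hi
          rw [Function.update_self] at hv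
          simp only [embLabel, mkLabel, zeroLabel, startLabel, Function.update_self] at hv ⊢
          generalize x' (ctl 0) = d at hv ⊢
          revert hv
          cases d <;> simp
        · rw [Function.update_of_ne (by simpa using hi)] at hv
          rw [← hv]
          simp [embLabel, mkLabel, startLabel, hi]
      | _ => rw [Function.update_of_ne (by simp)] at hv; exact hv.symm
    · rintro rfl
      funext v
      cases v with
      | ctl i =>
        by_cases hi : i = 0
        · subst hi
          rw [Function.update_self]
          simp only [embLabel, mkLabel, startLabel, Function.update_self]
          rfl
        · rw [Function.update_of_ne (by simpa using hi)]
          simp [embLabel, mkLabel, startLabel, hi]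
      | _ => rw [Function.update_of_ne (by simp)]; rfl
  rw [mul_onWires_apply]
  simp only [hstart]
  unfold outRow
  by_cases hx : x = mkLabel y (zeroLabel _) (fun i => x (reg i)) (zeroLabel _) false (startLabel K)
  · rw [if_pos hx, Finset.sum_eq_single (zeroLabel _)]
    · rw [if_pos, one_mul]
      · rfl
      · funext v
        cases v with
        | reg i => exact hrange _ i
        | _ => rw [hoff _ _ (by simp), hx]; rfl
    · intro z _ hz
      rw [if_neg, zero_mul]
      intro h
      apply hz
      funext i
      have := congrFun h (reg i)
      rw [hrange] at this
      exact this
    · simp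
  · rw [if_neg hx]
    refine Finset.sum_eq_zero fun z _ => ?_
    rw [if_neg, zero_mul]
    intro h
    apply hx
    funext v
    have hv := congrFun h v
    cases v with
    | reg i => rfl
    | _ => rw [hoff _ _ (by simp)] at hv; exact hv

/-- The start index is loaded as a classical constant, so the amplitude of its unpreparation is 1.
The padding qubit is touched by its rotation alone and has to end in 0, which gives the factor √(1 -
θ). -/
theorem encOp_apply {U : OracleOp ns na M} {B : ℕ → QOp (Fin ns)}
    (hU : ∀ (m m' : Fin M) (x y : Label (Fin ns)),
      U (m, zeroLabel _, x) (m', zeroLabel _, y) = if m = m' then B m x y else 0)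
    {P : Fin (Nat.clog 2 M) → Matrix Bool Bool ℂ}
    (hP : ∑ r, prepAmp P r * star (prepAmp P r) = 1)
    {z : Label (Fin (Nat.clog 2 M))} (hz : binVal z + 1 = M)
    {p : ℝ} (hp0 : 0 ≤ p) (hp1 : p ≤ 1) (θ : ℝ) (y s : Label (Fin ns)) :
    (encOp P z p θ U : QOp (Wire ns na (Nat.clog 2 M) (K + 1))) (embLabel y) (embLabel s) =
      (√(1 - θ) : ℝ) * walk P B p (K + 1) M y s := by
  set A : QOp (Wire ns na (Nat.clog 2 M) (K + 1)) := startOp * onWires regEmb (tens P)ᴴ *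
    levelOp P (loadGate z) false p 0 U (restOp P p U K (Nat.le_succ K)) *
    startOp * onWires regEmb (tens (loadGate z)) with hA
  have hpad : Fixes A pad := by
    refine ((((fixes_fiberOp (by simp) _).mul (fixes_onWires ?_ _)).mul
      (fixes_levelOp (v := pad) True.intro _ _ _ _ _
        (fixes_restOp P p U K _ (v := pad) fun _ _ => True.intro))).mul
      (fixes_fiberOp (by simp) _)).mul (fixes_onWires ?_ _)
    all_goals
      rintro ⟨i, hi⟩
      simp [regEmb] at hi
  have h1 : encOp P z p θ U = A * fiberOp pad (fun _ => rotMat θ 1) := rfl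
  rw [h1, mul_fiberOp_apply, Fintype.sum_bool]
  have h2 : A (embLabel y) (Function.update (embLabel s) pad true) = 0 := by
    by_contra hne
    have := hpad _ _ hne
    rw [Function.update_self] at this
    exact absurd this (by simp [embLabel, mkLabel])
  have h3 : Function.update (embLabel s : Label (Wire ns na (Nat.clog 2 M) (K + 1))) pad false =
      embLabel s := by
    rw [Function.update_eq_self_iff]
    rfl
  rw [h2, h3, zero_mul, zero_add, mul_comm]
  congr 1
  have hemb : (embLabel s : Label (Wire ns na (Nat.clog 2 M) (K + 1))) =
    mkLabel s (zeroLabel _) (zeroLabel _) (zeroLabel _) false (zeroLabel _) := rfl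
  rw [hA, hemb, mul_onWires_reg_apply, Finset.sum_eq_single z]
  · have hload : tens (loadGate z) z (zeroLabel _) = 1 :=
      (prepAmp_loadGate z z).trans (if_pos rfl)
    rw [hload, mul_one, startOp, mul_xorOp_apply]
    have hl : Function.update (mkLabel s (zeroLabel (Fin na)) z (zeroLabel _) false (zeroLabel _))
        (ctl 0) (mkLabel (K := K + 1) s (zeroLabel (Fin na)) z (zeroLabel _) false (zeroLabel _)
          (ctl 0) ^^ true) =
        mkLabel s (zeroLabel (Fin na)) z (zeroLabel _) false (startLabel (K + 1)) := by
      funext v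
      cases v with
      | ctl i =>
        by_cases hi : i = 0
        · subst hi
          simp [mkLabel, startLabel, zeroLabel]
        · rw [Function.update_of_ne (by simpa using hi)]
          simp [mkLabel, startLabel, hi]
      | _ => rw [Function.update_of_ne (by simp)]; rfl
    rw [hl]
    have hrow : ((startOp : QOp (Wire ns na (Nat.clog 2 M) (K + 1))) *
        (onWires regEmb (tens P)ᴴ : QOp (Wire ns na (Nat.clog 2 M) (K + 1))) *
        levelOp P (loadGate z) false p 0 U (restOp P p U K (Nat.le_succ K))) (embLabel y)
          (mkLabel s (zeroLabel (Fin na)) z (zeroLabel _) false (startLabel (K + 1))) =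
        ((outRow P : OutMat ns na (Nat.clog 2 M) (K + 1)) *
          levelOp P (loadGate z) false p 0 U (restOp P p U K (Nat.le_succ K))) (startLabel (K + 1), y)
          (mkLabel s (zeroLabel (Fin na)) z (zeroLabel _) false (startLabel (K + 1))) := by
      rw [Matrix.mul_apply, Matrix.mul_apply]
      refine Finset.sum_congr rfl fun x _ => ?_
      rw [startOp_mul_apply]
    have hrs := rowSpec_restOp (K := K + 1) hU hP hp0 hp1 K (Nat.le_succ K)
    have hidx : (⟨K + 1 - K, by omega⟩ : Fin (K + 1 + 1)) = (0 : Fin (K + 1)).succ := by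
      ext
      simp
    rw [hidx] at hrs
    have hgt : ∀ i > (0 : Fin (K + 1)).castSucc, startLabel (K + 1) i = false := by
      intro i hi
      rw [startLabel, Function.update_of_ne]
      · rfl
      · rintro rfl
        exact lt_irrefl _ hi
    rw [← startOp, hrow, outRow_mul_levelOp hU hP (loadGate z) false hp0 hp1 0 hrs _ _ _ y s z hgt hgt,
      if_pos rfl, prepAmp_loadGate, if_pos rfl, star_one, one_mul]
    · have hc : startLabel (K + 1) (0 : Fin (K + 1)).castSucc = true := by
        simp [startLabel]
      rw [hc, cond_true, walk]
      -- M itself need not fit into the register. The walk starts at M - 1 with a non-strict first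
      -- comparison, which equals a strict one with M.
      have hs : walkSum P B (fun r => walk P B p K (binVal r)) (if false = true then 1 else 0)
          (binVal z) = walkSum P B (fun r => walk P B p K (binVal r)) 1 M := by
        unfold walkSum
        refine Finset.sum_congr rfl fun r _ => ?_
        have : binVal r + (if false = true then 1 else 0) ≤ binVal z ↔ binVal r + 1 ≤ M := by
          simp
          omega
        simp only [this]
      rw [hs]
    · intro _ r hr
      simp at hr
      omega
    · refine fixes_restOp P p U K _ fun j hj => ?_
      intro h
      rw [← h] at hj
      simp at hj
  · intro r _ hr
    have hload : tens (loadGate z) r (zeroLabel _) = 0 :=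
      (prepAmp_loadGate z r).trans (if_neg hr)
    rw [hload, mul_zero]
  · simp

theorem fixes_encOp (P : Fin (Nat.clog 2 M) → Matrix Bool Bool ℂ)
    (z : Label (Fin (Nat.clog 2 M))) (p θ : ℝ) (U : OracleOp ns na M)
    (i : Fin (na + 2 * Nat.clog 2 M + 2 * (K + 1) + 10)) :
    Fixes (encOp P z p θ U : QOp (Wire ns na (Nat.clog 2 M) (K + 1))) (scr i) := by
  refine (((((fixes_fiberOp (by simp) _).mul (fixes_onWires ?_ _)).mul
    (fixes_levelOp (v := scr i) True.intro _ _ _ _ _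
      (fixes_restOp P p U K _ (v := scr i) fun _ _ => True.intro))).mul
    (fixes_fiberOp (by simp) _)).mul (fixes_onWires ?_ _)).mul (fixes_fiberOp (by simp) _)
  all_goals
    rintro ⟨i, hi⟩
    simp [regEmb] at hi

end Encoder

/-! ### Query and gate counts of the encoding circuit. -/

section Costs

variable {ns na M K L : ℕ}

theorem gateImpl_swapList {b : ℕ} (l : List (Fin b)) :
    GateImpl ns na M L (3 * l.length) (swapList l : QOp (Wire ns na b K)) := by
  induction l with
  | nil => exact GateImpl.one
  | cons j l ih =>
    exact ((gateImpl_swap (by simp)).mul ih).mono (by simp; omega)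

theorem gateImpl_cmpOp {b : ℕ} (j : Fin (K + 1)) (v : Bool) :
    GateImpl ns na M L (30 * (b + 1) + 5) (cmpOp j v : QOp (Wire ns na b K)) :=
  gateImpl_cmpCond (scratch_injOn (by omega)) (by simp [scratch]) (by simp [scratch]) (by simp)
    (by simp) (by simp) (by simp [scratch]) (by simp [scratch]) (by simp)

theorem gateImpl_flagOp {b : ℕ} (j : Fin K) :
    GateImpl ns na M L (12 * (na + b + 1) + 1) (flagOp j : QOp (Wire ns na b K)) := by
  have h := card_dirty_le (ns := ns) (na := na) (b := b) (K := K)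
  refine GateImpl.mono (gateImpl_orCond (G := fun c => cond c boolX 1)
    (scratch_injOn (h.trans (by omega)))
    (by simp [scratch, mem_dirty, isDirty]) (by simp [mem_dirty, isDirty]) (by simp [scratch])
    fun c => cond_mem boolX_unitary (one_mem _) c) (by omega)

theorem gateImpl_ctlRot {b : ℕ} (j : Fin K) {p : ℝ} (hp0 : 0 ≤ p) (hp1 : p ≤ 1) {φ : ℂ}
    (hφ : φ * star φ = 1) : GateImpl ns na M L 1 (ctlRot j p φ : QOp (Wire ns na b K)) :=
  gateImpl_ctrl (G := fun c => cond c (rotMat p φ) 1) (by simp [Fin.ext_iff]) fun c =>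
    cond_mem (rotMat_unitary hp0 hp1 hφ) (one_mem _) c

theorem impl_queryOp (j : Fin (K + 1)) (l : Fin L) :
    Impl 1 0 (fun O : Fin L → OracleOp ns na M => (queryOp j (O l) : QOp (Wire ns na _ K))) :=
  Impl.cquery l (queryEmb j)

variable {P : Fin (Nat.clog 2 M) → Matrix Bool Bool ℂ}

/-- With b = `Nat.clog 2 M`, the summands are 12(na + b + 1) + 1 for the flag, 30(b + 1) + 5 for the
comparison, b for each of preparation and unpreparation, 3b for the swap, and 2 for the rotations.
-/
theorem impl_levelOp (hP : ∀ i, P i ∈ unitaryGroup Bool ℂ)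
    {G : Fin (Nat.clog 2 M) → Matrix Bool Bool ℂ} (hG : ∀ i, G i ∈ unitaryGroup Bool ℂ)
    (v : Bool) {p : ℝ} (hp0 : 0 ≤ p) (hp1 : p ≤ 1) (j : Fin K) (l : Fin L) {q g : ℕ}
    {R : (Fin L → OracleOp ns na M) → QOp (Wire ns na (Nat.clog 2 M) K)} (hR : Impl q g R) :
    Impl (q + 1) (g + (12 * na + 47 * Nat.clog 2 M + 50))
      (fun O => levelOp P G v p j (O l) (R O)) := by
  have hflag : Impl _ _ (fun _ : Fin L → OracleOp ns na M =>
      (flagOp j : QOp (Wire ns na (Nat.clog 2 M) K))) := gateImpl_flagOp j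
  have hcmp : Impl _ _ (fun _ : Fin L → OracleOp ns na M =>
      (cmpOp j.succ v : QOp (Wire ns na (Nat.clog 2 M) K))) := gateImpl_cmpOp j.succ v
  have hold : Impl _ _ (fun _ : Fin L → OracleOp ns na M =>
      (onWires oldEmb (tens G) : QOp (Wire ns na (Nat.clog 2 M) K))ᴴ) :=
    (gateImpl_tens oldEmb hG).adjoint
  simp only [onWires_conjTranspose] at hold
  have hreg : Impl _ _ (fun _ : Fin L → OracleOp ns na M =>
      (onWires regEmb (tens P) : QOp (Wire ns na (Nat.clog 2 M) K))) :=
    gateImpl_tens regEmb hP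
  have hswap : Impl _ _ (fun _ : Fin L → OracleOp ns na M =>
      (swapReg : QOp (Wire ns na (Nat.clog 2 M) K))) := gateImpl_swapList _
  have hr1 : Impl _ _ (fun _ : Fin L → OracleOp ns na M =>
      (ctlRot j p (-1) : QOp (Wire ns na (Nat.clog 2 M) K))) := gateImpl_ctlRot j hp0 hp1 (by simp)
  have hr2 : Impl _ _ (fun _ : Fin L → OracleOp ns na M =>
      (ctlRot j p Complex.I : QOp (Wire ns na (Nat.clog 2 M) K))) :=
    gateImpl_ctlRot j hp0 hp1 (by simp)
  have h := ((hr2.mul hR).mul (((((hflag.mul (impl_queryOp j.succ l)).mul hold).mul hcmp).mul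
    hreg).mul hswap)).mul hr1
  refine h.mono (by omega) ?_
  simp
  omega

theorem impl_restOp (hP : ∀ i, P i ∈ unitaryGroup Bool ℂ) {p : ℝ} (hp0 : 0 ≤ p) (hp1 : p ≤ 1)
    (l : Fin L) (n : ℕ) (h : n ≤ K) :
    Impl n (n * (12 * na + 47 * Nat.clog 2 M + 50))
      (fun O : Fin L → OracleOp ns na M => restOp (K := K) P p (O l) n h) := by
  induction n with
  | zero => exact Impl.one.mono le_rfl (by omega)
  | succ n ih =>
    refine (impl_levelOp hP hP true hp0 hp1 ⟨K - (n + 1), by omega⟩ l (ih (by omega))).mono le_rfl ?_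
    rw [add_mul, one_mul]

theorem impl_encOp (hP : ∀ i, P i ∈ unitaryGroup Bool ℂ) (z : Label (Fin (Nat.clog 2 M)))
    {p : ℝ} (hp0 : 0 ≤ p) (hp1 : p ≤ 1) {θ : ℝ} (hθ0 : 0 ≤ θ) (hθ1 : θ ≤ 1) (l : Fin L) :
    Impl (K + 1) ((K + 1) * (12 * na + 47 * Nat.clog 2 M + 50) + 2 * Nat.clog 2 M + 3)
      (fun O : Fin L → OracleOp ns na M =>
        (encOp P z p θ (O l) : QOp (Wire ns na (Nat.clog 2 M) (K + 1)))) := by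
  have hload : ∀ i, loadGate z i ∈ unitaryGroup Bool ℂ := fun i =>
    cond_mem boolX_unitary (one_mem _) _
  have hstart : Impl _ _ (fun _ : Fin L → OracleOp ns na M =>
      (startOp : QOp (Wire ns na (Nat.clog 2 M) (K + 1)))) := gateImpl_const _ true
  have hun : Impl _ _ (fun _ : Fin L → OracleOp ns na M =>
      (onWires regEmb (tens P) : QOp (Wire ns na (Nat.clog 2 M) (K + 1)))ᴴ) :=
    (gateImpl_tens regEmb hP).adjoint
  simp only [onWires_conjTranspose] at hun
  have hreg : Impl _ _ (fun _ : Fin L → OracleOp ns na M =>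
      (onWires regEmb (tens (loadGate z)) : QOp (Wire ns na (Nat.clog 2 M) (K + 1)))) :=
    gateImpl_tens regEmb hload
  have hpad : Impl _ _ (fun _ : Fin L → OracleOp ns na M =>
      (fiberOp pad (fun _ => rotMat θ 1) : QOp (Wire ns na (Nat.clog 2 M) (K + 1)))) :=
    gateImpl_single pad (rotMat_unitary hθ0 hθ1 (by simp))
  have h := ((((hstart.mul hun).mul (impl_levelOp hP hload false hp0 hp1 0 l
    (impl_restOp hP hp0 hp1 l K (Nat.le_succ K)))).mul hstart).mul hreg).mul hpad
  refine h.mono (by omega) ?_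
  rw [add_mul]
  omega

end Costs
end DysonSim

namespace DysonSim
open Matrix Wire

/-! ### Reflections and one round of amplitude amplification. -/

section Reflection

variable {ns na b K : ℕ}

/-- The diagonal matrix with entries `-1` and `1`. -/
def signMat : Matrix Bool Bool ℂ := Matrix.diagonal fun c => cond c 1 (-1)

theorem signMat_unitary : signMat ∈ unitaryGroup Bool ℂ := by
  rw [mem_unitaryGroup_iff, star_eq_conjTranspose, signMat, Matrix.diagonal_conjTranspose,
    Matrix.diagonal_mul_diagonal, ← Matrix.diagonal_one]
  congr 1
  funext c
  cases c <;> simp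

/-- The reflection about the states in which all qubits outside of the system are `0`, up to the
sign `ε`. -/
noncomputable def reflOp (ε : Bool) : QOp (Wire ns na b K) :=
  fiberOp pad (fun y => (fun c => cond ε 1 (-1 : ℂ) • cond c 1 signMat)
    (orCond scratch (work.erase pad) y))

theorem card_work_erase_le : (work.erase pad : Finset (Wire ns na b K)).card ≤
    na + 2 * b + 2 * K + 2 := by
  rw [Finset.card_erase_of_mem (by simp [mem_work, isWork])]
  have := card_work_le (ns := ns) (na := na) (b := b) (K := K)
  omega

theorem gateImpl_reflOp {M L : ℕ} (ε : Bool) :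
    GateImpl ns na M L (12 * (na + 2 * b + 2 * K + 2) + 1) (reflOp ε : QOp (Wire ns na b K)) := by
  have h := card_work_erase_le (ns := ns) (na := na) (b := b) (K := K)
  refine GateImpl.mono (gateImpl_orCond (G := fun c => cond ε 1 (-1 : ℂ) • cond c 1 signMat)
    (scratch_injOn (h.trans (by omega)))
    (by simp [scratch, mem_work, isWork]) (by simp) (by simp [scratch])
    fun c => ?_) (by omega)
  have hc : (cond c 1 signMat : Matrix Bool Bool ℂ) ∈ unitaryGroup Bool ℂ :=
    cond_mem (one_mem _) signMat_unitary c
  cases ε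
  · rw [mem_unitaryGroup_iff] at hc ⊢
    simpa using hc
  · simpa using hc

/-- Rows that are supported on labels with clean scratch qubits. -/
def Clean {ι : Type} (ρ : Matrix ι (Label (Wire ns na b K)) ℂ) : Prop :=
  ∀ i x, ρ i x ≠ 0 → ∀ k, x (scr k) = false

variable {ι : Type} {ρ ρ' : Matrix ι (Label (Wire ns na b K)) ℂ}

theorem Clean.mul {A : QOp (Wire ns na b K)} (hρ : Clean ρ) (hA : ∀ k, Fixes A (scr k)) :
    Clean (ρ * A) := fun i x h k => by
  rw [Matrix.mul_apply] at h
  obtain ⟨y, _, hy⟩ := Finset.exists_ne_zero_of_sum_ne_zero h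
  exact (hA k y x (right_ne_zero_of_mul hy)).symm.trans (hρ i y (left_ne_zero_of_mul hy) k)

theorem Clean.sub (hρ : Clean ρ) (hρ' : Clean ρ') : Clean (ρ - ρ') := fun i x h k => by
  by_cases h0 : ρ i x = 0
  · exact hρ' i x (fun h1 => h (by rw [Matrix.sub_apply, h0, h1, sub_zero])) k
  · exact hρ i x h0 k

/-- The embedding of the system. -/
def embRow : Matrix (Label (Fin ns)) (Label (Wire ns na b K)) ℂ :=
  fun y x => if x = embLabel y then 1 else 0

theorem embLabel_injective :
    Function.Injective (embLabel : Label (Fin ns) → Label (Wire ns na b K)) := fun _ _ h =>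
  funext fun i => congrFun h (sys i)

theorem mul_embRow_apply (A : Matrix ι (Label (Fin ns)) ℂ) (i : ι)
    (x : Label (Wire ns na b K)) :
    (A * (embRow : Matrix (Label (Fin ns)) (Label (Wire ns na b K)) ℂ)) i x =
      if x = embLabel (fun k => x (sys k)) then A i (fun k => x (sys k)) else 0 := by
  rw [Matrix.mul_apply]
  split_ifs with h
  · rw [Finset.sum_eq_single fun k => x (sys k)]
    · rw [embRow, if_pos h, mul_one]
    · intro y _ hy
      rw [embRow, if_neg, mul_zero]
      rintro rfl
      exact hy rfl
    · simp
  · refine Finset.sum_eq_zero fun y _ => ?_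
    rw [embRow, if_neg, mul_zero]
    rintro rfl
    exact h rfl

theorem mul_embRow_conjTranspose_apply (i : ι) (y : Label (Fin ns)) :
    (ρ * (embRow : Matrix (Label (Fin ns)) (Label (Wire ns na b K)) ℂ)ᴴ) i y = ρ i (embLabel y) := by
  rw [Matrix.mul_apply, Finset.sum_eq_single (embLabel y)]
  · simp [embRow, Matrix.conjTranspose_apply]
  · intro x _ hx
    simp [embRow, Matrix.conjTranspose_apply, hx]
  · simp

theorem embRow_mul_apply (A : QOp (Wire ns na b K)) (y : Label (Fin ns))
    (x : Label (Wire ns na b K)) :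
    ((embRow : Matrix (Label (Fin ns)) (Label (Wire ns na b K)) ℂ) * A) y x = A (embLabel y) x := by
  rw [Matrix.mul_apply, Finset.sum_eq_single (embLabel y)]
  · simp [embRow]
  · intro z _ hz
    simp [embRow, hz]
  · simp

theorem clean_embRow : Clean (embRow : Matrix (Label (Fin ns)) (Label (Wire ns na b K)) ℂ) := by
  intro y x h k
  unfold embRow at h
  rw [ite_ne_right_iff] at h
  rw [h.1]
  rfl

theorem clean_mul_embRow (A : Matrix ι (Label (Fin ns)) ℂ) :
    Clean (A * (embRow : Matrix (Label (Fin ns)) (Label (Wire ns na b K)) ℂ)) := by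
  intro i x h k
  rw [Matrix.mul_apply] at h
  obtain ⟨y, _, hy⟩ := Finset.exists_ne_zero_of_sum_ne_zero h
  exact clean_embRow y x (right_ne_zero_of_mul hy) k

/-- The scratch qubits that compute the reflection are not part of what it tests. It therefore is
the reflection about the embedded system only on rows supported on clean scratch. -/
theorem mul_reflOp (hρ : Clean ρ) (ε : Bool) :
    ρ * (reflOp ε : QOp (Wire ns na b K)) = cond ε 1 (-1 : ℂ) • (ρ - (2 : ℂ) •
      (ρ * (embRow : Matrix (Label (Fin ns)) (Label (Wire ns na b K)) ℂ)ᴴ *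
        (embRow : Matrix (Label (Fin ns)) (Label (Wire ns na b K)) ℂ))) := by
  ext i x
  rw [reflOp, mul_fiberOp_apply, Finset.sum_eq_single (x pad), Function.update_eq_self,
    Matrix.smul_apply, Matrix.sub_apply, Matrix.smul_apply, mul_embRow_apply (ρ * embRowᴴ) i x,
    mul_embRow_conjTranspose_apply]
  · by_cases h0 : ρ i x = 0
    · rw [h0]
      split_ifs with h
      · rw [← h, h0]
        simp
      · simp
    · have hx := hρ i x h0
      rw [orCond_eq (scratch_injOn (card_work_erase_le.trans (by omega)))
        (by simp [scratch, mem_work, isWork]) fun _ _ => hx _]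
      by_cases hw : ∃ v ∈ (work.erase pad : Finset (Wire ns na b K)), x v = true
      · rw [decide_eq_true hw, if_neg]
        · simp [mul_comm]
        · intro h
          obtain ⟨v, hv, hxv⟩ := hw
          have hv' := congrFun h v
          rw [hxv] at hv'
          cases v with
          | sys k => simp [mem_work, isWork] at hv
          | scr k => simp [mem_work, isWork] at hv
          | _ => exact Bool.noConfusion (show true = false from hv')
      · rw [decide_eq_false hw]
        push Not at hw
        by_cases hp : x pad = true
        · rw [if_neg]
          · simp [hp, signMat, mul_comm]
          · intro h
            rw [h] at hp
            exact absurd hp (by simp [embLabel, mkLabel])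
        · have hx' : x = embLabel (fun k => x (sys k)) := by
            funext v
            cases v with
            | sys k => rfl
            | scr k => exact hx k
            | pad => exact Bool.eq_false_iff.2 hp
            | _ => exact Bool.eq_false_iff.2 (hw _ (by simp [mem_work, isWork]))
          rw [if_pos hx', ← hx']
          simp only [Bool.not_eq_true] at hp
          simp [hp, signMat]
          ring
  · intro d _ hd
    have : (cond ε 1 (-1 : ℂ) • (cond (orCond scratch (work.erase pad) x) 1 signMat :
        Matrix Bool Bool ℂ)) d (x pad) = 0 := by
      cases orCond scratch (work.erase pad) x
      · simp [signMat, Matrix.diagonal_apply_ne _ hd]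
      · simp [Matrix.one_apply_ne hd]
    exact mul_eq_zero_of_right _ this
  · simp

/-- One round of amplitude amplification for `Vᴴ`. -/
noncomputable def ampOp (V : QOp (Wire ns na b K)) : QOp (Wire ns na b K) :=
  Vᴴ * (reflOp true : QOp (Wire ns na b K)) * V * (reflOp false : QOp (Wire ns na b K)) * Vᴴ

/-- Let J be the embedding row matrix and A = J V Jᴴ. Each reflection is ±(1 - 2JᴴJ), so expanding
Vᴴ(1 - 2JᴴJ)V·(-(1 - 2JᴴJ))Vᴴ between J and Jᴴ leaves only A and Aᴴ. The polynomial 3a - 4a³ sends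
1/2 to 1, hence the rescaling of blocks to norm 1/2. Starting from Vᴴ turns the backward evolution
in V into a forward one. -/
theorem ampOp_apply {V : QOp (Wire ns na b K)} (hV : V ∈ unitaryGroup _ ℂ)
    (hf : ∀ k, Fixes V (scr k)) {A : QOp (Fin ns)}
    (hA : ∀ y s, V (embLabel y) (embLabel s) = A y s) (y s : Label (Fin ns)) :
    ampOp V (embLabel y) (embLabel s) = ((3 : ℂ) • Aᴴ - (4 : ℂ) • (Aᴴ * A * Aᴴ)) y s := by
  set J : Matrix (Label (Fin ns)) (Label (Wire ns na b K)) ℂ := embRow with hJ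
  have hVV : Vᴴ * V = 1 := mem_unitaryGroup_iff'.1 hV
  have hA1 : J * V * Jᴴ = A := by
    ext y s
    rw [hJ, mul_embRow_conjTranspose_apply, embRow_mul_apply, hA]
  have hA2 : J * Vᴴ * Jᴴ = Aᴴ := by
    rw [← hA1, Matrix.conjTranspose_mul, Matrix.conjTranspose_mul,
      Matrix.conjTranspose_conjTranspose, Matrix.mul_assoc]
  have hf' : ∀ k, Fixes Vᴴ (scr k) := fun k => (hf k).conjTranspose
  have hJJ : J * Jᴴ = 1 := by
    ext y s
    rw [hJ, mul_embRow_conjTranspose_apply, embRow, Matrix.one_apply]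
    simp only [embLabel_injective.eq_iff, eq_comm]
  have h1 : J * Vᴴ * (reflOp true : QOp (Wire ns na b K)) = J * Vᴴ - (2 : ℂ) • (Aᴴ * J) := by
    rw [mul_reflOp (clean_embRow.mul hf'), ← hJ, hA2, cond_true, one_smul]
  have h2 : J * Vᴴ * (reflOp true : QOp (Wire ns na b K)) * V = J - (2 : ℂ) • (Aᴴ * J * V) := by
    rw [h1, Matrix.sub_mul, Matrix.mul_assoc J, hVV, Matrix.mul_one, Matrix.smul_mul]
  have hc : Clean (J - (2 : ℂ) • (Aᴴ * J * V)) := by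
    rw [← Matrix.smul_mul, ← Matrix.smul_mul]
    exact clean_embRow.sub ((clean_mul_embRow _).mul hf)
  have h3 : (J - (2 : ℂ) • (Aᴴ * J * V)) * Jᴴ = 1 - (2 : ℂ) • (Aᴴ * A) := by
    rw [Matrix.sub_mul, hJJ, Matrix.smul_mul, Matrix.mul_assoc, Matrix.mul_assoc Aᴴ,
      ← Matrix.mul_assoc J, hA1]
  have h4 : J * ampOp V * Jᴴ = (3 : ℂ) • Aᴴ - (4 : ℂ) • (Aᴴ * A * Aᴴ) := by
    have : J * ampOp V = J * Vᴴ * (reflOp true : QOp (Wire ns na b K)) * V *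
        (reflOp false : QOp (Wire ns na b K)) * Vᴴ := by
      simp only [ampOp, Matrix.mul_assoc]
    rw [this, h2, mul_reflOp hc, ← hJ, h3]
    simp only [cond_false, neg_smul, one_smul, Matrix.sub_mul, Matrix.neg_mul, Matrix.smul_mul,
      Matrix.one_mul, Matrix.mul_assoc, smul_sub]
    have hA2' : J * (Vᴴ * Jᴴ) = Aᴴ := by rw [← Matrix.mul_assoc, hA2]
    have hV' : V * (Vᴴ * Jᴴ) = Jᴴ := by
      rw [← Matrix.mul_assoc, ← star_eq_conjTranspose V, mem_unitaryGroup_iff.1 hV, Matrix.one_mul]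
    rw [hV', hA2', hJJ, Matrix.mul_one]
    module
  rw [← h4, hJ, mul_embRow_conjTranspose_apply, embRow_mul_apply]

end Reflection
end DysonSim

namespace DysonSim
open Matrix Wire

/-! ### Uniform superpositions over half of the binary indices. -/

section Prepare

theorem sum_binVal {α : Type*} [AddCommMonoid α] {b : ℕ} (f : ℕ → α) :
    ∑ r : Label (Fin b), f (binVal r) = ∑ j ∈ Finset.range (2 ^ b), f j := by
  refine Finset.sum_bij (fun r _ => binVal r) (fun r _ => Finset.mem_range.2 (binVal_lt r))
    (fun r _ r' _ h => binVal_injective h) (fun j hj => ?_) (fun _ _ => rfl)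
  obtain ⟨z, hz⟩ := exists_binVal_eq (Finset.mem_range.1 hj)
  exact ⟨z, Finset.mem_univ _, hz⟩

/-- One-qubit gates that prepare the uniform superposition of the indices with top bit `c`. -/
noncomputable def prepGate (b : ℕ) (c : Bool) (i : Fin b) : Matrix Bool Bool ℂ :=
  if (i : ℕ) + 1 = b then cond c boolX 1 else rotMat (1 / 2) 1

theorem prepGate_unitary (b : ℕ) (c : Bool) (i : Fin b) :
    prepGate b c i ∈ unitaryGroup Bool ℂ := by
  unfold prepGate
  split_ifs
  · exact cond_mem boolX_unitary (one_mem _) c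
  · exact rotMat_unitary (by norm_num) (by norm_num) (by simp)

/-- The first index of a piece. -/
def pieceLo (b : ℕ) (c : Bool) : ℕ := cond c (2 ^ (b - 1)) 0

/-- Each lower qubit has weight 1/2 on both values and the top qubit is set to c. For b = 0 there is
no top qubit; only the lower piece makes sense, and it consists of the single index 0. -/
theorem prepAmp_prepGate {b : ℕ} {c : Bool} (hb : c = true → b ≠ 0) (r : Label (Fin b)) :
    prepAmp (prepGate b c) r * star (prepAmp (prepGate b c) r) =
      if pieceLo b c ≤ binVal r ∧ binVal r < pieceLo b c + 2 ^ (b - 1) then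
        ((2 : ℂ) ^ (b - 1))⁻¹ else 0 := by
  obtain _ | n := b
  · have hc : c = false := by
      cases c
      · rfl
      · exact absurd rfl (hb rfl)
    subst hc
    simp [prepAmp, tens, pieceLo, binVal]
  · have h1 : prepAmp (prepGate (n + 1) c) r * star (prepAmp (prepGate (n + 1) c) r) =
        if r (Fin.last n) = c then ((2 : ℂ) ^ n)⁻¹ else 0 := by
      have hh : ∀ d : Bool, rotMat (1 / 2) 1 d false * star (rotMat (1 / 2) 1 d false) = 2⁻¹ := by
        have hs : ((√(2⁻¹) : ℝ) : ℂ) * (√(2⁻¹) : ℝ) = 2⁻¹ := by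
          rw [← Complex.ofReal_mul, Real.mul_self_sqrt (by norm_num)]
          push_cast
          rfl
        intro d
        cases d
        · simp only [rotMat, if_true, show (1 : ℝ) - 1 / 2 = 2⁻¹ by norm_num]
          simpa using hs
        · simp only [rotMat, show (1 : ℝ) / 2 = 2⁻¹ by norm_num]
          simpa using hs
      have hl : ∀ d : Bool, (cond c boolX 1 : Matrix Bool Bool ℂ) d false *
          star ((cond c boolX 1 : Matrix Bool Bool ℂ) d false) = if d = c then 1 else 0 := by
        intro d
        cases c <;> cases d <;> simp [boolX]
      unfold prepAmp tens
      rw [star_prod, ← Finset.prod_mul_distrib, Fin.prod_univ_castSucc]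
      have h2 : ∀ i : Fin n, prepGate (n + 1) c i.castSucc = rotMat (1 / 2) 1 := fun i => by
        rw [prepGate, if_neg]
        simp
        omega
      have h3 : prepGate (n + 1) c (Fin.last n) = cond c boolX 1 := by
        rw [prepGate, if_pos]
        simp
      simp only [h2, h3, zeroLabel, hh, hl, Finset.prod_const, Finset.card_univ, Fintype.card_fin]
      split_ifs <;> simp
    rw [h1, Nat.add_sub_cancel, binVal_castSucc]
    have hlt := binVal_lt fun i : Fin n => r i.castSucc
    congr 1
    rw [eq_iff_iff, pieceLo, Nat.add_sub_cancel]
    cases c <;> cases hr : r (Fin.last n) <;> simp <;> omega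

theorem pieceLo_add_le {b : ℕ} {c : Bool} (hb : c = true → b ≠ 0) :
    pieceLo b c + 2 ^ (b - 1) ≤ 2 ^ b := by
  obtain _ | n := b
  · cases c
    · simp [pieceLo]
    · exact absurd rfl (hb rfl)
  · rw [pieceLo, Nat.add_sub_cancel, pow_succ]
    cases c <;> simp
    omega

theorem sum_prepAmp_prepGate {b : ℕ} {c : Bool} (hb : c = true → b ≠ 0) :
    ∑ r, prepAmp (prepGate b c) r * star (prepAmp (prepGate b c) r) = 1 := by
  simp only [prepAmp_prepGate hb]
  rw [sum_binVal fun j => if pieceLo b c ≤ j ∧ j < pieceLo b c + 2 ^ (b - 1) then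
    ((2 : ℂ) ^ (b - 1))⁻¹ else 0, ← Finset.sum_filter]
  have : (Finset.range (2 ^ b)).filter (fun j => pieceLo b c ≤ j ∧ j < pieceLo b c + 2 ^ (b - 1)) =
      Finset.Ico (pieceLo b c) (pieceLo b c + 2 ^ (b - 1)) := by
    have := pieceLo_add_le hb
    ext j
    simp only [Finset.mem_filter, Finset.mem_range, Finset.mem_Ico]
    omega
  rw [this, Finset.sum_const, Nat.card_Ico, Nat.add_sub_cancel_left, nsmul_eq_mul]
  push_cast
  exact mul_inv_cancel₀ (pow_ne_zero _ two_ne_zero)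

/-- The truncated discrete evolution from the index `lo` on, in Horner form. -/
noncomputable def discWalk {ns : ℕ} (B : ℕ → QOp (Fin ns)) (p : ℝ) (N lo : ℕ) :
    ℕ → ℕ → QOp (Fin ns)
  | 0, _ => 1
  | n + 1, m => ((1 - p : ℝ) : ℂ) • (1 : QOp (Fin ns)) +
      (Complex.I * (p / N : ℝ)) • ∑ j ∈ Finset.Ico lo (min m (lo + N)), discWalk B p N lo n j * B j

/-- The weights are 1/N on the N indices of the piece, so the walk sum is a plain sum over the part
of the piece below m. Indices of the upper piece beyond M are cut off by the comparison alone. -/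
theorem walk_prepGate {ns b : ℕ} {c : Bool} (hb : c = true → b ≠ 0) (B : ℕ → QOp (Fin ns)) (p : ℝ)
    (n : ℕ) {m : ℕ} (hm : m ≤ 2 ^ b) :
    walk (prepGate b c) B p n m = discWalk B p (2 ^ (b - 1)) (pieceLo b c) n m := by
  induction n generalizing m with
  | zero => rfl
  | succ n ih =>
    rw [walk, discWalk, walkSum]
    congr 1
    have h1 : ∀ r : Label (Fin b), (if binVal r + 1 ≤ m then
        (prepAmp (prepGate b c) r * star (prepAmp (prepGate b c) r)) •
          (walk (prepGate b c) B p n (binVal r) * B (binVal r)) else 0) =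
        (fun j => if j ∈ Finset.Ico (pieceLo b c) (min m (pieceLo b c + 2 ^ (b - 1))) then
          ((2 : ℂ) ^ (b - 1))⁻¹ •
            (discWalk B p (2 ^ (b - 1)) (pieceLo b c) n j * B j) else 0) (binVal r) := by
      intro r
      rw [ih (binVal_lt r).le, prepAmp_prepGate hb]
      simp only [Finset.mem_Ico, lt_min_iff]
      by_cases h1 : binVal r + 1 ≤ m
      · rw [if_pos h1]
        by_cases h2 : pieceLo b c ≤ binVal r ∧ binVal r < pieceLo b c + 2 ^ (b - 1)
        · rw [if_pos h2, if_pos ⟨h2.1, h1, h2.2⟩]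
        · rw [if_neg h2, if_neg fun h => h2 ⟨h.1, h.2.2⟩, zero_smul]
      · rw [if_neg h1, if_neg fun h => h1 h.2.1]
    rw [Finset.sum_congr rfl fun r _ => h1 r, sum_binVal fun j =>
        if j ∈ Finset.Ico (pieceLo b c) (min m (pieceLo b c + 2 ^ (b - 1))) then
          ((2 : ℂ) ^ (b - 1))⁻¹ • (discWalk B p (2 ^ (b - 1)) (pieceLo b c) n j * B j) else 0,
      Finset.sum_ite_mem,
      Finset.inter_eq_right.2, ← Finset.smul_sum, smul_smul]
    · congr 1
      push_cast
      ring
    · intro j hj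
      rw [Finset.mem_Ico] at hj
      rw [Finset.mem_range]
      omega

end Prepare

/-! ### The amplified circuit of a piece. -/

section Piece

variable {ns na M K L : ℕ}

/-- The last index, in binary. -/
noncomputable def lastIndex (M : ℕ) (hM : 1 ≤ M) : Label (Fin (Nat.clog 2 M)) :=
  (exists_binVal_eq (b := Nat.clog 2 M) (m := M - 1)
    (lt_of_lt_of_le (by omega) (Nat.le_pow_clog one_lt_two M))).choose

theorem binVal_lastIndex (hM : 1 ≤ M) : binVal (lastIndex M hM) + 1 = M := by
  have := (exists_binVal_eq (b := Nat.clog 2 M) (m := M - 1)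
    (lt_of_lt_of_le (by omega) (Nat.le_pow_clog one_lt_two M))).choose_spec
  unfold lastIndex
  omega

/-- The circuit of a piece. -/
noncomputable def pieceOp (K : ℕ) (hM : 1 ≤ M) (c : Bool) (p θ : ℝ) (U : OracleOp ns na M) :
    QOp (Wire ns na (Nat.clog 2 M) (K + 1)) :=
  ampOp (encOp (prepGate (Nat.clog 2 M) c) (lastIndex M hM) p θ U)

theorem impl_pieceOp (hM : 1 ≤ M) (c : Bool) {p : ℝ} (hp0 : 0 ≤ p) (hp1 : p ≤ 1) {θ : ℝ}
    (hθ0 : 0 ≤ θ) (hθ1 : θ ≤ 1) (l : Fin L) :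
    Impl (3 * (K + 1)) ((K + 1) * (60 * na + 207 * Nat.clog 2 M + 300))
      (fun O : Fin L → OracleOp ns na M => pieceOp K hM c p θ (O l)) := by
  have hV := impl_encOp (K := K) (prepGate_unitary (Nat.clog 2 M) c) (lastIndex M hM) hp0 hp1 hθ0
    hθ1 l (ns := ns) (na := na)
  have hR : ∀ ε : Bool, Impl _ _ (fun _ : Fin L → OracleOp ns na M =>
      (reflOp ε : QOp (Wire ns na (Nat.clog 2 M) (K + 1)))) := fun ε => gateImpl_reflOp ε
  have h := (((hV.adjoint.mul (hR true)).mul hV).mul (hR false)).mul hV.adjoint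
  refine h.mono (by omega) ?_
  ring_nf
  nlinarith [Nat.zero_le (K * na), Nat.zero_le (K * Nat.clog 2 M), Nat.zero_le K,
    Nat.zero_le na, Nat.zero_le (Nat.clog 2 M)]

/-- The angle θ satisfies √(1 - θ)·(1 - p) = 1/2, which is possible because p ≤ 1/2. The encoded
block is then Y/2, and 3A - 4A³ becomes (3Y - Y³)/2 with the adjoints in place. -/
theorem pieceOp_apply {U : OracleOp ns na M} (hUu : U ∈ unitaryGroup _ ℂ) {B : ℕ → QOp (Fin ns)}
    (hU : ∀ (m m' : Fin M) (x y : Label (Fin ns)),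
      U (m, zeroLabel _, x) (m', zeroLabel _, y) = if m = m' then B m x y else 0)
    (hM : 1 ≤ M) {c : Bool} (hc : c = true → M ≠ 1) {p : ℝ} (hp0 : 0 ≤ p) (hp1 : p ≤ 1 / 2)
    {Y : QOp (Fin ns)} (hY : discWalk B p (2 ^ (Nat.clog 2 M - 1)) (pieceLo (Nat.clog 2 M) c)
      (K + 1) M = ((1 - p : ℝ) : ℂ) • Y) (y s : Label (Fin ns)) :
    pieceOp K hM c p (1 - (1 / (2 * (1 - p))) ^ 2) U (embLabel y) (embLabel s) =
      ((2 : ℂ)⁻¹ • ((3 : ℂ) • Yᴴ - Yᴴ * Y * Yᴴ)) y s := by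
  have hb : c = true → Nat.clog 2 M ≠ 0 := fun h => by
    have := hc h
    exact (Nat.clog_pos one_lt_two (by omega)).ne'
  have h1 : (0 : ℝ) < 1 / (2 * (1 - p)) := by
    have : 0 < 1 - p := by linarith
    positivity
  have h2 : 1 / (2 * (1 - p)) ≤ 1 := by
    rw [div_le_one (by linarith)]
    linarith
  have hV : encOp (K := K) (prepGate (Nat.clog 2 M) c) (lastIndex M hM) p
      (1 - (1 / (2 * (1 - p))) ^ 2) U ∈ unitaryGroup _ ℂ := by
    obtain ⟨_, _, _, _, h⟩ := impl_encOp (K := K) (L := 1) (prepGate_unitary (Nat.clog 2 M) c)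
      (lastIndex M hM) hp0 (by linarith : p ≤ 1) (θ := 1 - (1 / (2 * (1 - p))) ^ 2) (by nlinarith)
      (by nlinarith) 0 (ns := ns) (na := na)
    exact h (fun _ => U) fun _ => hUu
  have hA : ∀ y s : Label (Fin ns), encOp (K := K) (prepGate (Nat.clog 2 M) c) (lastIndex M hM) p
      (1 - (1 / (2 * (1 - p))) ^ 2) U (embLabel y) (embLabel s) = ((2 : ℂ)⁻¹ • Y) y s := by
    intro y s
    rw [encOp_apply hU (sum_prepAmp_prepGate hb) (binVal_lastIndex hM) hp0 (by linarith),
      walk_prepGate hb _ _ _ (Nat.le_pow_clog one_lt_two M), hY, sub_sub_cancel,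
      Real.sqrt_sq h1.le, Matrix.smul_apply, Matrix.smul_apply, smul_eq_mul, smul_eq_mul,
      ← mul_assoc]
    congr 1
    have : (1 : ℝ) - p ≠ 0 := by linarith
    rw [← Complex.ofReal_mul]
    have h3 : 1 / (2 * (1 - p)) * (1 - p) = 2⁻¹ := by field_simp
    rw [h3]
    push_cast
    rfl
  rw [pieceOp, ampOp_apply hV (fun k => fixes_encOp _ _ _ _ _ k) hA]
  simp only [Matrix.conjTranspose_smul, Matrix.smul_mul, Matrix.mul_smul, smul_sub, smul_smul]
  simp
  ring

end Piece
end DysonSim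

namespace DysonSim
open Matrix Wire

/-! ### From typed wires to circuits, and intermediate measurements. -/

section Relabel

variable {ns na M L : ℕ} {w w' : Type} [Fintype w] [DecidableEq w] [Fintype w'] [DecidableEq w']

/-- An instruction on renamed wires. -/
def Instr.map (f : w ≃ w') : Instr ns na M L w → Instr ns na M L w'
  | gate k hk e U => gate k hk (e.trans f.toEmbedding) U
  | query j inv e => query j inv (e.trans f.toEmbedding)
  | cquery j inv e => cquery j inv (e.trans f.toEmbedding)
  | check q => check (f q)

theorem onWires_map {k : Type} (f : w ≃ w') (e : k ↪ w) (A : QOp k) (x y : Label w') :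
    onWires (e.trans f.toEmbedding) A x y = onWires e A (x ∘ f) (y ∘ f) := by
  unfold onWires
  congr 1
  rw [eq_iff_iff]
  constructor
  · intro h i hi
    exact h (f i) fun ⟨j, hj⟩ => hi ⟨j, f.injective hj⟩
  · intro h i hi
    have := h (f.symm i) fun ⟨j, hj⟩ => hi ⟨j, by simp [hj]⟩
    simpa using this

theorem Instr.op_map (O : Fin L → OracleOp ns na M) (f : w ≃ w') (i : Instr ns na M L w)
    (x y : Label w') : (i.map f).op O x y = i.op O (x ∘ f) (y ∘ f) := by
  cases i with
  | check q =>
    simp only [Instr.map, Instr.op, projZero]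
    congr 1
    rw [eq_iff_iff, Function.comp_apply]
    refine and_congr_left fun _ => ⟨fun h => by rw [h], fun h => ?_⟩
    exact f.surjective.injective_comp_right h
  | _ => exact onWires_map _ _ _ _ _

theorem run_map (O : Fin L → OracleOp ns na M) (f : w ≃ w') (c : List (Instr ns na M L w))
    (x y : Label w') : run O (c.map (Instr.map f)) x y = run O c (x ∘ f) (y ∘ f) := by
  induction c generalizing x y with
  | nil =>
    rw [List.map_nil, run, run, Matrix.one_apply, Matrix.one_apply]
    congr 1
    rw [eq_iff_iff]
    exact ⟨fun h => by rw [h], fun h => f.surjective.injective_comp_right h⟩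
  | cons i c ih =>
    rw [List.map_cons, run, run, Matrix.mul_apply, Matrix.mul_apply]
    refine Fintype.sum_equiv (f.symm.arrowCongr (Equiv.refl _)) _ _ fun z => ?_
    rw [ih, Instr.op_map]
    rfl

end Relabel

section Checks

variable {ns na M L anc : ℕ} (O : Fin L → OracleOp ns na M)

theorem op_append (c d : Circuit ns na M L anc) :
    Circuit.op O (c ++ d) = Circuit.op O d * Circuit.op O c := by
  induction c with
  | nil => simp [Circuit.op]
  | cons i c ih => simp [Circuit.op, ih, Matrix.mul_assoc]

theorem op_eq_run (c : Circuit ns na M L anc) : Circuit.op O c = run O c := by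
  induction c with
  | nil => rfl
  | cons i c ih => rw [Circuit.op, run, ih]

/-- The measurement of all qubits outside of the system. -/
def checks (ns na M L anc : ℕ) : Circuit ns na M L anc :=
  (List.finRange anc).map fun i => Instr.check (Sum.inr i)

theorem op_check_list (l : List (Fin anc)) (x y : Label (Fin ns ⊕ Fin anc)) :
    Circuit.op O (l.map fun i => Instr.check (Sum.inr i) : Circuit ns na M L anc) x y =
      if x = y ∧ ∀ i ∈ l, x (Sum.inr i) = false then 1 else 0 := by
  induction l with
  | nil => simp [Circuit.op, Matrix.one_apply]
  | cons i l ih =>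
    rw [List.map_cons, Circuit.op, Matrix.mul_apply, Finset.sum_eq_single y]
    · rw [ih, Instr.op, projZero]
      by_cases h : x = y
      · subst h
        by_cases h2 : x (Sum.inr i) = false <;> simp [h2]
      · simp [h]
    · intro z _ hz
      simp [Instr.op, projZero, hz]
    · simp

/-- The measurements leave only intermediate labels with all other qubits in 0, so the sum over
intermediate labels collapses to a matrix product over system labels. -/
theorem implemented_append_checks (c d : Circuit ns na M L anc) :
    (c ++ (checks ns na M L anc ++ d)).implemented O = d.implemented O * c.implemented O := by
  ext x y
  rw [Circuit.implemented, op_append, op_append, Matrix.mul_apply, Matrix.mul_apply]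
  symm
  refine Fintype.sum_of_injective
    (fun z : Label (Fin ns) => (Sum.elim z (zeroLabel (Fin anc)) : Label (Fin ns ⊕ Fin anc))) ?_ _ _
    ?_ ?_
  · intro z z' h
    exact funext fun k => congrFun h (Sum.inl k)
  · intro z hz
    rw [Matrix.mul_apply, Finset.sum_eq_zero, zero_mul]
    intro z' _
    rw [checks, op_check_list, if_neg, mul_zero]
    rintro ⟨rfl, h⟩
    refine hz ⟨fun k => z' (Sum.inl k), funext fun k => ?_⟩
    rcases k with k | k
    · rfl
    · exact (h k (List.mem_finRange k)).symm
  · intro z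
    rw [Matrix.mul_apply, Finset.sum_eq_single (Sum.elim z (zeroLabel (Fin anc)))]
    · rw [checks, op_check_list, if_pos ⟨rfl, fun _ _ => rfl⟩, mul_one]
      rfl
    · intro z' _ hz'
      rw [checks, op_check_list, if_neg fun h => hz' h.1, mul_zero]
    · simp

theorem implemented_nil : Circuit.implemented O ([] : Circuit ns na M L anc) = 1 := by
  ext x y
  rw [Circuit.implemented, Circuit.op, Matrix.one_apply, Matrix.one_apply]
  congr 1
  rw [eq_iff_iff]
  exact ⟨fun h => funext fun k => congrFun h (Sum.inl k), fun h => by rw [h]⟩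

theorem queries_checks : (checks ns na M L anc).queries = 0 := by
  simp [checks, Circuit.queries, Function.comp_def, Instr.queries]

theorem gates_checks : (checks ns na M L anc).gates = anc := by
  simp [checks, Circuit.gates, Function.comp_def, Instr.gates]

end Checks

section Blocks

variable {ns na M K L : ℕ}

/-- The wires in the order in which circuits use them. -/
noncomputable def wireEquiv (ns na b K : ℕ) :
    Wire ns na b K ≃ Fin ns ⊕ Fin (2 * na + 4 * b + 4 * K + 13) :=
  equivSum.trans (Equiv.sumCongr (Equiv.refl _) (Fintype.equivFinOfCardEq (by
    simp
    omega)))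

theorem elim_comp_wireEquiv {b : ℕ} (x : Label (Fin ns)) :
    (Sum.elim x (zeroLabel _) : Label (Fin ns ⊕ Fin (2 * na + 4 * b + 4 * K + 13))) ∘
      wireEquiv ns na b K = embLabel x := by
  funext v
  cases v <;> rfl

theorem Impl.exists_circuit {b q g : ℕ} {F : (Fin L → OracleOp ns na M) → QOp (Wire ns na b K)}
    (h : Impl q g F) : ∃ c : Circuit ns na M L (2 * na + 4 * b + 4 * K + 13),
      c.queries ≤ q ∧ c.gates ≤ g ∧ ∀ O x y, c.implemented O x y = F O (embLabel x) (embLabel y) := by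
  obtain ⟨c, h1, h2, h3, -⟩ := h
  refine ⟨c.map (Instr.map (wireEquiv ns na b K)), ?_, ?_, fun O x y => ?_⟩
  · refine le_of_eq_of_le ?_ h1
    rw [Circuit.queries, List.map_map]
    congr 1
    refine List.map_congr_left fun i _ => ?_
    cases i <;> rfl
  · refine le_of_eq_of_le ?_ h2
    rw [Circuit.gates, List.map_map]
    congr 1
    refine List.map_congr_left fun i _ => ?_
    cases i <;> rfl
  · rw [Circuit.implemented, op_eq_run, run_map, elim_comp_wireEquiv, elim_comp_wireEquiv, h3]

theorem norm_le_one_of_unitary {n : Type} [Fintype n] [DecidableEq n] {A : Matrix n n ℂ}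
    (hA : A ∈ unitaryGroup n ℂ) : ‖A‖ ≤ 1 := by
  have h := Matrix.l2_opNorm_conjTranspose_mul_self A
  rw [← star_eq_conjTranspose, mem_unitaryGroup_iff'.1 hA] at h
  have h1 : ‖(1 : Matrix n n ℂ)‖ ≤ 1 := by
    have h2 := Matrix.l2_opNorm_conjTranspose_mul_self (1 : Matrix n n ℂ)
    rw [Matrix.conjTranspose_one, Matrix.one_mul] at h2
    nlinarith [norm_nonneg (1 : Matrix n n ℂ)]
  nlinarith [norm_nonneg A]

/-- Compressing by the isometry Jᴴ does not increase the norm. Contractivity is what lets the errors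
of successive pieces add without growing. -/
theorem norm_block_le {b : ℕ} {A : QOp (Wire ns na b K)} (hA : A ∈ unitaryGroup _ ℂ)
    {W : QOp (Fin ns)} (hW : ∀ x y, W x y = A (embLabel x) (embLabel y)) : ‖W‖ ≤ 1 := by
  set J : Matrix (Label (Fin ns)) (Label (Wire ns na b K)) ℂ := embRow with hJ
  have hJJ : J * Jᴴ = 1 := by
    ext y s
    rw [hJ, mul_embRow_conjTranspose_apply, embRow, Matrix.one_apply]
    simp only [embLabel_injective.eq_iff, eq_comm]
  have hJ' : ‖Jᴴ‖ ≤ 1 := by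
    have h := Matrix.l2_opNorm_conjTranspose_mul_self Jᴴ
    rw [Matrix.conjTranspose_conjTranspose, hJJ] at h
    have h1 := norm_le_one_of_unitary (one_mem (unitaryGroup (Label (Fin ns)) ℂ))
    nlinarith [norm_nonneg Jᴴ]
  have hJ1 : ‖J‖ ≤ 1 := by rwa [← Matrix.l2_opNorm_conjTranspose]
  have h : W = J * A * Jᴴ := by
    ext x y
    rw [hJ, mul_embRow_conjTranspose_apply, embRow_mul_apply, hW]
  rw [h]
  calc ‖J * A * Jᴴ‖ ≤ ‖J * A‖ * ‖Jᴴ‖ := Matrix.l2_opNorm_mul _ _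
    _ ≤ ‖J‖ * ‖A‖ * ‖Jᴴ‖ := by gcongr; exact Matrix.l2_opNorm_mul _ _
    _ ≤ 1 * 1 * 1 := by
      gcongr
      exact norm_le_one_of_unitary hA
    _ = 1 := by norm_num

end Blocks

/-! ### The amplified block of a nearly unitary operator. -/

section Amplification

variable {n : Type} [Fintype n] [DecidableEq n]

/-- On a unitary, (3Yᴴ - YᴴYYᴴ)/2 equals Yᴴ. With Y = E + Δ, the difference is half of two linear,
three quadratic and one cubic terms in Δ, each of norm at most δ once δ ≤ 1. -/
theorem norm_amplified_sub_le {Y E : Matrix n n ℂ} (hE : E ∈ unitaryGroup n ℂ) {δ : ℝ}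
    (hδ : ‖Y - E‖ ≤ δ) (hn : ‖(2 : ℂ)⁻¹ • ((3 : ℂ) • Yᴴ - Yᴴ * Y * Yᴴ)‖ ≤ 1) :
    ‖(2 : ℂ)⁻¹ • ((3 : ℂ) • Yᴴ - Yᴴ * Y * Yᴴ) - Eᴴ‖ ≤ 3 * δ := by
  have hE1 := norm_le_one_of_unitary hE
  have hE2 : ‖Eᴴ‖ ≤ 1 := by rwa [Matrix.l2_opNorm_conjTranspose]
  have hδ0 : 0 ≤ δ := (norm_nonneg _).trans hδ
  -- For δ ≥ 1 two contractions differ by at most 2 ≤ 3δ, so no smallness of δ has to be assumed.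
  rcases le_total 1 δ with h1 | h1
  · calc _ ≤ _ := norm_sub_le _ _
      _ ≤ 1 + 1 := add_le_add hn hE2
      _ ≤ 3 * δ := by linarith
  · set Δ := Y - E with hΔ
    have hΔ' : ‖Δᴴ‖ ≤ δ := by rwa [Matrix.l2_opNorm_conjTranspose]
    have hY : Y = E + Δ := by rw [hΔ]; abel
    have hEE : Eᴴ * E = 1 := mem_unitaryGroup_iff'.1 hE
    have hEE' : E * Eᴴ = 1 := mem_unitaryGroup_iff.1 hE
    have hm : ∀ {A B : Matrix n n ℂ} {a b : ℝ}, ‖A‖ ≤ a → ‖B‖ ≤ b → ‖A * B‖ ≤ a * b := by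
      intro A B a b hA hB
      exact (Matrix.l2_opNorm_mul _ _).trans
        (mul_le_mul hA hB (norm_nonneg _) ((norm_nonneg _).trans hA))
    have key : (2 : ℂ)⁻¹ • ((3 : ℂ) • Yᴴ - Yᴴ * Y * Yᴴ) - Eᴴ =
        (2 : ℂ)⁻¹ • ((Δᴴ - Eᴴ * Δ * Eᴴ) - (Δᴴ * Δ * Eᴴ + Δᴴ * E * Δᴴ + Eᴴ * Δ * Δᴴ) -
          Δᴴ * Δ * Δᴴ) := by
      have e1 : Yᴴ * Y * Yᴴ = Eᴴ + Δᴴ + Δᴴ + Eᴴ * Δ * Eᴴ +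
          (Δᴴ * Δ * Eᴴ + Δᴴ * E * Δᴴ + Eᴴ * Δ * Δᴴ) + Δᴴ * Δ * Δᴴ := by
        rw [hY, Matrix.conjTranspose_add]
        simp only [Matrix.add_mul, Matrix.mul_add, hEE, Matrix.one_mul]
        rw [Matrix.mul_assoc Δᴴ E Eᴴ, hEE', Matrix.mul_one]
        abel
      rw [e1, hY, Matrix.conjTranspose_add]
      module
    have t1 : ‖Eᴴ * Δ * Eᴴ‖ ≤ 1 * δ * 1 := hm (hm hE2 hδ) hE2
    have t2 : ‖Δᴴ * Δ * Eᴴ‖ ≤ δ * δ * 1 := hm (hm hΔ' hδ) hE2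
    have t3 : ‖Δᴴ * E * Δᴴ‖ ≤ δ * 1 * δ := hm (hm hΔ' hE1) hΔ'
    have t4 : ‖Eᴴ * Δ * Δᴴ‖ ≤ 1 * δ * δ := hm (hm hE2 hδ) hΔ'
    have t5 : ‖Δᴴ * Δ * Δᴴ‖ ≤ δ * δ * δ := hm (hm hΔ' hδ) hΔ'
    have hδ2 : δ * δ ≤ δ := by nlinarith
    have hδ3 : δ * δ * δ ≤ δ := by nlinarith
    rw [key, norm_smul]
    have h2 : ‖(2 : ℂ)⁻¹‖ = 2⁻¹ := by simp
    have h3 : ‖(Δᴴ - Eᴴ * Δ * Eᴴ) - (Δᴴ * Δ * Eᴴ + Δᴴ * E * Δᴴ + Eᴴ * Δ * Δᴴ) -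
          Δᴴ * Δ * Δᴴ‖ ≤ 6 * δ := by
      have s1 := norm_sub_le ((Δᴴ - Eᴴ * Δ * Eᴴ) -
        (Δᴴ * Δ * Eᴴ + Δᴴ * E * Δᴴ + Eᴴ * Δ * Δᴴ)) (Δᴴ * Δ * Δᴴ)
      have s2 := norm_sub_le (Δᴴ - Eᴴ * Δ * Eᴴ)
        (Δᴴ * Δ * Eᴴ + Δᴴ * E * Δᴴ + Eᴴ * Δ * Δᴴ)
      have s3 := norm_sub_le Δᴴ (Eᴴ * Δ * Eᴴ)
      have s4 := norm_add₃_le (a := Δᴴ * Δ * Eᴴ) (b := Δᴴ * E * Δᴴ) (c := Eᴴ * Δ * Δᴴ)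
      linarith
    rw [h2]
    linarith

end Amplification
end DysonSim

/-! ### Assembling pieces into segments and segments into the evolution. -/

namespace DysonSim
open Matrix

variable {ns na M L : ℕ}

/-- A bound for the number of gates of a piece. -/
def pieceGates (na M K : ℕ) : ℕ :=
  (K + 1) * (60 * na + 207 * Nat.clog 2 M + 300) + (2 * na + 4 * Nat.clog 2 M + 4 * (K + 1) + 13)

/-- `B m` is the block of the oracle `U` at time index `m`. -/
def IsBlock (U : OracleOp ns na M) (B : ℕ → QOp (Fin ns)) : Prop :=
  ∀ (m m' : Fin M) (x y : Label (Fin ns)),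
    U (m, zeroLabel _, x) (m', zeroLabel _, y) = if m = m' then B m x y else 0

/-- The circuit is fixed before oracle, blocks and target are quantified, since it may depend on the
parameters only. -/
theorem exists_pieceCircuit (K : ℕ) (hM : 1 ≤ M) {p : ℝ} (hp0 : 0 ≤ p) (hp1 : p ≤ 1 / 2)
    (l : Fin L) (c : Bool) :
    ∃ P : Circuit ns na M L (2 * na + 4 * Nat.clog 2 M + 4 * (K + 1) + 13),
      P.queries ≤ 3 * (K + 1) ∧ P.gates ≤ (K + 1) * (60 * na + 207 * Nat.clog 2 M + 300) ∧
      ∀ O : Fin L → OracleOp ns na M, (∀ j, O j ∈ unitaryGroup _ ℂ) →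
        ‖P.implemented O‖ ≤ 1 ∧
        ((c = true ∧ M = 1) → P.implemented O = 1) ∧
        ∀ (B : ℕ → QOp (Fin ns)) (Y E : QOp (Fin ns)) (δ : ℝ), IsBlock (O l) B →
          (c = true → M ≠ 1) →
          discWalk B p (2 ^ (Nat.clog 2 M - 1)) (pieceLo (Nat.clog 2 M) c) (K + 1) M =
            ((1 - p : ℝ) : ℂ) • Y →
          E ∈ unitaryGroup _ ℂ → ‖Y - E‖ ≤ δ → ‖P.implemented O - Eᴴ‖ ≤ 3 * δ := by
  by_cases hc : c = true ∧ M = 1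
  -- For M = 1 the upper piece contains no time index, and its circuit is empty.
  · refine ⟨[], by simp [Circuit.queries], by simp [Circuit.gates], fun O _ => ?_⟩
    rw [implemented_nil]
    exact ⟨norm_le_one_of_unitary (one_mem _), fun _ => rfl, fun _ _ _ _ _ h => absurd hc.2 (h hc.1)⟩
  · have h1 : (0 : ℝ) < 1 / (2 * (1 - p)) := by
      have : 0 < 1 - p := by linarith
      positivity
    have h2 : 1 / (2 * (1 - p)) ≤ 1 := by
      rw [div_le_one (by linarith)]
      linarith
    have himpl := impl_pieceOp (ns := ns) (na := na) (K := K) hM c hp0 (by linarith : p ≤ 1)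
      (θ := 1 - (1 / (2 * (1 - p))) ^ 2) (by nlinarith) (by nlinarith) l
    obtain ⟨P, hq, hg, hP⟩ := himpl.exists_circuit
    obtain ⟨_, _, _, _, hunit⟩ := himpl
    refine ⟨P, hq, hg, fun O hO => ?_⟩
    have hn := norm_block_le (hunit O hO) (hP O)
    refine ⟨hn, fun h => absurd h hc, fun B Y E δ hB hc' hY hE hδ => ?_⟩
    have hW : P.implemented O = (2 : ℂ)⁻¹ • ((3 : ℂ) • Yᴴ - Yᴴ * Y * Yᴴ) := by
      ext x y
      rw [hP, pieceOp_apply (hO l) hB hM hc' hp0 hp1 hY]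
    rw [hW] at hn ⊢
    exact norm_amplified_sub_le hE hδ hn

/-- Both pieces end with measurements, so a segment acts as a factor S in front of any continuation
d; quantifying over d is what makes segments composable. The lower piece, earlier in time, runs
first. -/
theorem exists_segmentCircuit (K : ℕ) (hM : 1 ≤ M) {p : ℝ} (hp0 : 0 ≤ p) (hp1 : p ≤ 1 / 2)
    (l : Fin L) :
    ∃ P : Circuit ns na M L (2 * na + 4 * Nat.clog 2 M + 4 * (K + 1) + 13),
      P.queries ≤ 6 * (K + 1) ∧ P.gates ≤ 2 * pieceGates na M K ∧
      ∀ (d : Circuit ns na M L (2 * na + 4 * Nat.clog 2 M + 4 * (K + 1) + 13))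
        (O : Fin L → OracleOp ns na M), (∀ j, O j ∈ unitaryGroup _ ℂ) →
        ∃ S : QOp (Fin ns), (P ++ d).implemented O = d.implemented O * S ∧ ‖S‖ ≤ 1 ∧
        ∀ (B : ℕ → QOp (Fin ns)) (Y E : Bool → QOp (Fin ns)) (δ : Bool → ℝ), IsBlock (O l) B →
          (M = 1 → E true = 1) → 0 ≤ δ true →
          (∀ c, (c = true → M ≠ 1) →
            discWalk B p (2 ^ (Nat.clog 2 M - 1)) (pieceLo (Nat.clog 2 M) c) (K + 1) M =
              ((1 - p : ℝ) : ℂ) • Y c ∧ ‖Y c - E c‖ ≤ δ c) →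
          (∀ c, E c ∈ unitaryGroup _ ℂ) →
          ‖S - (E true)ᴴ * (E false)ᴴ‖ ≤ 3 * (δ false + δ true) := by
  obtain ⟨P, hq, hg, hP⟩ := exists_pieceCircuit (ns := ns) (na := na) K hM hp0 hp1 l false
  obtain ⟨P', hq', hg', hP'⟩ := exists_pieceCircuit (ns := ns) (na := na) K hM hp0 hp1 l true
  refine ⟨P ++ (checks _ _ _ _ _ ++ (P' ++ checks _ _ _ _ _)), ?_, ?_, fun d O hO => ?_⟩
  · have := queries_checks (ns := ns) (na := na) (M := M) (L := L)
      (anc := 2 * na + 4 * Nat.clog 2 M + 4 * (K + 1) + 13)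
    simp only [Circuit.queries, List.map_append, List.sum_append] at *
    omega
  · have := gates_checks (ns := ns) (na := na) (M := M) (L := L)
      (anc := 2 * na + 4 * Nat.clog 2 M + 4 * (K + 1) + 13)
    simp only [Circuit.gates, List.map_append, List.sum_append, pieceGates] at *
    omega
  · obtain ⟨h1, -, h3⟩ := hP O hO
    obtain ⟨h1', h2', h3'⟩ := hP' O hO
    refine ⟨P'.implemented O * P.implemented O, ?_, ?_, fun B Y E δ hB hE1 hδ hY hE => ?_⟩
    · simp only [List.append_assoc]
      rw [implemented_append_checks, implemented_append_checks, Matrix.mul_assoc]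
    · calc _ ≤ _ := Matrix.l2_opNorm_mul _ _
        _ ≤ 1 * 1 := mul_le_mul h1' h1 (norm_nonneg _) zero_le_one
        _ = 1 := one_mul 1
    · obtain ⟨hY0, hδ0⟩ := hY false (by simp)
      have e0 := h3 B (Y false) (E false) (δ false) hB (by simp) hY0 (hE false) hδ0
      have e1 : ‖P'.implemented O - (E true)ᴴ‖ ≤ 3 * δ true := by
        by_cases hM1 : M = 1
        · rw [h2' ⟨rfl, hM1⟩, hE1 hM1, Matrix.conjTranspose_one, sub_self, norm_zero]
          positivity
        · obtain ⟨hY1, hδ1⟩ := hY true (fun _ => hM1)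
          exact h3' B (Y true) (E true) (δ true) hB (fun _ => hM1) hY1 (hE true) hδ1
      have hE2 : ‖(E true)ᴴ‖ ≤ 1 := by
        rw [Matrix.l2_opNorm_conjTranspose]
        exact norm_le_one_of_unitary (hE true)
      have e : P'.implemented O * P.implemented O - (E true)ᴴ * (E false)ᴴ =
          (P'.implemented O - (E true)ᴴ) * P.implemented O +
            (E true)ᴴ * (P.implemented O - (E false)ᴴ) := by
        rw [Matrix.sub_mul, Matrix.mul_sub]
        abel
      rw [e]
      calc _ ≤ _ := norm_add_le _ _
        _ ≤ ‖P'.implemented O - (E true)ᴴ‖ * ‖P.implemented O‖ +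
            ‖(E true)ᴴ‖ * ‖P.implemented O - (E false)ᴴ‖ :=
          add_le_add (Matrix.l2_opNorm_mul _ _) (Matrix.l2_opNorm_mul _ _)
        _ ≤ (3 * δ true) * 1 + 1 * (3 * δ false) := by
          refine add_le_add (mul_le_mul e1 h1 (norm_nonneg _) ((norm_nonneg _).trans e1))
            (mul_le_mul hE2 e0 (norm_nonneg _) zero_le_one)
        _ = 3 * (δ false + δ true) := by ring

/-- The hypotheses under which the circuit for segment `l` implements `(E true)ᴴ * (E false)ᴴ` up to
the error `3 * (δ false + δ true)`. -/
structure SegmentApprox (U : OracleOp ns na M) (K : ℕ) (p : ℝ) (E : Bool → QOp (Fin ns))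
    (δ : Bool → ℝ) : Prop where
  unitary : ∀ c, E c ∈ unitaryGroup _ ℂ
  eq_one : M = 1 → E true = 1
  nonneg : 0 ≤ δ true
  approx : ∃ (B : ℕ → QOp (Fin ns)) (Y : Bool → QOp (Fin ns)), IsBlock U B ∧
    ∀ c, (c = true → M ≠ 1) →
      discWalk B p (2 ^ (Nat.clog 2 M - 1)) (pieceLo (Nat.clog 2 M) c) (K + 1) M =
        ((1 - p : ℝ) : ℂ) • Y c ∧ ‖Y c - E c‖ ≤ δ c

/-- Hybrid argument: replacing one contraction at a time by its target changes the product by at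
most the error of that factor. The list is reversed because the first segment executed is the
rightmost factor. -/
theorem exists_circuit_aux (K : ℕ) (hM : 1 ≤ M) {p : ℝ} (hp0 : 0 ≤ p) (hp1 : p ≤ 1 / 2)
    (l : List (Fin L)) :
    ∃ P : Circuit ns na M L (2 * na + 4 * Nat.clog 2 M + 4 * (K + 1) + 13),
      P.queries ≤ l.length * (6 * (K + 1)) ∧ P.gates ≤ l.length * (2 * pieceGates na M K) ∧
      ∀ O : Fin L → OracleOp ns na M, (∀ j, O j ∈ unitaryGroup _ ℂ) →
        ∀ (E : Fin L → Bool → QOp (Fin ns)) (δ : Fin L → Bool → ℝ),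
          (∀ j, SegmentApprox (O j) K p (E j) (δ j)) →
          ‖P.implemented O - (l.reverse.map fun j => (E j true)ᴴ * (E j false)ᴴ).prod‖ ≤
            (l.map fun j => 3 * (δ j false + δ j true)).sum ∧
          ‖(l.reverse.map fun j => (E j true)ᴴ * (E j false)ᴴ).prod‖ ≤ 1 := by
  induction l with
  | nil =>
    refine ⟨[], by simp [Circuit.queries], by simp [Circuit.gates], fun O _ E δ _ => ?_⟩
    rw [implemented_nil]
    simp
  | cons j l ih =>
    obtain ⟨P, hq, hg, hP⟩ := ih
    obtain ⟨S, hq', hg', hS⟩ := exists_segmentCircuit (ns := ns) (na := na) K hM hp0 hp1 j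
    refine ⟨S ++ P, ?_, ?_, fun O hO E δ hE => ?_⟩
    · simp only [Circuit.queries, List.map_append, List.sum_append, List.length_cons] at *
      rw [add_mul]
      omega
    · simp only [Circuit.gates, List.map_append, List.sum_append, List.length_cons] at *
      rw [add_mul]
      omega
    · obtain ⟨A, hA, hA1, hA2⟩ := hS P O hO
      obtain ⟨h1, h2⟩ := hP O hO E δ hE
      obtain ⟨B, Y, hB, hY⟩ := (hE j).approx
      have h3 := hA2 B Y (E j) (δ j) hB (hE j).eq_one (hE j).nonneg hY (hE j).unitary
      have hEn : ∀ c, ‖(E j c)ᴴ‖ ≤ 1 := fun c => by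
        rw [Matrix.l2_opNorm_conjTranspose]
        exact norm_le_one_of_unitary ((hE j).unitary c)
      rw [hA, List.reverse_cons, List.map_append, List.prod_append,
        List.map_singleton, List.prod_singleton, List.map_cons, List.sum_cons]
      set Q := (l.reverse.map fun j => (E j true)ᴴ * (E j false)ᴴ).prod with hQ
      set V := (E j true)ᴴ * (E j false)ᴴ with hV
      constructor
      · have e : P.implemented O * A - Q * V = (P.implemented O - Q) * A + Q * (A - V) := by
          rw [Matrix.sub_mul, Matrix.mul_sub]
          abel
        rw [e]
        calc _ ≤ _ := norm_add_le _ _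
          _ ≤ ‖P.implemented O - Q‖ * ‖A‖ + ‖Q‖ * ‖A - V‖ :=
            add_le_add (Matrix.l2_opNorm_mul _ _) (Matrix.l2_opNorm_mul _ _)
          _ ≤ _ * 1 + 1 * _ := by
            refine add_le_add (mul_le_mul h1 hA1 (norm_nonneg _) ((norm_nonneg _).trans h1))
              (mul_le_mul h2 h3 (norm_nonneg _) zero_le_one)
          _ = _ := by ring
      · calc _ ≤ _ := Matrix.l2_opNorm_mul _ _
          _ ≤ 1 * (1 * 1) := by
            refine mul_le_mul h2 ((Matrix.l2_opNorm_mul _ _).trans ?_) (norm_nonneg _) zero_le_one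
            exact mul_le_mul (hEn true) (hEn false) (norm_nonneg _) zero_le_one
          _ = 1 := by norm_num

theorem prod_reverse_finRange {R : Type*} [Monoid R] (L : ℕ) (V : ℕ → R) (U : ℕ → R)
    (h0 : U 0 = 1) (h : ∀ n, n < L → U (n + 1) = V n * U n) :
    ((List.finRange L).reverse.map fun j : Fin L => V j).prod = U L := by
  induction L with
  | zero => simp [h0]
  | succ L ih =>
    rw [List.finRange_succ_last, List.reverse_append, List.map_append, List.prod_append,
      h L (Nat.lt_succ_self L), ← ih fun n hn => h n (by omega), ← List.map_reverse]
    simp [Function.comp_def]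

/-- A circuit for the whole evolution. -/
theorem exists_circuit (ns na L K : ℕ) (hM : 1 ≤ M) {p : ℝ} (hp0 : 0 ≤ p) (hp1 : p ≤ 1 / 2) :
    ∃ P : Circuit ns na M L (2 * na + 4 * Nat.clog 2 M + 4 * (K + 1) + 13),
      P.queries ≤ L * (6 * (K + 1)) ∧ P.gates ≤ L * (2 * pieceGates na M K) ∧
      ∀ O : Fin L → OracleOp ns na M, (∀ j, O j ∈ unitaryGroup _ ℂ) →
        ∀ (E : ℕ → Bool → QOp (Fin ns)) (δ : ℕ → Bool → ℝ) (U : ℕ → QOp (Fin ns)),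
          (∀ j : Fin L, SegmentApprox (O j) K p (E j) (δ j)) → U 0 = 1 →
          (∀ j < L, U (j + 1) = (E j true)ᴴ * (E j false)ᴴ * U j) →
          ‖P.implemented O - U L‖ ≤ ∑ j ∈ Finset.range L, 3 * (δ j false + δ j true) := by
  obtain ⟨P, hq, hg, hP⟩ := exists_circuit_aux (ns := ns) (na := na) K hM hp0 hp1 (List.finRange L)
  rw [List.length_finRange] at hq hg
  refine ⟨P, hq, hg, fun O hO E δ U hE h0 h => ?_⟩
  have h1 := (hP O hO (fun j => E j) (fun j => δ j) hE).1
  rw [prod_reverse_finRange L (fun j => (E j true)ᴴ * (E j false)ᴴ) U h0 h] at h1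
  refine h1.trans (le_of_eq ?_)
  rw [← Fin.sum_univ_eq_sum_range (fun j => 3 * (δ j false + δ j true)), Fin.sum_univ_def]
end DysonSim

namespace DysonSim
open Matrix MeasureTheory

/-! ### The Dyson series solves the Schrödinger equation and is unitary. -/

section Generic

variable {A : Type*} [NormedRing A] [NormedAlgebra ℝ A] [CompleteSpace A] {F : ℝ → A} {h : ℝ}

/-- Differentiation term by term: on a ball around 0 containing s the derivatives are dominated by
an exponential series. The derivative of each term is F times the preceding one, so the derived
series is F times the whole. -/
theorem hasDerivAt_tsum_of_iterates {T : ℕ → ℝ → A} (hF : ∀ s, ‖F s‖ ≤ h) (h0 : ∀ s, T 0 s = 1)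
    (hT : ∀ k s, HasDerivAt (T (k + 1)) (F s * T k s) s)
    (hb : ∀ k s, ‖T k s‖ ≤ (h * |s|) ^ k / k.factorial) (s : ℝ) :
    HasDerivAt (fun s => ∑' k, T k s) (F s * ∑' k, T k s) s := by
  have hh : 0 ≤ h := (norm_nonneg _).trans (hF 0)
  have hsum : ∀ s, Summable fun k => T k s := fun s =>
    Summable.of_norm_bounded (Real.summable_pow_div_factorial (h * |s|)) fun k => hb k s
  have hR : ∀ u ∈ Metric.ball (0 : ℝ) (|s| + 1), |u| ≤ |s| + 1 := fun u hu => by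
    rw [mem_ball_zero_iff, Real.norm_eq_abs] at hu
    exact hu.le
  have hs : s ∈ Metric.ball (0 : ℝ) (|s| + 1) := by
    rw [mem_ball_zero_iff, Real.norm_eq_abs]
    linarith
  have hb' : ∀ k, ∀ u ∈ Metric.ball (0 : ℝ) (|s| + 1),
      ‖F u * T k u‖ ≤ h * ((h * (|s| + 1)) ^ k / k.factorial) := fun k u hu => by
    refine (norm_mul_le _ _).trans (mul_le_mul (hF u) ((hb k u).trans ?_) (norm_nonneg _) hh)
    have := hR u hu
    gcongr
  have hpre : IsPreconnected (Metric.ball (0 : ℝ) (|s| + 1)) :=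
    (convex_ball _ _).isPreconnected
  have hsum' : Summable fun k => T (k + 1) s := (summable_nat_add_iff 1).2 (hsum s)
  have hderiv := hasDerivAt_tsum_of_isPreconnected
    ((Real.summable_pow_div_factorial (h * (|s| + 1))).mul_left h) Metric.isOpen_ball hpre
    (fun k u _ => hT k u) hb' hs hsum' hs
  rw [(hsum s).tsum_mul_left] at hderiv
  have heq : (fun s => ∑' k, T k s) = fun s => 1 + ∑' k, T (k + 1) s := funext fun u => by
    rw [(hsum u).tsum_eq_zero_add, h0]
  rw [heq]
  exact hderiv.const_add 1

/-- For a skew-adjoint generator the two terms in the derivative of U*U cancel. -/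
theorem star_mul_self_of_hasDerivAt [StarRing A] [ContinuousStar A] [StarModule ℝ A] {U : ℝ → A}
    (hU : ∀ s, HasDerivAt U (F s * U s) s) (hF : ∀ s, star (F s) = -F s) (h0 : U 0 = 1) (s : ℝ) :
    star (U s) * U s = 1 := by
  have hd : ∀ u, HasDerivAt (fun u => star (U u) * U u) 0 u := fun u =>
    ((hU u).star.mul (hU u)).congr_deriv (by rw [star_mul, hF]; noncomm_ring)
  have hc := is_const_of_deriv_eq_zero (fun u => (hd u).differentiableAt)
    (fun u => (hd u).deriv) s 0
  rw [h0, star_one, one_mul] at hc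
  exact hc

end Generic

section DysonSeries

variable {n : ℕ} {G : ℝ → QOp (Fin n)} {h : ℝ}

theorem continuous_dysonTerm (hG : Continuous G) (k : ℕ) : Continuous (dysonTerm G k) := by
  induction k with
  | zero => exact continuous_const
  | succ k ih =>
    exact intervalIntegral.continuous_primitive
      (fun a b => (hG.mul ih).intervalIntegrable a b) 0

theorem hasDerivAt_dysonTerm_succ (hG : Continuous G) (k : ℕ) (s : ℝ) :
    HasDerivAt (dysonTerm G (k + 1)) (G s * dysonTerm G k s) s := by
  have hc : Continuous fun u => G u * dysonTerm G k u := hG.mul (continuous_dysonTerm hG k)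
  exact intervalIntegral.integral_hasDerivAt_right (hc.intervalIntegrable 0 s)
    (hc.stronglyMeasurableAtFilter _ _) hc.continuousAt

theorem norm_dysonTerm_le (hh : ∀ s, ‖G s‖ ≤ h) (k : ℕ) (s : ℝ) :
    ‖dysonTerm G k s‖ ≤ (h * |s|) ^ k / k.factorial := by
  have h0 : 0 ≤ h := (norm_nonneg _).trans (hh 0)
  induction k generalizing s with
  | zero => simp [dysonTerm]
  | succ k ih =>
    rw [dysonTerm, intervalIntegral.norm_integral_eq_norm_integral_uIoc]
    have hc : Continuous fun u : ℝ => h * ((h * |u - 0|) ^ k / k.factorial) := by fun_prop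
    calc _ ≤ ∫ u in Set.uIoc 0 s, h * ((h * |u - 0|) ^ k / k.factorial) := by
          refine norm_integral_le_of_norm_le ?_ ?_
          · exact ((hc.intervalIntegrable 0 s).def')
          · refine Filter.Eventually.of_forall fun u => (norm_mul_le _ _).trans ?_
            rw [sub_zero]
            exact mul_le_mul (hh u) (ih u) (norm_nonneg _) h0
      _ = h ^ (k + 1) / k.factorial * ∫ u in Set.uIoc 0 s, |u - 0| ^ k := by
          rw [← integral_const_mul]
          refine integral_congr_ae (Filter.Eventually.of_forall fun u => ?_)
          simp only [mul_pow]
          ring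
      _ = _ := by
          rw [integral_pow_abs_sub_uIoc, sub_zero, Nat.factorial_succ, mul_pow]
          push_cast
          field_simp

theorem timeOrderedExp_zero : timeOrderedExp G 0 = 1 := by
  rw [timeOrderedExp, tsum_eq_single 0]
  · simp [dysonTerm]
  · intro k hk
    obtain ⟨k, rfl⟩ := Nat.exists_eq_succ_of_ne_zero hk
    rw [Nat.succ_eq_add_one, dysonTerm, intervalIntegral.integral_same, smul_zero]

theorem hasDerivAt_timeOrderedExp (hG : Continuous G) (hh : ∀ s, ‖G s‖ ≤ h) (s : ℝ) :
    HasDerivAt (timeOrderedExp G) (((-Complex.I) • G s) * timeOrderedExp G s) s := by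
  refine hasDerivAt_tsum_of_iterates (F := fun s => (-Complex.I) • G s)
    (T := fun k s => (-Complex.I) ^ k • dysonTerm G k s) (h := h) (fun s => ?_) (fun s => ?_)
    (fun k s => ?_) (fun k s => ?_) s
  · rw [norm_smul, norm_neg, Complex.norm_I, one_mul]
    exact hh s
  · rw [pow_zero, one_smul]
    rfl
  · refine ((hasDerivAt_dysonTerm_succ hG k s).const_smul ((-Complex.I) ^ (k + 1))).congr_deriv ?_
    rw [Matrix.smul_mul, Matrix.mul_smul, smul_smul, pow_succ']
  · rw [norm_smul, norm_pow, norm_neg, Complex.norm_I, one_pow, one_mul]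
    exact norm_dysonTerm_le hh k s

theorem timeOrderedExp_unitary (hG : Continuous G) (hh : ∀ s, ‖G s‖ ≤ h)
    (hH : ∀ s, (G s).IsHermitian) (s : ℝ) :
    timeOrderedExp G s ∈ unitaryGroup (Label (Fin n)) ℂ := by
  rw [mem_unitaryGroup_iff']
  refine star_mul_self_of_hasDerivAt (F := fun s => (-Complex.I) • G s)
    (hasDerivAt_timeOrderedExp hG hh) (fun s => ?_) timeOrderedExp_zero s
  rw [star_eq_conjTranspose, Matrix.conjTranspose_smul, (hH s).eq, ← neg_smul]
  simp

end DysonSeries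
end DysonSim

namespace DysonSim
open Matrix MeasureTheory

/-! ### Euler steps and the truncated discrete series. -/

section Discretization

variable {A : Type*} [NormedRing A] [NormedAlgebra ℝ A]

/-- The error of one step of the Euler method. -/
theorem norm_euler_step_le {E F : ℝ → A} {h : ℝ} (hE : ∀ s, HasDerivAt E (E s * F s) s)
    (hE1 : ∀ s, ‖E s‖ ≤ 1) (hF : ∀ s, ‖F s‖ ≤ h) {a b W : ℝ} (hab : a ≤ b)
    (hW : ∀ u ∈ Set.Icc a b, ‖F u - F a‖ ≤ W) :
    ‖E b - E a - (b - a) • (E a * F a)‖ ≤ (h ^ 2 * (b - a) + W) * (b - a) := by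
  have hh : 0 ≤ h := (norm_nonneg _).trans (hF 0)
  have hb : b ∈ Set.Icc a b := Set.right_mem_Icc.2 hab
  have ha : a ∈ Set.Icc a b := Set.left_mem_Icc.2 hab
  have h1 : ∀ u ∈ Set.Icc a b, ‖E u - E a‖ ≤ h * (b - a) := by
    intro u hu
    have := (convex_Icc a b).norm_image_sub_le_of_norm_hasDerivWithin_le (f := E) (C := h)
      (fun x _ => (hE x).hasDerivWithinAt) (fun x _ => ?_) ha hu
    · refine this.trans (mul_le_mul_of_nonneg_left ?_ hh)
      rw [Real.norm_eq_abs, abs_of_nonneg (by linarith [hu.1])]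
      linarith [hu.2]
    · calc _ ≤ ‖E x‖ * ‖F x‖ := norm_mul_le _ _
        _ ≤ 1 * h := mul_le_mul (hE1 x) (hF x) (norm_nonneg _) zero_le_one
        _ = h := one_mul h
  -- A second mean value estimate, for E minus its tangent at a: the derivative E u F u - E a F a is
  -- small because E moves by at most h(b - a) and F by at most W.
  have h2 := (convex_Icc a b).norm_image_sub_le_of_norm_hasDerivWithin_le
    (f := fun u => E u - u • (E a * F a)) (C := h ^ 2 * (b - a) + W)
    (f' := fun u => E u * F u - E a * F a) (fun x _ => ?_) (fun x hx => ?_) ha hb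
  · rw [Real.norm_eq_abs, abs_of_nonneg (by linarith)] at h2
    have e : E b - E a - (b - a) • (E a * F a) =
        E b - b • (E a * F a) - (E a - a • (E a * F a)) := by
      rw [sub_smul]
      abel
    rw [e]
    exact h2
  · have := (hE x).sub ((hasDerivAt_id x).smul_const (E a * F a))
    rw [one_smul] at this
    exact this.hasDerivWithinAt
  · have e : E x * F x - E a * F a = (E x - E a) * F x + E a * (F x - F a) := by
      rw [sub_mul, mul_sub]
      abel
    rw [e]
    calc _ ≤ _ := norm_add_le _ _
      _ ≤ ‖E x - E a‖ * ‖F x‖ + ‖E a‖ * ‖F x - F a‖ :=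
        add_le_add (norm_mul_le _ _) (norm_mul_le _ _)
      _ ≤ (h * (b - a)) * h + 1 * W := by
        refine add_le_add (mul_le_mul (h1 x hx) (hF x) (norm_nonneg _) ?_)
          (mul_le_mul (hE1 a) (hW x hx) (norm_nonneg _) zero_le_one)
        exact mul_nonneg hh (by linarith)
      _ = _ := by ring

/-- The hockey-stick identity; it counts descending walks, and is where the factorial in the
truncation error comes from. -/
theorem sum_Ico_choose (lo m n : ℕ) (h : lo ≤ m) :
    ∑ j ∈ Finset.Ico lo m, (j - lo).choose n = (m - lo).choose (n + 1) := by
  induction m, h using Nat.le_induction with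
  | base => simp
  | succ m hm ih =>
    rw [Finset.sum_Ico_succ_top hm, ih, Nat.succ_sub hm, Nat.succ_eq_add_one,
      Nat.choose_succ_succ', add_comm]

/-- The truncated discrete series approximates every sequence that satisfies its recursion up to
small errors. -/
theorem norm_discrete_sub_le {E F : ℕ → A} {Y : ℕ → ℕ → A} {e : ℕ → ℝ} {lo hi : ℕ} {δ h : ℝ}
    (hδ : 0 ≤ δ) (hF : ∀ j, ‖F j‖ ≤ h) (hsmall : h * δ * (hi - lo : ℕ) ≤ 1 / 2)
    (hElo : E lo = 1) (hE1 : ∀ j, ‖E j‖ ≤ 1) (hY0 : ∀ m, ‖Y 0 m‖ ≤ 2)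
    (hstep : ∀ j, lo ≤ j → j < hi → ‖E (j + 1) - E j - δ • (E j * F j)‖ ≤ e j)
    (hY : ∀ n m, lo ≤ m → m ≤ hi →
      Y (n + 1) m = 1 + δ • ∑ j ∈ Finset.Ico lo m, Y n j * F j)
    (n m : ℕ) (hm : lo ≤ m) (hm' : m ≤ hi) :
    ‖Y n m - E m‖ ≤ 2 * ∑ j ∈ Finset.Ico lo hi, e j + 3 * (h * δ) ^ n * (m - lo).choose n := by
  have hh : 0 ≤ h := (norm_nonneg _).trans (hF 0)
  have he : ∀ j, lo ≤ j → j < hi → 0 ≤ e j := fun j h1 h2 => (norm_nonneg _).trans (hstep j h1 h2)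
  have hη : 0 ≤ ∑ j ∈ Finset.Ico lo hi, e j := Finset.sum_nonneg fun j hj => by
    rw [Finset.mem_Ico] at hj
    exact he j hj.1 hj.2
  -- Summing the Euler steps shows that E solves the discrete integral equation up to the
  -- accumulated error.
  have hquad : ∀ m, lo ≤ m → m ≤ hi → ‖E m - 1 - δ • ∑ j ∈ Finset.Ico lo m, E j * F j‖ ≤
      ∑ j ∈ Finset.Ico lo m, e j := by
    intro m hm
    induction m, hm using Nat.le_induction with
    | base => simp [hElo]
    | succ m hm ih =>
      intro hm'
      rw [Finset.sum_Ico_succ_top hm, Finset.sum_Ico_succ_top hm]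
      have : E (m + 1) - 1 - δ • (∑ j ∈ Finset.Ico lo m, E j * F j + E m * F m) =
          (E m - 1 - δ • ∑ j ∈ Finset.Ico lo m, E j * F j) +
            (E (m + 1) - E m - δ • (E m * F m)) := by
        rw [smul_add]
        abel
      rw [this]
      exact (norm_add_le _ _).trans (add_le_add (ih (by omega)) (hstep m hm (by omega)))
  have hquad' : ∀ m, lo ≤ m → m ≤ hi → ‖E m - 1 - δ • ∑ j ∈ Finset.Ico lo m, E j * F j‖ ≤
      ∑ j ∈ Finset.Ico lo hi, e j := fun m hm hm' =>
    (hquad m hm hm').trans (Finset.sum_le_sum_of_subset_of_nonneg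
      (Finset.Ico_subset_Ico_right hm') fun j hj _ => by
        rw [Finset.mem_Ico] at hj
        exact he j hj.1 hj.2)
  set η := ∑ j ∈ Finset.Ico lo hi, e j with hηdef
  induction n generalizing m with
  | zero =>
    -- The constant 3 is 2 + 1, from the bounds for the initial iterate and for E.
    have := norm_sub_le (Y 0 m) (E m)
    rw [pow_zero, Nat.choose_zero_right, Nat.cast_one]
    linarith [hY0 m, hE1 m]
  | succ n ih =>
    have key : Y (n + 1) m - E m = δ • ∑ j ∈ Finset.Ico lo m, (Y n j - E j) * F j -
        (E m - 1 - δ • ∑ j ∈ Finset.Ico lo m, E j * F j) := by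
      rw [hY n m hm hm']
      simp only [sub_mul, Finset.sum_sub_distrib, smul_sub]
      abel
    have hs : ‖∑ j ∈ Finset.Ico lo m, (Y n j - E j) * F j‖ ≤
        ∑ j ∈ Finset.Ico lo m, (2 * η + 3 * (h * δ) ^ n * (j - lo).choose n) * h := by
      refine norm_sum_le_of_le _ fun j hj => ?_
      rw [Finset.mem_Ico] at hj
      refine (norm_mul_le _ _).trans (mul_le_mul (ih j hj.1 (by omega)) (hF j) (norm_nonneg _) ?_)
      positivity
    have hsum : ∑ j ∈ Finset.Ico lo m, (2 * η + 3 * (h * δ) ^ n * ((j - lo).choose n : ℕ)) * h =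
        (2 * η * (m - lo : ℕ) + 3 * (h * δ) ^ n * ((m - lo).choose (n + 1) : ℕ)) * h := by
      rw [← sum_Ico_choose lo m n hm, ← Finset.sum_mul, Finset.sum_add_distrib, Finset.sum_const,
        Nat.card_Ico, nsmul_eq_mul, ← Finset.mul_sum]
      push_cast
      ring
    have hml : h * δ * (m - lo : ℕ) ≤ 1 / 2 := by
      refine le_trans ?_ hsmall
      have : ((m - lo : ℕ) : ℝ) ≤ (hi - lo : ℕ) := by
        exact_mod_cast Nat.sub_le_sub_right hm' lo
      gcongr
    rw [key]
    calc _ ≤ _ := norm_sub_le _ _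
      _ ≤ δ * ((2 * η * (m - lo : ℕ) + 3 * (h * δ) ^ n * ((m - lo).choose (n + 1) : ℕ)) * h) + η := by
        refine add_le_add ?_ (hquad' m hm hm')
        rw [norm_smul, Real.norm_eq_abs, abs_of_nonneg hδ]
        exact mul_le_mul_of_nonneg_left (hs.trans hsum.le) hδ
      _ = 2 * η * (h * δ * (m - lo : ℕ)) + η +
          3 * (h * δ) ^ (n + 1) * ((m - lo).choose (n + 1) : ℕ) := by ring
      -- The iteration contracts by 1/2, so the bound 2η reproduces itself as 2η · 1/2 + η.
      _ ≤ 2 * η * (1 / 2) + η + 3 * (h * δ) ^ (n + 1) * ((m - lo).choose (n + 1) : ℕ) := by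
        gcongr
      _ = _ := by ring

end Discretization
end DysonSim

namespace DysonSim
open Matrix MeasureTheory

/-! ### Extending the Hamiltonian to the line, and its variation on a cell. -/

section Extension

variable {n : ℕ} {H : ℝ → QOp (Fin n)} {t h : ℝ}

/-- The continuous extension of `H` by its boundary values. -/
noncomputable def extendIcc (H : ℝ → QOp (Fin n)) (ht : 0 ≤ t) (s : ℝ) : QOp (Fin n) :=
  H (Set.projIcc 0 t ht s)

theorem extendIcc_of_mem (ht : 0 ≤ t) {s : ℝ} (hs : s ∈ Set.Icc 0 t) :
    extendIcc H ht s = H s := by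
  rw [extendIcc, Set.projIcc_of_mem ht hs]

theorem continuous_extendIcc (ht : 0 ≤ t) (hH : ContinuousOn H (Set.Icc 0 t)) :
    Continuous (extendIcc H ht) := by
  have := (continuousOn_iff_continuous_domRestrict.1 hH).comp (continuous_projIcc (h := ht))
  exact this

/-- H is unconstrained outside of [0, t]. The iterated integrals do not see those values, so H may
be replaced by an extension continuous on the whole line. -/
theorem dysonTerm_extendIcc (ht : 0 ≤ t) (k : ℕ) {s : ℝ} (hs : s ∈ Set.Icc 0 t) :
    dysonTerm (extendIcc H ht) k s = dysonTerm H k s := by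
  induction k generalizing s with
  | zero => rfl
  | succ k ih =>
    rw [dysonTerm, dysonTerm]
    refine intervalIntegral.integral_congr fun u hu => ?_
    rw [Set.uIcc_of_le hs.1] at hu
    have hu' : u ∈ Set.Icc 0 t := ⟨hu.1, hu.2.trans hs.2⟩
    simp only [extendIcc_of_mem ht hu', ih hu']

theorem timeOrderedExp_extendIcc (ht : 0 ≤ t) :
    timeOrderedExp (extendIcc H ht) t = timeOrderedExp H t := by
  unfold timeOrderedExp
  simp only [dysonTerm_extendIcc ht _ (Set.right_mem_Icc.2 ht)]

/-- The fundamental theorem of calculus needs only continuity, differentiability inside and an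
integrable derivative. Enlarging the integral to the whole cell gives a bound uniform in u. -/
theorem norm_extendIcc_sub_le (ht : 0 ≤ t) (hH : IsHamiltonianOn H t) {a b u : ℝ} (ha : 0 ≤ a)
    (hb : b ≤ t) (hu : u ∈ Set.Icc a b) :
    ‖extendIcc H ht u - extendIcc H ht a‖ ≤ ∫ s in a..b, ‖derivWithin H (Set.Icc 0 t) s‖ := by
  have hsub : ∀ {c d : ℝ}, a ≤ c → c ≤ d → d ≤ b →
      IntervalIntegrable (derivWithin H (Set.Icc 0 t)) volume c d := by
    intro c d h1 h2 h3
    refine hH.integrable.mono_set ?_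
    rw [Set.uIcc_of_le h2, Set.uIcc_of_le ht]
    exact Set.Icc_subset_Icc (by linarith) (by linarith)
  have hab : a ≤ b := hu.1.trans hu.2
  rw [extendIcc_of_mem ht ⟨ha.trans hu.1, hu.2.trans hb⟩,
    extendIcc_of_mem ht ⟨ha, hab.trans hb⟩]
  have hftc : ∫ s in a..u, derivWithin H (Set.Icc 0 t) s = H u - H a := by
    refine intervalIntegral.integral_eq_sub_of_hasDeriv_right ?_ ?_ (hsub le_rfl hu.1 hu.2)
    · rw [Set.uIcc_of_le hu.1]
      exact hH.differentiable.continuousOn.mono (Set.Icc_subset_Icc ha (hu.2.trans hb))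
    · intro x hx
      rw [min_eq_left hu.1, max_eq_right hu.1] at hx
      have hx1 : 0 < x := ha.trans_lt hx.1
      have hx2 : x < t := hx.2.trans_le (hu.2.trans hb)
      exact ((hH.differentiable x ⟨hx1.le, hx2.le⟩).hasDerivWithinAt.hasDerivAt
        (Icc_mem_nhds hx1 hx2)).hasDerivWithinAt
  rw [← hftc]
  refine (intervalIntegral.norm_integral_le_integral_norm hu.1).trans ?_
  rw [← intervalIntegral.integral_add_adjacent_intervals (hsub le_rfl hu.1 hu.2).norm
    (hsub hu.1 hu.2 le_rfl).norm, le_add_iff_nonneg_right]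
  exact intervalIntegral.integral_nonneg hu.2 fun s _ => norm_nonneg _

end Extension

/-! ### The discrete walk approximates the backward evolution. -/

section Pieces

variable {ns : ℕ} {G : ℝ → QOp (Fin ns)} {h : ℝ}

/-- The evolution backwards from `s` to `a`. -/
noncomputable def backward (G : ℝ → QOp (Fin ns)) (a s : ℝ) : QOp (Fin ns) :=
  timeOrderedExp G a * (timeOrderedExp G s)ᴴ

theorem backward_unitary (hG : Continuous G) (hh : ∀ s, ‖G s‖ ≤ h) (hH : ∀ s, (G s).IsHermitian)
    (a s : ℝ) : backward G a s ∈ unitaryGroup (Label (Fin ns)) ℂ :=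
  mul_mem (timeOrderedExp_unitary hG hh hH a)
    (Unitary.star_mem (timeOrderedExp_unitary hG hh hH s))

theorem backward_self (hG : Continuous G) (hh : ∀ s, ‖G s‖ ≤ h) (hH : ∀ s, (G s).IsHermitian)
    (a : ℝ) : backward G a a = 1 := mem_unitaryGroup_iff.1 (timeOrderedExp_unitary hG hh hH a)

theorem hasDerivAt_backward (hG : Continuous G) (hh : ∀ s, ‖G s‖ ≤ h)
    (hH : ∀ s, (G s).IsHermitian) (a s : ℝ) :
    HasDerivAt (backward G a) (backward G a s * (Complex.I • G s)) s := by
  have h1 := (hasDerivAt_timeOrderedExp hG hh s).star.const_mul (timeOrderedExp G a)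
  refine h1.congr_deriv ?_
  rw [star_eq_conjTranspose, Matrix.conjTranspose_mul, Matrix.conjTranspose_smul, (hH s).eq,
    backward, Matrix.mul_assoc]
  simp

/-- Dividing the walk by 1 - p turns its recursion into Y ↦ 1 + δ ∑ Y·iG, because (p/N)/α = δ. The
initial iterate becomes 1/(1 - p), of norm at most 2. The binomial coefficient is at most
M^(K+1)/(K+1)!. -/
theorem discWalk_approx (hG : Continuous G) (hh : ∀ s, ‖G s‖ ≤ h) (hH : ∀ s, (G s).IsHermitian)
    {α δ T p : ℝ} {w : ℝ → ℝ} (hα : 0 < α) (hδ : 0 ≤ δ) {N lo hi M : ℕ}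
    (hp : p = α * δ * N) (hp1 : p ≤ 1 / 2) (hN : N ≠ 0) (hlo : lo ≤ hi) (hhi : hi = min M (lo + N))
    (hsmall : h * δ * M ≤ 1 / 2)
    (hw : ∀ j < M, ∀ u ∈ Set.Icc (T + j * δ) (T + (j + 1 : ℕ) * δ),
      ‖G u - G (T + j * δ)‖ ≤ ∫ s in (T + j * δ)..(T + (j + 1 : ℕ) * δ), w s) (K : ℕ) :
    ∃ Y : QOp (Fin ns),
      discWalk (fun j => (α : ℂ)⁻¹ • G (T + j * δ)) p N lo (K + 1) M = ((1 - p : ℝ) : ℂ) • Y ∧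
      ‖Y - backward G (T + lo * δ) (T + hi * δ)‖ ≤
        2 * ∑ j ∈ Finset.Ico lo hi,
          (h ^ 2 * δ + ∫ s in (T + j * δ)..(T + (j + 1 : ℕ) * δ), w s) * δ +
        3 * ((h * δ * M) ^ (K + 1) / (K + 1).factorial) := by
  have h0 : 0 ≤ h := (norm_nonneg _).trans (hh 0)
  have hp' : ((1 - p : ℝ) : ℂ) ≠ 0 := by
    rw [Ne, Complex.ofReal_eq_zero]
    linarith
  set B : ℕ → QOp (Fin ns) := fun j => (α : ℂ)⁻¹ • G (T + j * δ) with hB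
  let Y : ℕ → ℕ → QOp (Fin ns) := fun n m => ((1 - p : ℝ) : ℂ)⁻¹ • discWalk B p N lo n m
  have hYw : ∀ n m, discWalk B p N lo n m = ((1 - p : ℝ) : ℂ) • Y n m := fun n m => by
    simp only [Y]
    rw [smul_smul, mul_inv_cancel₀ hp', one_smul]
  have hhiM : hi ≤ M := by omega
  have hI : ∀ s, ‖Complex.I • G s‖ ≤ h := fun s => by
    rw [norm_smul, Complex.norm_I, one_mul]
    exact hh s
  have hstep : ∀ n m, lo ≤ m → m ≤ hi →
      Y (n + 1) m = 1 + δ • ∑ j ∈ Finset.Ico lo m, Y n j * (Complex.I • G (T + j * δ)) := by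
    intro n m hm hm'
    simp only [Y]
    rw [discWalk, min_eq_left (by omega), smul_add, smul_smul, inv_mul_cancel₀ hp', one_smul]
    congr 1
    rw [smul_smul, Finset.smul_sum, Finset.smul_sum]
    refine Finset.sum_congr rfl fun j _ => ?_
    rw [hYw]
    have hcoef : p / N = α * δ := by
      rw [hp]
      field_simp
    have hα' : (α : ℂ) ≠ 0 := by exact_mod_cast hα.ne'
    rw [hcoef]
    simp only [hB, Matrix.smul_mul, Matrix.mul_smul, smul_smul]
    ext x y
    simp only [Matrix.smul_apply, smul_eq_mul, Complex.real_smul]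
    push_cast
    field_simp
  refine ⟨Y (K + 1) hi, ?_, ?_⟩
  · rw [← hYw]
    have hmin : min M (lo + N) = min hi (lo + N) := by omega
    simp only [discWalk, hmin]
  · have h1 := norm_discrete_sub_le (E := fun j : ℕ => backward G (T + lo * δ) (T + j * δ))
      (F := fun j : ℕ => Complex.I • G (T + j * δ)) (Y := Y)
      (e := fun j => (h ^ 2 * δ + ∫ s in (T + j * δ)..(T + (j + 1 : ℕ) * δ), w s) * δ)
      (lo := lo) (hi := hi) (δ := δ) (h := h) hδ (fun _ => hI _) ?_
      (backward_self hG hh hH _) (fun j => norm_le_one_of_unitary (backward_unitary hG hh hH _ _))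
      ?_ ?_ hstep (K + 1) hi hlo le_rfl
    · refine h1.trans (add_le_add_right ?_ _)
      have hc : (((hi - lo).choose (K + 1) : ℕ) : ℝ) ≤ (M : ℝ) ^ (K + 1) / (K + 1).factorial := by
        refine (Nat.choose_le_pow_div (α := ℝ) (K + 1) (hi - lo)).trans ?_
        have : ((hi - lo : ℕ) : ℝ) ≤ M := by exact_mod_cast (by omega)
        gcongr
      calc _ ≤ 3 * (h * δ) ^ (K + 1) * ((M : ℝ) ^ (K + 1) / (K + 1).factorial) := by gcongr
        _ = _ := by
          rw [mul_pow (h * δ)]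
          ring
    · refine le_trans ?_ hsmall
      have : ((hi - lo : ℕ) : ℝ) ≤ M := by exact_mod_cast (by omega)
      gcongr
    · intro m
      simp only [Y, discWalk]
      rw [norm_smul, norm_inv, Complex.norm_real, Real.norm_eq_abs, abs_of_nonneg (by linarith)]
      have h2 : ‖(1 : QOp (Fin ns))‖ ≤ 1 := norm_le_one_of_unitary (one_mem _)
      have h3 : (1 - p)⁻¹ ≤ 2 := by
        rw [inv_le_comm₀ (by linarith) (by norm_num)]
        linarith
      calc _ ≤ 2 * 1 := mul_le_mul h3 h2 (norm_nonneg _) (by norm_num)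
        _ = 2 := by norm_num
    · intro j hj hj'
      have hd : T + ((j + 1 : ℕ) : ℝ) * δ - (T + j * δ) = δ := by
        push_cast
        ring
      have := norm_euler_step_le (E := backward G (T + lo * δ)) (F := fun s => Complex.I • G s)
        (h := h) (hasDerivAt_backward hG hh hH _)
        (fun s => norm_le_one_of_unitary (backward_unitary hG hh hH _ _)) hI
        (a := T + j * δ) (b := T + (j + 1 : ℕ) * δ)
        (W := ∫ s in (T + j * δ)..(T + (j + 1 : ℕ) * δ), w s) (by linarith) (fun u hu => ?_)
      · rw [hd] at this
        exact this
      · rw [← smul_sub, norm_smul, Complex.norm_I, one_mul]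
        exact hw j (by omega) u hu

end Pieces
end DysonSim

namespace DysonSim
open Matrix MeasureTheory

/-! ### Segment approximations and the total error of the evolution. -/

section Segments

variable {ns na M L : ℕ} {H : ℝ → QOp (Fin ns)} {t h α δ T : ℝ}

theorem two_pow_clog_pred_le (hM : 1 ≤ M) : 2 ^ (Nat.clog 2 M - 1) ≤ M := by
  rcases Nat.eq_or_lt_of_le hM with rfl | h
  · simp
  · exact (Nat.pow_pred_clog_lt_self one_lt_two h).le

/-- The error of one time step. -/
noncomputable def cellError (H : ℝ → QOp (Fin ns)) (t h δ T : ℝ) (j : ℕ) : ℝ :=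
  (h ^ 2 * δ + ∫ s in (T + j * δ)..(T + (j + 1 : ℕ) * δ), ‖derivWithin H (Set.Icc 0 t) s‖) * δ

theorem cellError_nonneg (hδ : 0 ≤ δ) (j : ℕ) : 0 ≤ cellError H t h δ T j := by
  have : T + j * δ ≤ T + (j + 1 : ℕ) * δ := by
    push_cast
    linarith
  have h2 : 0 ≤ ∫ s in (T + j * δ)..(T + (j + 1 : ℕ) * δ), ‖derivWithin H (Set.Icc 0 t) s‖ :=
    intervalIntegral.integral_nonneg this fun s _ => norm_nonneg _
  rw [cellError]
  positivity

theorem sum_cellError (hH : IsHamiltonianOn H t) (hδ : 0 ≤ δ) (hT : 0 ≤ T) (hTt : T + M * δ ≤ t) :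
    ∑ j ∈ Finset.range M, cellError H t h δ T j = M * h ^ 2 * δ ^ 2 +
      δ * ∫ s in T..(T + M * δ), ‖derivWithin H (Set.Icc 0 t) s‖ := by
  have hadd := intervalIntegral.sum_integral_adjacent_intervals (μ := volume)
    (f := fun s => ‖derivWithin H (Set.Icc 0 t) s‖) (a := fun j : ℕ => T + j * δ) (n := M) ?_
  · simp only [cellError, add_mul, Finset.sum_add_distrib, Finset.sum_const, Finset.card_range,
      nsmul_eq_mul, ← Finset.sum_mul, hadd]
    simp
    ring
  · intro j hj
    refine (hH.integrable.mono_set ?_).norm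
    have h1 : T + j * δ ≤ T + (j + 1 : ℕ) * δ := by
      push_cast
      linarith
    have h3 : ((j + 1 : ℕ) : ℝ) ≤ M := by exact_mod_cast hj
    have h4 : 0 ≤ j * δ := by positivity
    have h5 : ((j + 1 : ℕ) : ℝ) * δ ≤ M * δ := by gcongr
    have ht : 0 ≤ t := by linarith
    rw [Set.uIcc_of_le h1, Set.uIcc_of_le ht]
    exact Set.Icc_subset_Icc (by linarith) (by linarith)

/-- The two pieces share the parameter p although the upper one may contain fewer than N indices,
since p/N is all that enters the recursion. -/
theorem segmentApprox {U : OracleOp ns na M} (ht : 0 ≤ t) (hH : IsHamiltonianOn H t)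
    (hh : ∀ s ∈ Set.Icc 0 t, ‖H s‖ ≤ h) (hM : 1 ≤ M) (hα : 0 < α) (hhα : h ≤ α) (hδ : 0 ≤ δ)
    (hT : 0 ≤ T) (hTt : T + M * δ ≤ t) (hsmall : α * δ * M ≤ 1 / 2)
    (hU : ∀ (m m' : Fin M) (x y : Label (Fin ns)),
      U (m, zeroLabel _, x) (m', zeroLabel _, y) =
        if m = m' then H (T + m * δ) x y / (α : ℂ) else 0) (K : ℕ) :
    SegmentApprox U K (α * δ * (2 ^ (Nat.clog 2 M - 1) : ℕ))
      (fun c => cond c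
        (backward (extendIcc H ht) (T + (2 ^ (Nat.clog 2 M - 1) : ℕ) * δ) (T + M * δ))
        (backward (extendIcc H ht) T (T + (2 ^ (Nat.clog 2 M - 1) : ℕ) * δ)))
      (fun c => 2 * ∑ j ∈ Finset.Ico (cond c (2 ^ (Nat.clog 2 M - 1)) 0)
          (cond c M (2 ^ (Nat.clog 2 M - 1))), cellError H t h δ T j +
        3 * ((h * δ * M) ^ (K + 1) / (K + 1).factorial)) := by
  set N := 2 ^ (Nat.clog 2 M - 1) with hN
  have hNM : N ≤ M := two_pow_clog_pred_le hM
  have h0 : 0 ≤ h := (norm_nonneg _).trans (hh 0 (Set.left_mem_Icc.2 ht))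
  have hG : Continuous (extendIcc H ht) := continuous_extendIcc ht hH.differentiable.continuousOn
  have hG1 : ∀ s, ‖extendIcc H ht s‖ ≤ h := fun s => hh _ (Subtype.mem _)
  have hG2 : ∀ s, (extendIcc H ht s).IsHermitian := fun s => hH.hermitian _ (Subtype.mem _)
  have hmono : ∀ {j : ℕ}, j ≤ M → (j : ℝ) * δ ≤ M * δ := fun {j} hj => by
    have : (j : ℝ) ≤ M := by exact_mod_cast hj
    gcongr
  have hj0 : ∀ j : ℕ, 0 ≤ (j : ℝ) * δ := fun j => by positivity
  refine ⟨fun c => ?_, fun hM1 => ?_, ?_, fun j => (α : ℂ)⁻¹ • extendIcc H ht (T + j * δ), ?_⟩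
  · cases c <;> exact backward_unitary hG hG1 hG2 _ _
  -- For M = 1 the truncated subtraction gives N = 2 ^ 0 = 1, so the upper time interval is
  -- degenerate.
  · have : N = M := by
      rw [hN, hM1]
      simp
    rw [this]
    exact backward_self hG hG1 hG2 _
  · have : 0 ≤ ∑ j ∈ Finset.Ico (cond true N 0) (cond true M N), cellError H t h δ T j :=
      Finset.sum_nonneg fun j _ => cellError_nonneg hδ j
    positivity
  · have hp1 : α * δ * (N : ℕ) ≤ 1 / 2 := by
      refine le_trans ?_ hsmall
      rw [mul_assoc, mul_assoc]
      exact mul_le_mul_of_nonneg_left (by linarith [hmono hNM]) hα.le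
    have hsmall' : h * δ * M ≤ 1 / 2 := le_trans (by gcongr) hsmall
    have key := fun (lo hi : ℕ) (hlo : lo ≤ hi) (hhi : hi = min M (lo + N)) =>
      discWalk_approx hG hG1 hG2 (T := T) (p := α * δ * (N : ℕ))
        (w := fun s => ‖derivWithin H (Set.Icc 0 t) s‖) hα hδ rfl hp1
        (by rw [hN]; positivity) hlo hhi hsmall' (fun j hj u hu => by
          refine norm_extendIcc_sub_le ht hH ?_ ?_ hu
          · linarith [hj0 j]
          · linarith [hmono (j := j + 1) hj]) K
    have hex : ∀ c : Bool, ∃ Y : QOp (Fin ns), (c = true → M ≠ 1) →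
        discWalk (fun j => (α : ℂ)⁻¹ • extendIcc H ht (T + j * δ)) (α * δ * (N : ℕ)) N
          (pieceLo (Nat.clog 2 M) c) (K + 1) M = ((1 - α * δ * (N : ℕ) : ℝ) : ℂ) • Y ∧
        ‖Y - cond c (backward (extendIcc H ht) (T + (N : ℕ) * δ) (T + M * δ))
          (backward (extendIcc H ht) T (T + (N : ℕ) * δ))‖ ≤
          2 * ∑ j ∈ Finset.Ico (cond c N 0) (cond c M N), cellError H t h δ T j +
            3 * ((h * δ * M) ^ (K + 1) / (K + 1).factorial) := by
      intro c
      cases c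
      · obtain ⟨Y, h1, h2⟩ := key 0 N (Nat.zero_le _) (by omega)
        refine ⟨Y, fun _ => ⟨h1, ?_⟩⟩
        rw [Nat.cast_zero, zero_mul, add_zero] at h2
        exact h2
      · by_cases hM1 : M = 1
        · exact ⟨0, fun h => absurd hM1 (h rfl)⟩
        · have h2N : M ≤ N + N := by
            have hc : 0 < Nat.clog 2 M := Nat.clog_pos one_lt_two (by omega)
            have h1 := Nat.le_pow_clog one_lt_two M
            have h2 : 2 ^ Nat.clog 2 M = N + N := by
              rw [hN, ← two_mul, ← pow_succ', Nat.sub_add_cancel hc]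
            omega
          obtain ⟨Y, h1, h2⟩ := key N M hNM (by omega)
          exact ⟨Y, fun _ => ⟨h1, h2⟩⟩
    choose Y hY using hex
    refine ⟨Y, fun m m' x y => ?_, hY⟩
    rw [hU]
    by_cases hm : m = m'
    · rw [if_pos hm, if_pos hm]
      change _ = ((α : ℂ)⁻¹ • extendIcc H ht (T + m * δ)) x y
      rw [Matrix.smul_apply, extendIcc_of_mem, smul_eq_mul, div_eq_inv_mul]
      exact ⟨by linarith [hj0 m], by linarith [hmono m.2.le]⟩
    · rw [if_neg hm, if_neg hm]

/-- The truncated Dyson series circuit approximates the evolution. -/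
theorem exists_evolutionCircuit (ns na L K : ℕ) (hM : 1 ≤ M) (hL : L ≠ 0) (hα : 0 < α) (ht : 0 ≤ t)
    (hL2 : 2 * α * t ≤ L) :
    ∃ P : Circuit ns na M L (2 * na + 4 * Nat.clog 2 M + 4 * (K + 1) + 13),
      P.queries ≤ L * (6 * (K + 1)) ∧ P.gates ≤ L * (2 * pieceGates na M K) ∧
      ∀ (h : ℝ) (H : ℝ → QOp (Fin ns)) (O : Fin L → OracleOp ns na M), h ≤ α →
        IsHamiltonianOn H t → (∀ s ∈ Set.Icc 0 t, ‖H s‖ ≤ h) →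
        (∀ j : Fin L, IsHamT (fun s => H ((j : ℝ) * (t / L) + s)) (t / L) α (O j)) →
        ‖P.implemented O - timeOrderedExp H t‖ ≤
          6 * (t / L / M) * (h ^ 2 * t + ∫ s in (0 : ℝ)..t, ‖derivWithin H (Set.Icc 0 t) s‖) +
            18 * L * ((h * (t / L)) ^ (K + 1) / (K + 1).factorial) := by
  have hL0 : (0 : ℝ) < L := by exact_mod_cast Nat.pos_of_ne_zero hL
  have hM0 : (0 : ℝ) < M := by exact_mod_cast hM
  set τ := t / L with hτ
  have hτ0 : 0 ≤ τ := by positivity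
  have hLτ : L * τ = t := by
    rw [hτ]
    field_simp
  set δ := τ / M with hδ
  have hδ0 : 0 ≤ δ := by positivity
  have hMδ : M * δ = τ := by
    rw [hδ]
    field_simp
  have hατ : α * τ ≤ 1 / 2 := by
    rw [hτ, ← mul_div_assoc, div_le_iff₀ hL0]
    linarith
  set N := 2 ^ (Nat.clog 2 M - 1) with hN
  have hNM : N ≤ M := two_pow_clog_pred_le hM
  have hsmall : α * δ * M ≤ 1 / 2 := by
    rw [mul_assoc, mul_comm δ, hMδ]
    exact hατ
  have hp1 : α * δ * (N : ℕ) ≤ 1 / 2 := by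
    refine le_trans ?_ hsmall
    have : (N : ℝ) ≤ M := by exact_mod_cast hNM
    gcongr
  obtain ⟨P, hq, hg, hP⟩ := exists_circuit ns na L K hM (p := α * δ * (N : ℕ)) (by positivity) hp1
  refine ⟨P, hq, hg, fun h H O hhα hH hh hO => ?_⟩
  have hG : Continuous (extendIcc H ht) := continuous_extendIcc ht hH.differentiable.continuousOn
  have hG1 : ∀ s, ‖extendIcc H ht s‖ ≤ h := fun s => hh _ (Subtype.mem _)
  have hG2 : ∀ s, (extendIcc H ht s).IsHermitian := fun s => hH.hermitian _ (Subtype.mem _)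
  have hTt : ∀ j < L, (j : ℝ) * τ + M * δ ≤ t := fun j hj => by
    have h1 : ((j + 1 : ℕ) : ℝ) ≤ L := by exact_mod_cast hj
    have h2 : ((j + 1 : ℕ) : ℝ) * τ ≤ L * τ := by gcongr
    push_cast at h2
    linarith
  have key := hP O (fun j => (hO j).unitary) (fun j c => cond c
      (backward (extendIcc H ht) (j * τ + (N : ℕ) * δ) (j * τ + M * δ))
      (backward (extendIcc H ht) (j * τ) (j * τ + (N : ℕ) * δ)))
    (fun j c => 2 * ∑ i ∈ Finset.Ico (cond c N 0) (cond c M N), cellError H t h δ (j * τ) i +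
        3 * ((h * δ * M) ^ (K + 1) / (K + 1).factorial))
    (fun j => timeOrderedExp (extendIcc H ht) (j * τ)) (fun j => ?_) ?_ ?_
  · rw [hLτ, timeOrderedExp_extendIcc] at key
    refine key.trans (le_of_eq ?_)
    -- The factors are 6 = 3 · 2 for the Euler errors and 18 = 3 · (3 + 3) for the truncations of
    -- the two pieces; the factor 3 stems from the amplification.
    have hsum : ∀ j ∈ Finset.range L, 3 * ((2 * ∑ i ∈ Finset.Ico (cond false N 0) (cond false M N),
          cellError H t h δ (j * τ) i + 3 * ((h * δ * M) ^ (K + 1) / (K + 1).factorial)) +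
        (2 * ∑ i ∈ Finset.Ico (cond true N 0) (cond true M N),
          cellError H t h δ (j * τ) i + 3 * ((h * δ * M) ^ (K + 1) / (K + 1).factorial))) =
        6 * δ * (h ^ 2 * τ + ∫ s in (j * τ)..((j + 1 : ℕ) * τ), ‖derivWithin H (Set.Icc 0 t) s‖) +
          18 * ((h * τ) ^ (K + 1) / (K + 1).factorial) := by
      intro j hj
      have h1 := sum_cellError (h := h) hH hδ0 (by positivity : 0 ≤ (j : ℝ) * τ)
        (hTt j (Finset.mem_range.1 hj))
      rw [Finset.range_eq_Ico, ← Finset.sum_Ico_consecutive _ (Nat.zero_le N) hNM] at h1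
      have h2 : (j : ℝ) * τ + M * δ = (j + 1 : ℕ) * τ := by
        rw [hMδ]
        push_cast
        ring
      have h3 : h * δ * M = h * τ := by rw [mul_assoc, mul_comm δ, hMδ]
      have h4 : M * h ^ 2 * δ ^ 2 = δ * (h ^ 2 * τ) := by
        rw [← hMδ]
        ring
      rw [h2, h4] at h1
      rw [h3]
      simp only [cond_true, cond_false]
      linear_combination 6 * h1
    rw [Finset.sum_congr rfl hsum, Finset.sum_add_distrib, ← Finset.mul_sum, Finset.sum_add_distrib,
      Finset.sum_const, Finset.sum_const, Finset.card_range, nsmul_eq_mul, nsmul_eq_mul]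
    have hadd := intervalIntegral.sum_integral_adjacent_intervals (μ := volume)
      (f := fun s => ‖derivWithin H (Set.Icc 0 t) s‖) (a := fun j : ℕ => j * τ) (n := L) ?_
    · rw [hadd, Nat.cast_zero, zero_mul, hLτ]
      have : (L : ℝ) * (h ^ 2 * τ) = h ^ 2 * t := by
        rw [← hLτ]
        ring
      rw [this]
      ring
    · intro j hj
      refine (hH.integrable.mono_set ?_).norm
      have h1 : (j : ℝ) * τ ≤ (j + 1 : ℕ) * τ := by
        push_cast
        linarith
      have h3 := hTt j hj
      have h4 : 0 ≤ j * τ := by positivity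
      rw [Set.uIcc_of_le h1, Set.uIcc_of_le ht]
      refine Set.Icc_subset_Icc h4 ?_
      push_cast
      linarith
  · refine segmentApprox ht hH hh hM hα hhα hδ0 (by positivity) (hTt j j.2) hsmall ?_ K
    intro m m' x y
    rw [(hO j).block, hδ, mul_div_assoc]
  · rw [Nat.cast_zero, zero_mul, timeOrderedExp_zero]
  · intro j _
    have h2 : (j : ℝ) * τ + M * δ = (j + 1 : ℕ) * τ := by
      rw [hMδ]
      push_cast
      ring
    have hu : ∀ s, (timeOrderedExp (extendIcc H ht) s)ᴴ * timeOrderedExp (extendIcc H ht) s = 1 :=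
      fun s => mem_unitaryGroup_iff'.1 (timeOrderedExp_unitary hG hG1 hG2 s)
    -- The adjoints of the two backward evolutions are forward evolutions over adjacent intervals,
    -- and the product telescopes.
    simp only [cond_true, cond_false, backward, h2, Matrix.conjTranspose_mul,
      Matrix.conjTranspose_conjTranspose, Matrix.mul_assoc, hu, Matrix.mul_one]

end Segments
end DysonSim

namespace DysonSim
open Matrix MeasureTheory

/-! ### Choice of the truncation order and size of the time register. -/

section Parameters

theorem exp_one_le_log_max (r : ℝ) : Real.exp 1 ≤ Real.log (max r 16) := by
  have h1 : Real.log 16 = 4 * Real.log 2 := by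
    rw [show (16 : ℝ) = 2 ^ 4 by norm_num, Real.log_pow]
    norm_num
  have h2 : Real.log 16 ≤ Real.log (max r 16) :=
    Real.log_le_log (by norm_num) (le_max_right _ _)
  linarith [Real.log_two_gt_d9, Real.exp_one_lt_d9]

theorem one_le_logLog (r : ℝ) : 1 ≤ Real.log (Real.log (max r 16)) := by
  rw [← Real.log_exp 1]
  exact Real.log_le_log (Real.exp_pos 1) (exp_one_le_log_max r)

theorem one_le_logOverLogLog (r : ℝ) : 1 ≤ logOverLogLog r := by
  have h1 := one_le_logLog r
  rw [logOverLogLog, one_le_div (by linarith)]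
  have h2 : 0 < Real.log (max r 16) := (Real.exp_pos 1).trans_le (exp_one_le_log_max r)
  linarith [Real.log_le_sub_one_of_pos h2]

theorem logOverLogLog_le (r : ℝ) : logOverLogLog r ≤ Real.log (max r 16) := by
  have h2 : 0 < Real.log (max r 16) := (Real.exp_pos 1).trans_le (exp_one_le_log_max r)
  exact div_le_self h2.le (one_le_logLog r)

/-- With x = log max(r, 16) and y = log x, the bound n! ≥ (n/e)ⁿ reduces the claim to n(log n - 1) ≥
2x. Since n ≥ 4x/y, it suffices that log n - 1 ≥ y/2. -/
theorem sq_max_le_factorial (r : ℝ) {n : ℕ} (hn : 4 * logOverLogLog r ≤ n) :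
    (max r 16) ^ 2 ≤ n.factorial := by
  set x := Real.log (max r 16) with hx
  set y := Real.log x with hy
  have hy1 : 1 ≤ y := one_le_logLog r
  have hx0 : 0 < x := (Real.exp_pos 1).trans_le (exp_one_le_log_max r)
  have hr0 : (0 : ℝ) < max r 16 := lt_of_lt_of_le (by norm_num) (le_max_right _ _)
  have hκ0 : 0 < 4 * logOverLogLog r := by linarith [one_le_logOverLogLog r]
  have hn0 : (0 : ℝ) < n := hκ0.trans_le hn
  have hlog4 : Real.log 4 = 2 * Real.log 2 := by
    rw [show (4 : ℝ) = 2 ^ 2 by norm_num, Real.log_pow]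
    norm_num
  have hlogy : Real.log y ≤ y / 2 := by
    have h1 := Real.log_le_sub_one_of_pos (by positivity : 0 < y / 2)
    rw [Real.log_div (by positivity) two_ne_zero] at h1
    linarith [Real.log_two_lt_d9]
  have hlogκ : Real.log (4 * logOverLogLog r) = Real.log 4 + y - Real.log y := by
    rw [logOverLogLog, Real.log_mul (by norm_num) (by positivity),
      Real.log_div hx0.ne' (by positivity)]
    ring
  -- From log n ≥ log 4 + y - log y with log 4 ≥ 1 and log y ≤ y/2.
  have hlogn : 1 + y / 2 ≤ Real.log n := by
    have := Real.log_le_log hκ0 hn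
    linarith [Real.log_two_gt_d9]
  have hmain : 2 * x ≤ n * (Real.log n - 1) := by
    have h1 : 4 * logOverLogLog r * (y / 2) = 2 * x := by
      have h2 : logOverLogLog r = x / y := rfl
      rw [h2]
      field_simp
      ring
    rw [← h1]
    exact mul_le_mul hn (by linarith) (by positivity) hn0.le
  have hfac := Real.pow_div_factorial_le_exp (n : ℝ) hn0.le n
  have hf0 : (0 : ℝ) < n.factorial := by exact_mod_cast n.factorial_pos
  rw [div_le_iff₀ hf0] at hfac
  have h1 : (max r 16) ^ 2 = Real.exp (2 * x) := by
    rw [two_mul, Real.exp_add, hx, Real.exp_log hr0, sq]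
  have h2 : (n : ℝ) ^ n = Real.exp (n * Real.log n) := by
    rw [mul_comm, Real.exp_mul, Real.exp_log hn0, Real.rpow_natCast]
  rw [h1]
  calc Real.exp (2 * x) ≤ Real.exp (n * Real.log n - n) := Real.exp_le_exp.2 (by linarith)
    _ = (n : ℝ) ^ n / Real.exp n := by rw [Real.exp_sub, h2]
    _ ≤ n.factorial := by
      rw [div_le_iff₀ (Real.exp_pos _)]
      linarith

/-- A truncation order that suffices. -/
theorem exists_order {r X : ℝ} (hr : 0 < r) (hX : 0 ≤ X) :
    ∃ K : ℕ, ((K + 1 : ℕ) : ℝ) ≤ 5 * logOverLogLog r ∧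
      ((K + 1 : ℕ) : ℝ) ≤ 20 * Real.log (max X 2) ∧
      ∀ q : ℝ, 0 ≤ q → q ≤ 1 → q ^ 2 ≤ X / r →
        36 * r * q ^ (K + 1) ≤ 2 ^ K * (K + 1).factorial := by
  have hΛ : Real.log 2 ≤ Real.log (max X 2) := Real.log_le_log (by norm_num) (le_max_right _ _)
  have hl := one_le_logOverLogLog r
  -- If X² ≤ r, then q⁴ ≤ (X/r)² ≤ 1/r, so K + 1 = 4 suffices: 36 ≤ 2³ · 4!. A larger order could
  -- exceed the qubit budget, as log r is not controlled by log X here.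
  by_cases hXr : X ^ 2 ≤ r
  · refine ⟨3, ?_, ?_, fun q hq0 hq1 hq => ?_⟩
    · push_cast
      linarith
    · push_cast
      linarith [Real.log_two_gt_d9]
    · have h1 : (q ^ 2) ^ 2 ≤ (X / r) ^ 2 := by gcongr
      have h2 : r * q ^ 4 ≤ 1 := by
        calc r * q ^ 4 = r * (q ^ 2) ^ 2 := by ring
          _ ≤ r * (X / r) ^ 2 := by gcongr
          _ = X ^ 2 / r := by field_simp
          _ ≤ 1 := by rwa [div_le_one hr]
      simp [Nat.factorial]
      linarith
  · push Not at hXr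
    -- Now r < X², so a counter of length O(log r / log log r) also has length O(log X).
    have hlogr : Real.log (max r 16) ≤ 4 * Real.log (max X 2) := by
      have h4 : 4 * Real.log (max X 2) = Real.log ((max X 2) ^ 4) := by
        rw [Real.log_pow]
        norm_num
      rw [h4]
      refine Real.log_le_log (lt_of_lt_of_le (by norm_num) (le_max_right _ _)) (max_le ?_ ?_)
      · have h5 : (1 : ℝ) ≤ (max X 2) ^ 2 := by nlinarith [le_max_right X 2]
        have h6 : X ^ 2 ≤ (max X 2) ^ 2 := by
          have := le_max_left X 2
          gcongr
        nlinarith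
      · have := le_max_right X 2
        calc (16 : ℝ) = 2 ^ 4 := by norm_num
          _ ≤ _ := by gcongr
    set n := ⌈4 * logOverLogLog r⌉₊ with hn
    have hn1 : 4 * logOverLogLog r ≤ n := Nat.le_ceil _
    have hn2 : (n : ℝ) < 4 * logOverLogLog r + 1 := Nat.ceil_lt_add_one (by linarith)
    have hn4 : 4 ≤ n := by
      have : (4 : ℝ) ≤ n := by linarith
      exact_mod_cast this
    have hK : n - 1 + 1 = n := by omega
    refine ⟨n - 1, ?_, ?_, fun q hq0 hq1 _ => ?_⟩
    · rw [hK]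
      linarith
    · rw [hK]
      linarith [logOverLogLog_le r]
    · rw [hK]
      have h1 := sq_max_le_factorial r hn1
      have h2 : (2 : ℝ) ^ 3 ≤ 2 ^ (n - 1) := pow_le_pow_right₀ (by norm_num) (by omega)
      have h3 : q ^ n ≤ 1 := pow_le_one₀ hq0 hq1
      have h4 : r ≤ max r 16 := le_max_left _ _
      have h5 : (16 : ℝ) ≤ max r 16 := le_max_right _ _
      calc 36 * r * q ^ n ≤ 36 * r * 1 := by gcongr
        _ ≤ 2 ^ 3 * (max r 16) ^ 2 := by nlinarith
        _ ≤ _ := by gcongr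

/-- This is the only use of the upper bound on M; the constant C enters logarithmically, and the
rounding is absorbed by log max(X, 2) ≥ log 2. -/
theorem clog_le {M : ℕ} {C X : ℝ} (hM : 1 ≤ M) (hMX : (M : ℝ) ≤ C * max X 1) :
    (Nat.clog 2 M : ℝ) ≤ (4 + 4 * Real.log (max C 1)) * Real.log (max X 2) := by
  have hΛ : Real.log 2 ≤ Real.log (max X 2) := Real.log_le_log (by norm_num) (le_max_right _ _)
  have hC : 0 ≤ Real.log (max C 1) := Real.log_nonneg (le_max_right _ _)
  have h2 := Real.log_two_gt_d9
  have hM0 : (0 : ℝ) < M := by exact_mod_cast hM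
  have h1 : ((Nat.clog 2 M - 1 : ℕ) : ℝ) * Real.log 2 ≤ Real.log M := by
    rw [← Real.log_pow]
    refine Real.log_le_log (by positivity) ?_
    exact_mod_cast two_pow_clog_pred_le hM
  have h3 : Real.log M ≤ Real.log (max C 1) + Real.log (max X 2) := by
    rw [← Real.log_mul (by positivity) (by positivity)]
    refine Real.log_le_log hM0 (hMX.trans ?_)
    have : max X 1 ≤ max X 2 := max_le_max le_rfl (by norm_num)
    gcongr
    exact le_max_left _ _
  have h4 : (Nat.clog 2 M : ℝ) ≤ (Nat.clog 2 M - 1 : ℕ) + 1 := by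
    exact_mod_cast (by omega : Nat.clog 2 M ≤ Nat.clog 2 M - 1 + 1)
  have h5 : (0 : ℝ) ≤ (Nat.clog 2 M - 1 : ℕ) := Nat.cast_nonneg _
  nlinarith

end Parameters

/-! ### The failure probability of a nearly unitary operation. -/

section Failure

variable {n : ℕ}

theorem norm_toEuclideanLin_le (A : QOp (Fin n)) (ψ : EuclideanSpace ℂ (Label (Fin n))) :
    ‖Matrix.toEuclideanLin A ψ‖ ≤ ‖A‖ * ‖ψ‖ := Matrix.l2_opNorm_mulVec A ψ

/-- Since ‖Uψ‖ ≥ 1, the norm of Wψ is at least 1 - ε, and 1 - (1 - ε)² ≤ 2ε. For ε > 1 the bound is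
trivial. -/
theorem one_sub_sq_norm_le {W U : QOp (Fin n)} (hU : U ∈ unitaryGroup (Label (Fin n)) ℂ) {ε : ℝ}
    (hε : ‖W - U‖ ≤ ε) {ψ : EuclideanSpace ℂ (Label (Fin n))} (hψ : ‖ψ‖ = 1) :
    1 - ‖Matrix.toEuclideanLin W ψ‖ ^ 2 ≤ 2 * ε := by
  have hUψ : 1 ≤ ‖Matrix.toEuclideanLin U ψ‖ := by
    have h1 : Matrix.toEuclideanLin Uᴴ (Matrix.toEuclideanLin U ψ) = ψ := by
      have h2 : Uᴴ * U = 1 := mem_unitaryGroup_iff'.1 hU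
      ext x
      simp [Matrix.toLpLin_apply, Matrix.mulVec_mulVec, h2]
    have h3 := norm_toEuclideanLin_le Uᴴ (Matrix.toEuclideanLin U ψ)
    rw [h1, hψ, Matrix.l2_opNorm_conjTranspose] at h3
    nlinarith [norm_le_one_of_unitary hU, norm_nonneg (Matrix.toEuclideanLin U ψ)]
  have hd : ‖Matrix.toEuclideanLin W ψ - Matrix.toEuclideanLin U ψ‖ ≤ ε := by
    have h1 := norm_toEuclideanLin_le (W - U) ψ
    rw [map_sub, LinearMap.sub_apply, hψ, mul_one] at h1
    exact h1.trans hε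
  have ht := norm_sub_norm_le (Matrix.toEuclideanLin U ψ) (Matrix.toEuclideanLin W ψ)
  rw [norm_sub_rev] at ht
  rcases le_total ε 1 with h | h
  · have h1 : (1 - ε) ^ 2 ≤ ‖Matrix.toEuclideanLin W ψ‖ ^ 2 :=
      pow_le_pow_left₀ (by linarith) (by linarith) 2
    nlinarith [sq_nonneg ε]
  · nlinarith [norm_nonneg (Matrix.toEuclideanLin W ψ)]

end Failure
end DysonSim

/-! ### Final error and cost bounds, and the theorem. -/

namespace DysonSim
open Matrix MeasureTheory

theorem timeOrderedExp_unitary_of_isHamiltonianOn {n : ℕ} {H : ℝ → QOp (Fin n)} {t h : ℝ}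
    (ht : 0 ≤ t) (hH : IsHamiltonianOn H t) (hh : ∀ s ∈ Set.Icc 0 t, ‖H s‖ ≤ h) :
    timeOrderedExp H t ∈ unitaryGroup (Label (Fin n)) ℂ := by
  rw [← timeOrderedExp_extendIcc ht]
  exact timeOrderedExp_unitary (continuous_extendIcc ht hH.differentiable.continuousOn)
    (fun s => hh _ (Subtype.mem _)) (fun s => hH.hermitian _ (Subtype.mem _)) t

/-- Each of the two errors gets ε/2. The discretization error is at most ατ·ε because M ≥ 6X. In the
truncation error, hτ = (h/α)(ατ) with ατ ≤ 1/2 and L·ατ = αt, which reduces it to the hypothesis on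
K at q = h/α. -/
theorem evolution_error_le {M L K : ℕ} {α t ε D h w : ℝ} (hα : 0 < α) (ht : 0 < t) (hε : 0 < ε)
    (hD : 0 ≤ D) (hh : 0 ≤ h) (hhα : h ≤ α) (hM : 1 ≤ M) (hL : 1 ≤ L) (hL2 : 2 * α * t ≤ L)
    (hMX : 6 * stepScale α t ε D h ≤ M) (hw : w ≤ t * D)
    (hK : ∀ q : ℝ, 0 ≤ q → q ≤ 1 → q ^ 2 ≤ stepScale α t ε D h / (α * t / ε) →
      36 * (α * t / ε) * q ^ (K + 1) ≤ 2 ^ K * (K + 1).factorial) :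
    6 * (t / L / M) * (h ^ 2 * t + w) + 18 * L * ((h * (t / L)) ^ (K + 1) / (K + 1).factorial) ≤
      ε := by
  have hL0 : (0 : ℝ) < L := by exact_mod_cast hL
  have hM0 : (0 : ℝ) < M := by exact_mod_cast hM
  set τ := t / L with hτ
  have hLτ : L * τ = t := by
    rw [hτ]
    field_simp
  have hτ0 : 0 < τ := by positivity
  have hατ : α * τ ≤ 1 / 2 := by
    rw [hτ, ← mul_div_assoc, div_le_iff₀ hL0]
    linarith
  have h1 : 6 * (τ / M) * (h ^ 2 * t + w) ≤ ε / 2 := by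
    have e1 : stepScale α t ε D h * (α * ε) = t * (D + h ^ 2) := by
      rw [stepScale]
      field_simp
    have e2 : 6 * (t * (D + h ^ 2)) ≤ M * (α * ε) := by
      rw [← e1, ← mul_assoc]
      exact mul_le_mul_of_nonneg_right hMX (by positivity)
    calc 6 * (τ / M) * (h ^ 2 * t + w) ≤ 6 * (τ / M) * (t * (D + h ^ 2)) := by
          refine mul_le_mul_of_nonneg_left (by linarith) (by positivity)
      _ = (τ / M) * (6 * (t * (D + h ^ 2))) := by ring
      _ ≤ (τ / M) * (M * (α * ε)) := by gcongr
      _ = (α * τ) * ε := by field_simp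
      _ ≤ 1 / 2 * ε := by gcongr
      _ = ε / 2 := by ring
  have h2 : 18 * L * ((h * τ) ^ (K + 1) / (K + 1).factorial) ≤ ε / 2 := by
    have hq := hK (h / α) (by positivity) (by rwa [div_le_one hα]) ?_
    · have hf : (0 : ℝ) < (K + 1).factorial := by exact_mod_cast Nat.factorial_pos _
      have e1 : (h * τ) ^ (K + 1) = (h / α) ^ (K + 1) * ((α * τ) ^ K * (α * τ)) := by
        rw [← pow_succ, ← mul_pow]
        congr 1
        field_simp
      have e2 : (α * τ) ^ K ≤ (1 / 2) ^ K := by gcongr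
      have e3 : 36 * (α * t) * (h / α) ^ (K + 1) ≤ ε * (2 ^ K * (K + 1).factorial) := by
        calc 36 * (α * t) * (h / α) ^ (K + 1) = ε * (36 * (α * t / ε) * (h / α) ^ (K + 1)) := by
              field_simp
          _ ≤ _ := by gcongr
      calc 18 * L * ((h * τ) ^ (K + 1) / (K + 1).factorial) =
            18 * (h / α) ^ (K + 1) * (α * (L * τ)) * (α * τ) ^ K / (K + 1).factorial := by
            rw [e1]
            ring
        _ ≤ 18 * (h / α) ^ (K + 1) * (α * (L * τ)) * (1 / 2) ^ K / (K + 1).factorial := by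
            gcongr
        _ = (36 * (α * t) * (h / α) ^ (K + 1)) * (1 / 2) ^ K / (K + 1).factorial / 2 := by
            rw [hLτ]
            ring
        _ ≤ (ε * (2 ^ K * (K + 1).factorial)) * (1 / 2) ^ K / (K + 1).factorial / 2 := by gcongr
        _ = ε / 2 := by
            rw [one_div, inv_pow]
            field_simp
    -- Dropping D from X = (t/(αε))(D + h²) gives (h/α)² · (αt/ε) ≤ X.
    · rw [stepScale, div_pow, le_div_iff₀ (by positivity), div_mul_div_comm, div_mul_eq_mul_div,
        div_le_div_iff₀ (by positivity) (by positivity)]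
      have : h ^ 2 * (α * t) * (α * ε) ≤ (D + h ^ 2) * (α * t) * (α * ε) := by
        gcongr
        linarith
      calc _ = h ^ 2 * (α * t) * (α * ε) := by ring
        _ ≤ _ := this
        _ ≤ _ := le_of_eq (by ring)
  linarith

end DysonSim

namespace DysonSim

/-- The costs of the circuits in terms of the parameters. -/
theorem cost_bounds {na M K L q g : ℕ} {C₁ x l Λ : ℝ} (hl : 1 ≤ l)
    (hΛ : 1 / 2 ≤ Λ) (hL : (L : ℝ) ≤ 3 * max x 1) (hKl : ((K + 1 : ℕ) : ℝ) ≤ 5 * l)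
    (hKΛ : ((K + 1 : ℕ) : ℝ) ≤ 20 * Λ)
    (hb : (Nat.clog 2 M : ℝ) ≤ (4 + 4 * Real.log (max C₁ 1)) * Λ)
    (hq : q ≤ L * (6 * (K + 1))) (hg : g ≤ L * (2 * pieceGates na M K)) :
    (q : ℝ) ≤ 30 * (2000 + 844 * Real.log (max C₁ 1)) * (max x 1 * l) ∧
    (2 * na + 4 * Nat.clog 2 M + 4 * (K + 1) + 13 : ℕ) ≤
      30 * (2000 + 844 * Real.log (max C₁ 1)) * (na + Λ) ∧
    (g : ℝ) ≤ 30 * (2000 + 844 * Real.log (max C₁ 1)) * (max x 1 * (na + Λ) * l) := by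
  set c := Real.log (max C₁ 1) with hc
  have hc0 : 0 ≤ c := Real.log_nonneg (le_max_right _ _)
  set k : ℝ := ((K + 1 : ℕ) : ℝ) with hk
  have hk1 : 1 ≤ k := by
    rw [hk]
    exact_mod_cast Nat.le_add_left 1 K
  set b : ℝ := (Nat.clog 2 M : ℝ) with hbdef
  have hb0 : 0 ≤ b := Nat.cast_nonneg _
  have hx1 : 1 ≤ max x 1 := le_max_right _ _
  set m := max x 1 with hm
  have ha0 : (0 : ℝ) ≤ na := Nat.cast_nonneg _
  have hL0 : (0 : ℝ) ≤ L := Nat.cast_nonneg _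
  have hcΛ : 0 ≤ c * Λ := by positivity
  have hca : 0 ≤ c * na := by positivity
  have hanc : 2 * (na : ℝ) + 4 * b + 4 * k + 13 ≤ (2000 + 844 * c) * (na + Λ) / 2 := by
    nlinarith
  have hq' : (q : ℝ) ≤ L * (6 * k) := by
    rw [hk]
    exact_mod_cast hq
  have hg' : (g : ℝ) ≤ L * (2 * (k * (60 * na + 207 * b + 300) +
      (2 * na + 4 * b + 4 * k + 13))) := by
    rw [hk, hbdef]
    rw [pieceGates] at hg
    exact_mod_cast hg
  have hml : 1 ≤ m * l := by nlinarith
  have hLk : L * k ≤ 15 * (m * l) := by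
    calc L * k ≤ (3 * m) * (5 * l) := by gcongr
      _ = _ := by ring
  refine ⟨?_, ?_, ?_⟩
  · calc (q : ℝ) ≤ 6 * (L * k) := by linarith
      _ ≤ 90 * (m * l) := by linarith
      _ ≤ _ := by
        refine mul_le_mul_of_nonneg_right ?_ (by linarith)
        linarith
  · push_cast at hk ⊢
    rw [← hk]
    have : 0 ≤ (2000 + 844 * c) * (na + Λ) := by positivity
    linarith
  · have h1 : 60 * (na : ℝ) + 207 * b + 300 + (2 * na + 4 * b + 4 * k + 13) ≤
        (2000 + 844 * c) * (na + Λ) := by nlinarith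
    have h2 : k * (60 * na + 207 * b + 300) + (2 * na + 4 * b + 4 * k + 13) ≤
        k * ((2000 + 844 * c) * (na + Λ)) := by
      have h3 : (2 * (na : ℝ) + 4 * b + 4 * k + 13) ≤ k * (2 * na + 4 * b + 4 * k + 13) :=
        le_mul_of_one_le_left (by positivity) hk1
      calc _ ≤ k * (60 * na + 207 * b + 300 + (2 * na + 4 * b + 4 * k + 13)) := by linarith
        _ ≤ _ := by gcongr
    calc (g : ℝ) ≤ L * (2 * (k * ((2000 + 844 * c) * (na + Λ)))) := by
          refine hg'.trans ?_
          gcongr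
      _ = 2 * (L * k) * ((2000 + 844 * c) * (na + Λ)) := by ring
      _ ≤ 2 * (15 * (m * l)) * ((2000 + 844 * c) * (na + Λ)) := by gcongr
      _ = _ := by ring

end DysonSim

theorem mainTheorem2 :
    ∃ c₀ cf : ℝ, 0 < c₀ ∧ 0 < cf ∧ ∀ C₁ : ℝ, ∃ C : ℝ, 0 < C ∧
      ∀ (ns na M : ℕ) (α t ε D h : ℝ),
        0 < α → 0 ≤ t → 0 < ε → 0 ≤ D → 0 ≤ h → h ≤ α → 1 ≤ M →
        c₀ * DysonSim.stepScale α t ε D h ≤ (M : ℝ) →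
        (M : ℝ) ≤ C₁ * max (DysonSim.stepScale α t ε D h) 1 →
        ∃ (anc : ℕ) (c : DysonSim.Circuit ns na M ⌈2 * α * t⌉₊ anc),
          (c.queries : ℝ) ≤ C * (max (α * t) 1 * DysonSim.logOverLogLog (α * t / ε)) ∧
          (c.qubits : ℝ) ≤
            ns + C * (na + Real.log (max (DysonSim.stepScale α t ε D h) 2)) ∧
          (c.gates : ℝ) ≤
            C * (max (α * t) 1 *
              (na + Real.log (max (DysonSim.stepScale α t ε D h) 2)) *
              DysonSim.logOverLogLog (α * t / ε)) ∧
          ∀ (H : ℝ → DysonSim.QOp (Fin ns))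
            (O : Fin ⌈2 * α * t⌉₊ → DysonSim.OracleOp ns na M),
            DysonSim.IsHamiltonianOn H t →
            (∀ s ∈ Set.Icc 0 t, ‖H s‖ ≤ h) →
            DysonSim.avgDerivNorm H t ≤ D →
            (∀ j : Fin ⌈2 * α * t⌉₊,
              DysonSim.IsHamT
                (fun s => H ((j : ℝ) * (t / (⌈2 * α * t⌉₊ : ℝ)) + s))
                (t / (⌈2 * α * t⌉₊ : ℝ)) α (O j)) →
            ‖c.implemented O - DysonSim.timeOrderedExp H t‖ ≤ ε ∧
            ∀ ψ : EuclideanSpace ℂ (DysonSim.Label (Fin ns)), ‖ψ‖ = 1 →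
              c.failureProb O ψ ≤ cf * ε := by
  -- The constant 6 is the prefactor of the discretization error, and 2 comes from 1 - (1 - ε)² ≤
  -- 2ε.
  refine ⟨6, 2, by norm_num, by norm_num, fun C₁ => ?_⟩
  have hc0 : 0 ≤ Real.log (max C₁ 1) := Real.log_nonneg (le_max_right _ _)
  refine ⟨30 * (2000 + 844 * Real.log (max C₁ 1)), by positivity, ?_⟩
  intro ns na M α t ε D h hα ht hε hD hh hhα hM hMX hMX'
  set X := DysonSim.stepScale α t ε D h with hX
  have hX0 : 0 ≤ X := by
    rw [hX, DysonSim.stepScale]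
    positivity
  have hl := DysonSim.one_le_logOverLogLog (α * t / ε)
  have hΛ : 1 / 2 ≤ Real.log (max X 2) := by
    have h1 : Real.log 2 ≤ Real.log (max X 2) :=
      Real.log_le_log (by norm_num) (le_max_right _ _)
    linarith [Real.log_two_gt_d9]
  have hm : 1 ≤ max (α * t) 1 := le_max_right _ _
  have hna : (0 : ℝ) ≤ na := Nat.cast_nonneg _
  have hb := DysonSim.clog_le hM hMX'
  rcases ht.eq_or_lt with rfl | ht'
  -- For t = 0 there are no segments, and the empty circuit without ancillas is exact.
  · refine ⟨0, [], ?_, ?_, ?_, ?_⟩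
    · rw [DysonSim.Circuit.queries, List.map_nil, List.sum_nil, Nat.cast_zero]
      positivity
    · rw [DysonSim.Circuit.qubits, Nat.add_zero, le_add_iff_nonneg_right]
      positivity
    · rw [DysonSim.Circuit.gates, List.map_nil, List.sum_nil, Nat.cast_zero]
      positivity
    · intro H O _ _ _ _
      have hW : ‖DysonSim.Circuit.implemented O ([] : DysonSim.Circuit ns na M _ 0) -
          DysonSim.timeOrderedExp H 0‖ ≤ ε := by
        rw [DysonSim.implemented_nil, DysonSim.timeOrderedExp_zero, sub_self, norm_zero]
        exact hε.le
      refine ⟨hW, fun ψ hψ => ?_⟩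
      rw [DysonSim.timeOrderedExp_zero] at hW
      exact DysonSim.one_sub_sq_norm_le (one_mem _) hW hψ
  · have hr : 0 < α * t / ε := by positivity
    obtain ⟨K, hKl, hKΛ, hK⟩ := DysonSim.exists_order hr hX0
    have hL0 : ⌈2 * α * t⌉₊ ≠ 0 := (Nat.ceil_pos.2 (by positivity)).ne'
    have hL2 : 2 * α * t ≤ ⌈2 * α * t⌉₊ := Nat.le_ceil _
    have hL3 : (⌈2 * α * t⌉₊ : ℝ) ≤ 3 * max (α * t) 1 := by
      have h1 := Nat.ceil_lt_add_one (by positivity : 0 ≤ 2 * α * t)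
      linarith [le_max_left (α * t) 1]
    obtain ⟨P, hq, hg, hP⟩ := DysonSim.exists_evolutionCircuit ns na ⌈2 * α * t⌉₊ K hM hL0 hα ht hL2
    obtain ⟨h1, h2, h3⟩ := DysonSim.cost_bounds hl hΛ hL3 hKl hKΛ hb hq hg
    refine ⟨_, P, h1, ?_, h3, ?_⟩
    · rw [DysonSim.Circuit.qubits, Nat.cast_add]
      exact add_le_add le_rfl h2
    · intro H O hH hHh hHD hO
      have hw : ∫ s in (0 : ℝ)..t, ‖derivWithin H (Set.Icc 0 t) s‖ ≤ t * D := by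
        rw [DysonSim.avgDerivNorm, one_div, inv_mul_le_iff₀ ht'] at hHD
        exact hHD
      have hW := (hP h H O hhα hH hHh hO).trans (DysonSim.evolution_error_le hα ht' hε hD hh hhα hM
        (Nat.one_le_iff_ne_zero.2 hL0) hL2 hMX hw hK)
      exact ⟨hW, fun ψ hψ => DysonSim.one_sub_sq_norm_le
        (DysonSim.timeOrderedExp_unitary_of_isHamiltonianOn ht hH hHh) hW hψ⟩
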